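/- A \emph{circuit} is built from input variables by gates that are binary And or binary Or gates; its \emph{size} is its number of gates and its \emph{depth} is the length of a longest directed path. The \emph{And-Or path} on inputs $t=(t_0,\dots,t_{m-1})$ is $g(t)=t_0\wedge(t_1\vee(t_2\wedge(t_3\vee\cdots)))$, and the \emph{extended And-Or path} is $f(s,t)=s_0\wedge\dots\wedge s_{n-1}\wedge g(t)$. The dual $f^*$ of $f$ (or $C^*$ of a circuit $C$) arises by exchanging $\wedge$ and $\vee$. \emph{Leftist circuits.} For $\circ\in\{\wedge,\vee\}$, the leftist $\circ$-circuit on $x_0,\dots,x_{N-1}$ consists of disjoint full binary $\circ$-trees on consecutive groups of inputs whose sizes are, from left to right, the powers of two in the binary expansion of $N$ in decreasing order. For a set $K$ of inputs of a leftist circuit $S$, the \emph{boundary vertices} of $K$ are the vertices $v$ such that all inputs below $v$ lie in $K$, but this does not hold for any successor of $v$; the trees below them, ordered from left to right, form the \emph{boundary tree sequence} of $K$. A \emph{symmetric tree} on $K$ and further vertices $L$ is built by Huffman coding (repeatedly combine two vertices with smallest arrival times $a\le b$ into one with arrival time $b+1$) on the boundary vertices of $K$, each with its depth as arrival time, and on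 $L$, each vertex with its depth as arrival time. Thus the gates of $S$ are re-used. \emph{The algorithm} (Grinchuk's algorithm with symmetric trees built on leftist circuits). Let $\xi$ be a rational constant with $1.995\le\xi<2$, put $$\mu(d,n)=\xi\,\frac{2^d-n-2}{d}+2,$$ and let $d_{\min}(n,m)$ be the least $d\ge 1$ with $m\le\mu(d,n)$. Given $t=(t_0,\dots,t_{m-1})$, construct the leftist And-circuit $S_0$ on $t_0,t_2,t_4,\dots$ and the leftist Or-circuit $S_1$ on $t_1,t_3,t_5,\dots$, together with arrays containing, for each input, the vertices of the leftist circuit that have this input as their left-most input, and the largest depth of such a vertex, and, for each vertex, the index of the right-most input below it. Then apply the following recursive procedure to $f((),t)$. To realize $f(s,t)$ for current symmetric inputs $s=(s_0,\dots,s_{n-1})$ and alternating inputs $t=(t_0,\dots,t_{m-1})$ (dual functions are realized dually, with $S_1$ instead of $S_0$): \begin{enumerate} \item If $m=1$, return the symmetric tree on $s,t_0$; if $m=2$, return the symmetric tree on $s,t_0$ and $L=\{t_1\}$. \item Otherwise let $d=d_{\min}(n,m)$. If $d\le 3$ and $m\in\{3,4\}$, return the symmetric tree on $s,t_0$ and $L=\{t_1\vee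 t_2\}$, respectively $L=\{t_1\vee(t_2\wedge t_3)\}$. If $d\le3$ and $m=5$, perform an alternating split (step 5) with $k=3$. \item If $d\ge4$ and $n\ge 2^{d-1}$, choose $s'\subseteq s$ as follows (symmetric split): if the boundary tree sequence of $s$ contains a tree of depth $d-1$, let $s'$ be the set of its inputs; otherwise let $D$ be the largest depth occurring twice in the sequence, and let $s'$ consist of the inputs of all trees from the first to the second tree of depth $D$. Return $\mathrm{sym}(s')\wedge C$, where $\mathrm{sym}(s')$ is the symmetric tree on $s'$ and $C$ is the recursively computed circuit for $f(s\setminus s',t)$. \item If $d\ge 4$, $n<2^{d-1}$ and $m\le\mu(d-1,0)$, return $\mathrm{sym}(s)\wedge C$, where $C$ is the recursively computed circuit for $f((),t)$ (simple split). \item If $d\ge4$, $n<2^{d-1}$ and $m>\mu(d-1,0)$, let $k$ be the largest odd integer with $k\le\mu(d-1,n)$ and return $C_1\wedge C_2$ for the recursively computed circuits $C_1$ for $f\bigl(s,(t_0,\dots,t_{k-1})\bigr)$ and $C_2$ for $f^*\bigl((t_1,t_3,\dots,t_{k-2}),(t_k,\dots,t_{m-1})\bigr)$ (alternating split). \end{enumerate}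 Running time is counted on a machine with unit costs, where each elementary operation on numbers of $O(\log m)$ bits (with $\xi$ a fixed constant), each array access and the creation of each gate takes constant time. \textbf{Theorem.} For all $m\ge2$ and input variables $t=(t_0,\dots,t_{m-1})$, this algorithm computes a circuit $C$ for the And-Or path $g(t)$ with $$\mathrm{depth}(C)\le\log_2 m+\log_2\log_2 m+0.65\qquad\text{and}\qquad \mathrm{size}(C)\le 3.67\,m-2,$$ where all gates of $S_0$ and $S_1$ are counted, and its running time is $O(m\log_2 m)$. -/

import Mathlib

namespace AndOrPath

/-! ### Circuits over the basis consisting of binary And and binary Or -/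

inductive Op where
  | and
  | or

def Op.apply : Op → Bool → Bool → Bool
  | .and, a, b => a && b
  | .or, a, b => a || b

def Op.dual : Op → Op
  | .and => .or
  | .or => .and

/-- A gate with its operation and its two predecessor vertices. -/
structure Gate where
  op : Op
  left : ℕ
  right : ℕ

/-- A circuit. Its vertices are numbered: `0, …, inputs - 1` are the inputs, and
`inputs + i` is the `i`-th gate of the list `gates`. -/
structure Circuit where
  inputs : ℕ
  gates : List Gate
  output : ℕ

/-- Every predecessor of a gate is an input or an earlier gate, and the output is a vertex. -/
def Circuit.IsValid (C : Circuit) : Prop :=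
  (∀ (i : ℕ) (h : i < C.gates.length),
    C.gates[i].left < C.inputs + i ∧ C.gates[i].right < C.inputs + i) ∧
  C.output < C.inputs + C.gates.length

/-- Label all vertices in topological order: the inputs by `inp`, and each gate by combining
the labels of its two predecessors. -/
def Circuit.label {α : Type} (C : Circuit) (inp : ℕ → α) (comb : Op → α → α → α) : ℕ → α :=
  (C.gates.foldl
    (fun (st : ℕ × (ℕ → α)) g =>
      (st.1 + 1, Function.update st.2 st.1 (comb g.op (st.2 g.left) (st.2 g.right))))
    (C.inputs, inp)).2

/-- The number of gates (all gates, whether or not the output depends on them). -/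
def Circuit.size (C : Circuit) : ℕ := C.gates.length

/-- The length of a longest directed path ending in a vertex. -/
def Circuit.vertexDepth (C : Circuit) : ℕ → ℕ :=
  C.label (fun _ => 0) (fun _ a b => max a b + 1)

/-- The length of a longest directed path in the circuit. -/
def Circuit.depth (C : Circuit) : ℕ :=
  (Finset.range (C.inputs + C.gates.length)).sup C.vertexDepth

/-- The value at the output for the given values of the inputs. -/
def Circuit.eval (C : Circuit) (x : ℕ → Bool) : Bool :=
  C.label x Op.apply C.output

/-- `C` is a circuit that realizes the Boolean function `F` of `m` inputs. -/
def Circuit.Computes (C : Circuit) {m : ℕ} (F : (Fin m → Bool) → Bool) : Prop :=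
  C.IsValid ∧ C.inputs = m ∧
    ∀ t : Fin m → Bool, C.eval (fun i => if h : i < m then t ⟨i, h⟩ else false) = F t

/-- `t₀ ∘ (t₁ ∘' (t₂ ∘ (t₃ ∘' ⋯)))`, where `∘'` is the dual operation of `∘`. -/
def alternating : Op → List Bool → Bool
  | _, [] => true
  | _, [a] => a
  | op, a :: b :: l => op.apply a (alternating op.dual (b :: l))

/-- The And-Or path `g(t) = t₀ ∧ (t₁ ∨ (t₂ ∧ (t₃ ∨ ⋯)))`. -/
def andOrPath {m : ℕ} (t : Fin m → Bool) : Bool :=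
  alternating .and (List.ofFn t)

/-! ### Machine model

Algorithms run on a machine with unit costs: every elementary operation (arithmetic or a
comparison on numbers of `O(log m)` bits, reading or overwriting one entry of an array, list cell
operations, adding a gate to the circuit) takes constant time. Arrays are represented by functions
on `ℕ`. Between two consecutive units of running time charged below, only a bounded number of
elementary operations is executed; a list traversal that is charged a single unit is paid for by
the units charged, cell by cell, when that list is built or processed. -/

/-- The circuit under construction (`next` is the number of the next new vertex), and the elapsed
running time. -/
structure Mem where
  next : ℕ
  gates : List Gate
  time : ℕ

abbrev Alg (α : Type) : Type := StateM Mem α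

/-- Deliver `x` for one unit of running time. -/
def step {α : Type} (x : α) : Alg α := do
  modify fun M => { M with time := M.time + 1 }
  return x

/-- Add a gate to the circuit, for one unit of running time, and return its vertex. -/
def newGate (op : Op) (u v : ℕ) : Alg ℕ := do
  let M ← get
  set ({ next := M.next + 1, gates := M.gates ++ [⟨op, u, v⟩], time := M.time + 1 } : Mem)
  return M.next

/-- The array of the numbers `⌊log₂ i⌋` for `1 ≤ i ≤ N`. -/
def logTable : ℕ → Alg (ℕ → ℕ)
  | 0 => pure fun _ => 0
  | i + 1 => do
    let f ← logTable i
    step (Function.update f (i + 1) (if i = 0 then 0 else f ((i + 1) / 2) + 1))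

/-! ### Leftist circuits -/

/-- The data stored for a leftist circuit on inputs `x₀, x₁, …`: `desc i j` is the right
descendant `s_j(x_i)`, that is, the vertex of depth `j` whose left-most input is `x_i`;
`high i` is the largest `j` for which it exists; `last v` is the index of the right-most input
below the vertex `v`. -/
structure Leftist where
  desc : ℕ → ℕ → ℕ
  high : ℕ → ℕ
  last : ℕ → ℕ

/-- Store the root `v` of the full tree of depth `j` on `x_i, …, x_{i + 2 ^ j - 1}`. -/
def record (S : Leftist) (i j v : ℕ) : Alg Leftist :=
  step
    { desc := Function.update S.desc i (Function.update (S.desc i) j v)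
      high := Function.update S.high i j
      last := Function.update S.last v (i + 2 ^ j - 1) }

/-- Build the ordered full tree of depth `k` on `x_i, …, x_{i + 2 ^ k - 1}`; the input `x_i` is
the vertex `leaf i`. -/
def buildTree (op : Op) (leaf : ℕ → ℕ) : (k i : ℕ) → Leftist → Alg (ℕ × Leftist)
  | 0, i, S => do
    let S₁ ← record S i 0 (leaf i)
    return (leaf i, S₁)
  | k + 1, i, S => do
    let r₁ ← buildTree op leaf k i S
    let r₂ ← buildTree op leaf k (i + 2 ^ k) r₁.2
    let v ← newGate op r₁.1 r₂.1
    let S₃ ← record r₂.2 i (k + 1) v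
    return (v, S₃)

/-- Process the remaining `n` inputs `x_i, x_{i+1}, …`: with `k` maximum such that
`k ≤ log₂ n`, build the full tree on the next `2 ^ k` inputs. (For `n = 1`, this adds no gate.)
The first argument only bounds the number of rounds. -/
def leftistLoop (op : Op) (leaf : ℕ → ℕ) (lg : ℕ → ℕ) : (fuel i n : ℕ) → Leftist → Alg Leftist
  | 0, _, _, S => pure S
  | fuel + 1, i, n, S =>
    if n = 0 then pure S
    else do
      let k ← step (lg n)
      let r ← buildTree op leaf k i S
      leftistLoop op leaf lg fuel (i + 2 ^ k) (n - 2 ^ k) r.2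

/-- The leftist circuit on `leaf 0, …, leaf (n - 1)`, with its data. -/
def buildLeftist (op : Op) (leaf : ℕ → ℕ) (lg : ℕ → ℕ) (n : ℕ) : Alg Leftist :=
  leftistLoop op leaf lg n 0 n ⟨fun _ _ => 0, fun _ => 0, fun _ => 0⟩

/-- A tree of a boundary tree sequence: the full tree of depth `dep` below the boundary vertex
`root`, with inputs `x_start, …, x_{start + 2 ^ dep - 1}`. -/
structure BTree where
  start : ℕ
  dep : ℕ
  root : ℕ

/-- The boundary tree sequence, from left to right, of the consecutive set `{x_i, …, x_{e-1}}`.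
The first argument only bounds the number of rounds. -/
def boundaryLoop (S : Leftist) (lg : ℕ → ℕ) : (fuel i e : ℕ) → Alg (List BTree)
  | 0, _, _ => pure []
  | fuel + 1, i, e =>
    if i < e then do
      let j ← step (min (lg (e - i)) (S.high i))
      let v ← step (S.desc i j)
      let l ← boundaryLoop S lg fuel (S.last v + 1) e
      return ⟨i, j, v⟩ :: l
    else pure []

def boundary (S : Leftist) (lg : ℕ → ℕ) (i e : ℕ) : Alg (List BTree) :=
  boundaryLoop S lg (e - i) i e

/-! ### Huffman coding with integral arrival times -/

/-- Combine the first with the second vertex, the third with the fourth, and so on. An unpaired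
last vertex becomes the first entry of the result. -/
def pairUp (op : Op) : List ℕ → List ℕ → Alg (List ℕ)
  | [], acc => pure acc
  | [x], acc => step (x :: acc)
  | x :: y :: l, acc => do
    let v ← newGate op x y
    pairUp op l (v :: acc)

/-- Sort pairs of an arrival time and a vertex into buckets, and determine the maximum arrival
time. -/
def fillBuckets : List (ℕ × ℕ) → (ℕ → List ℕ) → ℕ → Alg ((ℕ → List ℕ) × ℕ)
  | [], b, A => pure (b, A)
  | p :: l, b, A => do
    let b₁ ← step (Function.update b p.1 (p.2 :: b p.1))
    fillBuckets l b₁ (max A p.1)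

/-- Process `r` consecutive arrival times, starting with `a`; `cur` holds the unpaired vertex (if
there is one) and the gates handed over from the previous arrival time. -/
def huffmanLevels (op : Op) (b : ℕ → List ℕ) : (r a : ℕ) → List ℕ → Alg (List ℕ)
  | 0, _, cur => pure cur
  | r + 1, a, cur => do
    let l ← step (cur ++ b a)
    let c ← pairUp op l []
    huffmanLevels op b r (a + 1) c

def huffmanFinish (op : Op) : (fuel : ℕ) → List ℕ → Alg ℕ
  | 0, cur => pure (cur.headD 0)
  | _ + 1, [] => pure 0
  | _ + 1, [v] => pure v
  | fuel + 1, u :: v :: l => do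
    let c ← pairUp op (u :: v :: l) []
    huffmanFinish op fuel c

/-- Huffman coding (repeatedly combine two vertices with smallest arrival times) on a non-empty
list of pairs of an arrival time and a vertex. The result is the root of the tree. -/
def huffman (op : Op) (items : List (ℕ × ℕ)) : Alg ℕ := do
  let r ← fillBuckets items (fun _ => []) 0
  let cur ← huffmanLevels op r.1 (r.2 + 1) 0 []
  huffmanFinish op cur.length cur

/-- The symmetric tree built from the trees with the given boundary tree sequence, and from further
vertices `L` with arrival times. -/
def symTree (op : Op) (B : List BTree) (L : List (ℕ × ℕ)) : Alg ℕ :=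
  huffman op (B.map (fun T => (T.dep, T.root)) ++ L)

/-! ### Splitting off a triangular subset -/

/-- Split a sequence of trees before its first tree of depth `a`. -/
def splitBefore (a : ℕ) : List BTree → Alg (List BTree × List BTree)
  | [] => pure ([], [])
  | T :: l => do
    let found ← step (decide (T.dep = a))
    if found then pure ([], T :: l)
    else do
      let r ← splitBefore a l
      return (T :: r.1, r.2)

/-- The number of trees of each depth. -/
def countDepths : List BTree → Alg (ℕ → ℕ)
  | [] => pure fun _ => 0
  | T :: l => do
    let c ← countDepths l
    step (Function.update c T.dep (c T.dep + 1))

/-- The largest `a' ≤ a` with `2 ≤ c a'`. -/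
def maxRepeated (c : ℕ → ℕ) : (a : ℕ) → Alg ℕ
  | 0 => step 0
  | a + 1 => do
    let found ← step (decide (2 ≤ c (a + 1)))
    if found then pure (a + 1) else maxRepeated c a

/-- For the boundary tree sequence `B` of a triangular set `N` with `2 ^ (d - 1) ≤ |N| < 2 ^ d`,
divide `B` into an initial part, the boundary tree sequence of the chosen subset `K`, and a final
part: `K` is a single tree of depth `d - 1`, if there is one, and otherwise reaches from the
first to the second tree of depth `D`, for the largest `D` that occurs twice. -/
def triangularSubset (B : List BTree) (d : ℕ) :
    Alg (List BTree × List BTree × List BTree) := do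
  let r ← splitBefore (d - 1) B
  match r.2 with
  | T :: l => return (r.1, [T], l)
  | [] => do
    let c ← countDepths B
    let D ← maxRepeated c (d - 2)
    let r₁ ← splitBefore D B
    match r₁.2 with
    | [] => return (r₁.1, [], [])
    | T :: l => do
      let r₂ ← splitBefore D l
      return (r₁.1, T :: r₂.1 ++ r₂.2.take 1, r₂.2.drop 1)

/-! ### The recursive algorithm -/

/-- `f(s, t)` with `n` symmetric and `m` alternating inputs is realized with depth `d` if
`m ≤ μ(d, n) = ξ (2 ^ d - n - 2) / d + 2`. -/
def mu (ξ : ℚ) (d n : ℕ) : ℚ := ξ * ((2 : ℚ) ^ d - n - 2) / d + 2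

/-- The smallest `d' ≥ d` with `m ≤ μ(d', n)`. The first argument only bounds the search. -/
def minDepth (ξ : ℚ) (n m : ℕ) : (fuel d : ℕ) → Alg ℕ
  | 0, d => pure d
  | fuel + 1, d => do
    let found ← step (decide ((m : ℚ) ≤ mu ξ d n))
    if found then pure d else minDepth ξ n m fuel (d + 1)

/-- The largest odd number that is at most `μ(d, n)` (which is at least `1` where this is used). -/
def oddPrefix (ξ : ℚ) (d n : ℕ) : Alg ℕ := do
  let k ← step ⌊mu ξ d n⌋₊
  return if k % 2 = 1 then k else k - 1

/-- The fixed data of a run on the symmetric inputs `s₀, …, s_{q-1}` (the vertices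
`0, …, q - 1`) and the alternating inputs `t₀, t₁, …` (the vertices `q, q + 1, …`):
the leftist And-circuit `S₀` on the even inputs `s₀, …, s_{q-1}, t₀, t₂, …` and the leftist
Or-circuit `S₁` on the odd inputs `t₁, t₃, …`. -/
structure Setup where
  ξ : ℚ
  q : ℕ
  lg : ℕ → ℕ
  S₀ : Leftist
  S₁ : Leftist

/-- The position of `t_i` among the inputs of its leftist circuit. -/
def position (q i : ℕ) : ℕ := if i % 2 = 0 then q + i / 2 else i / 2

/-- The recursion, realizing
`f(s, t_{j..j+m-1}) = s₀ ∧ s₁ ∧ ⋯ ∧ (t_j ∧ (t_{j+1} ∨ (t_{j+2} ∧ ⋯)))` if `j` is even, and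
its dual function if `j` is odd. Here `s` consists of the inputs at the positions
`a₁, …, b₁ - 1` and `a₂, …, e - 1` of the leftist circuit for the parity of `j`, where `e` is the
position of `t_j`. The result is the output vertex; the first argument only bounds the depth of
the recursion. -/
def grinchuk (P : Setup) : (fuel a₁ b₁ a₂ j m : ℕ) → Alg ℕ
  | 0, _, _, _, _, _ => pure 0
  | fuel + 1, a₁, b₁, a₂, j, m => do
    let e ← step (position P.q j)
    let op := if j % 2 = 0 then Op.and else Op.or
    let S := if j % 2 = 0 then P.S₀ else P.S₁
    let n := (b₁ - a₁) + (e - a₂)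
    let t : ℕ → ℕ := fun i => P.q + j + i
    -- the symmetric tree on `s`, `t_j` and `L`
    let symWith : List (ℕ × ℕ) → Alg ℕ := fun L => do
      let B₁ ← boundary S P.lg a₁ b₁
      let B₂ ← boundary S P.lg a₂ (e + 1)
      symTree op (B₁ ++ B₂) L
    -- alternating split with a prefix of `t` of odd length `k`
    let alternatingSplit : ℕ → Alg ℕ := fun k => do
      let u ← grinchuk P fuel a₁ b₁ a₂ j k
      let v ← grinchuk P fuel 0 0 (position P.q (j + 1)) (j + k) (m - k)
      newGate op u v
    if m ≤ 1 then symWith []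
    else if m = 2 then symWith [(0, t 1)]
    else do
      let d ← minDepth P.ξ n m (n + m) 1
      if d ≤ 3 then
        if m = 3 then do
          let u ← newGate op.dual (t 1) (t 2)
          symWith [(1, u)]
        else if m = 4 then do
          let u ← newGate op (t 2) (t 3)
          let v ← newGate op.dual (t 1) u
          symWith [(2, v)]
        else alternatingSplit 3
      else if 2 ^ (d - 1) ≤ n then do
        -- symmetric split
        let B₁ ← boundary S P.lg a₁ b₁
        let B₂ ← boundary S P.lg a₂ e
        let r ← triangularSubset (B₁ ++ B₂) d
        let u ← symTree op r.2.1 []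
        let a ← step ((r.1.head?.map (fun T => T.start)).getD 0)
        let b ← step ((r.1.getLast?.map (fun T => T.start + 2 ^ T.dep)).getD 0)
        let c ← step ((r.2.2.head?.map (fun T => T.start)).getD e)
        let v ← grinchuk P fuel a b c j m
        newGate op u v
      else do
        let simple ← step (decide ((m : ℚ) ≤ mu P.ξ (d - 1) 0))
        if simple then do
          -- simple split
          let B₁ ← boundary S P.lg a₁ b₁
          let B₂ ← boundary S P.lg a₂ e
          let u ← symTree op (B₁ ++ B₂) []
          let v ← grinchuk P fuel 0 0 e j m
          newGate op u v
        else do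
          let k ← oddPrefix P.ξ (d - 1) n
          alternatingSplit k

/-- The complete algorithm for `q` symmetric and `r` alternating inputs: build the leftist circuits
and their data, then run the recursion. -/
def grinchukLeftistRun (ξ : ℚ) (q r : ℕ) : Alg ℕ := do
  let lg ← logTable (q + r)
  let S₀ ← buildLeftist .and (fun p => if p < q then p else q + 2 * (p - q)) lg (q + (r + 1) / 2)
  let S₁ ← buildLeftist .or (fun p => q + (2 * p + 1)) lg (r / 2)
  grinchuk ⟨ξ, q, lg, S₀, S₁⟩ (q + r) 0 0 0 0 r

/-- The computed circuit, and the running time. -/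
def grinchukLeftist (ξ : ℚ) (q r : ℕ) : Circuit × ℕ :=
  let res := (grinchukLeftistRun ξ q r).run { next := q + r, gates := [], time := 0 }
  (⟨q + r, res.2.gates, res.1⟩, res.2.time)

end AndOrPath

namespace AndOrPath

/-! ### Running algorithms -/

/-! The proof is an induction over levels `d`, carried by `grinchuk_spec`. If a call has `n < 2 ^ d`
symmetric and `m ≤ μ(d, n)` alternating inputs, it returns a correct vertex of depth at most `d`. It
adds fewer than `B + m + extraBound d m` gates, where `B` counts the boundary trees of its symmetric
inputs. Its running time is at most a constant times `E * (2 * g + 1)`, where `g` is the number of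
new gates and `E` bounds all depths.

Depth. By Kraft's inequality, Huffman coding reaches depth `D` as soon as the sum of `2 ^ a` over
the arrival times `a` is at most `2 ^ D` (`huffman_spec`); re-using full trees does not change this
sum. Hence the direct constructions and the trees split off have the right depth. For the recursive
parts, `le_mu_symmetricSplit` and `le_mu_alternatingSplit` show that they satisfy the hypothesis at
level `d - 1`. If `d` is the least level for `m`, then `m > μ(d - 1, 0)`, so `2 ^ (d - 1)` is at
most about `m * (d - 1) / ξ`. Taking logarithms gives the depth bound (`level_le_logb`).

Size. The leftist circuits have at most `m - 2` gates. The boundary trees of an interval first grow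
and then shrink strictly in depth (`Greedy.unimodal`). Hence an interval of size between `2 ^ (d -
1)` and `2 ^ d` contains a run of consecutive boundary trees with exactly `2 ^ (d - 1)` inputs
(`triangularSubset_spec`). The trees on both sides of the run are still the boundary trees of what
remains. So a symmetric or simple split costs one gate per boundary tree that it removes. Only an
alternating split creates boundary trees: its new symmetric inputs form an interval of some length
`h` in the other leftist circuit, with at most `2 * log₂ (h + 2) - 2` boundary trees
(`sq_two_pow_le`). As `h` is of order `2 ^ d / d`, and an alternating split from level `d + 1` to
level `d` needs `m` of order at least `2 ^ d / d`, the cost per alternating input is of order `d ^ 2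
/ 2 ^ d`. This is summable over the levels, with total at most `1.67` (`extraBound_split`,
`extraBound_le`). Altogether there are at most `(m - 2) + (2.67 * m - 1)` gates.

Time. A call itself takes time `O(E)` plus the time for the boundary trees it handles. Every split
adds a gate, so the calls form a binary tree whose size is bounded by the number of gates, and `E`
is `O(log m)`. -/

/-- The result and the final memory of `p`, started in `M`, satisfy `Q`. -/
def Spec {α : Type} (p : Alg α) (M : Mem) (Q : α → Mem → Prop) : Prop :=
  Q (p.run M).1 (p.run M).2

theorem Spec.bind {α β : Type} {p : Alg α} {f : α → Alg β} {M : Mem} {Q : β → Mem → Prop}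
    (h : Spec p M fun a M' => Spec (f a) M' Q) : Spec (p >>= f) M Q := h

theorem Spec.pure {α : Type} {a : α} {M : Mem} {Q : α → Mem → Prop} (h : Q a M) :
    Spec (Pure.pure a : Alg α) M Q := h

theorem Spec.mono {α : Type} {p : Alg α} {M : Mem} {P Q : α → Mem → Prop}
    (h : Spec p M P) (hPQ : ∀ a M', P a M' → Q a M') : Spec p M Q := hPQ _ _ h

/-- Running time passes. -/
def Mem.tick (M : Mem) (k : ℕ) : Mem := { M with time := M.time + k }

theorem Spec.step {α : Type} {a : α} {M : Mem} {Q : α → Mem → Prop} (h : Q a (M.tick 1)) :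
    Spec (AndOrPath.step a) M Q := h

/-! ### Values of lists -/

/-- The operation `op` applied to a list of Boolean values. -/
def bigOp : Op → List Bool → Bool
  | .and, l => l.all id
  | .or, l => l.any id

theorem bigOp_append (op : Op) (l₁ l₂ : List Bool) :
    bigOp op (l₁ ++ l₂) = op.apply (bigOp op l₁) (bigOp op l₂) := by
  cases op <;> simp [bigOp, Op.apply]

theorem bigOp_cons (op : Op) (a : Bool) (l : List Bool) :
    bigOp op (a :: l) = op.apply a (bigOp op l) := by
  cases op <;> simp [bigOp, Op.apply]

@[simp] theorem bigOp_singleton (op : Op) (a : Bool) : bigOp op [a] = a := by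
  cases op <;> simp [bigOp]

theorem bigOp_perm (op : Op) {l₁ l₂ : List Bool} (h : l₁.Perm l₂) :
    bigOp op l₁ = bigOp op l₂ := by
  rw [Bool.eq_iff_iff]
  cases op <;> simp [bigOp, h.mem_iff]

theorem Op.apply_assoc (op : Op) (a b c : Bool) :
    op.apply (op.apply a b) c = op.apply a (op.apply b c) := by
  cases op <;> simp [Op.apply, Bool.and_assoc, Bool.or_assoc]

theorem Op.apply_comm (op : Op) (a b : Bool) : op.apply a b = op.apply b a := by
  cases op <;> simp [Op.apply, Bool.and_comm, Bool.or_comm]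

@[simp] theorem Op.apply_bigOp_nil (op : Op) (a : Bool) : op.apply a (bigOp op []) = a := by
  cases op <;> simp [Op.apply, bigOp]

@[simp] theorem Op.bigOp_nil_apply (op : Op) (a : Bool) : op.apply (bigOp op []) a = a := by
  cases op <;> simp [Op.apply, bigOp]

/-! ### Labels of the vertices of the circuit under construction -/

theorem label_fst {α : Type} (comb : Op → α → α → α) (l : List Gate) (n : ℕ) (f : ℕ → α) :
    (l.foldl (fun (st : ℕ × (ℕ → α)) g =>
      (st.1 + 1, Function.update st.2 st.1 (comb g.op (st.2 g.left) (st.2 g.right)))) (n, f)).1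
      = n + l.length := by
  induction l generalizing n f with
  | nil => simp
  | cons g l ih => simp only [List.foldl_cons, ih, List.length_cons]; omega

/-- The labels of the vertices of a list of gates on `I` inputs. -/
def labels {α : Type} (I : ℕ) (gs : List Gate) (inp : ℕ → α) (comb : Op → α → α → α) : ℕ → α :=
  (Circuit.mk I gs 0).label inp comb

theorem labels_snoc {α : Type} (I : ℕ) (gs : List Gate) (g : Gate) (inp : ℕ → α)
    (comb : Op → α → α → α) :
    labels I (gs ++ [g]) inp comb = Function.update (labels I gs inp comb) (I + gs.length)
      (comb g.op (labels I gs inp comb g.left) (labels I gs inp comb g.right)) := by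
  have := label_fst comb gs I inp
  simp only [labels, Circuit.label, List.foldl_append, List.foldl_cons, List.foldl_nil, this]

theorem labels_of_lt {α : Type} (I : ℕ) (gs : List Gate) (inp : ℕ → α)
    (comb : Op → α → α → α) (v : ℕ) (hv : v < I) : labels I gs inp comb v = inp v := by
  induction gs using List.reverseRecOn with
  | nil => rfl
  | append_singleton l a ih =>
    rw [labels_snoc, Function.update_of_ne (by omega), ih]

/-- The depth of a vertex of the circuit under construction. -/
def vdepth (I : ℕ) (M : Mem) : ℕ → ℕ :=
  labels I M.gates (fun _ => 0) (fun _ a b => max a b + 1)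

/-- The value of a vertex of the circuit under construction under the assignment `x`. -/
def value (I : ℕ) (x : ℕ → Bool) (M : Mem) : ℕ → Bool := labels I M.gates x Op.apply

@[simp] theorem value_tick (I : ℕ) (x : ℕ → Bool) (M : Mem) (k : ℕ) :
    value I x (M.tick k) = value I x M := rfl

/-- The memory holds a valid circuit on `I` inputs whose vertices have depth at most `E`. -/
structure Inv (I E : ℕ) (M : Mem) : Prop where
  next_eq : M.next = I + M.gates.length
  valid : ∀ (i : ℕ) (h : i < M.gates.length),
    M.gates[i].left < I + i ∧ M.gates[i].right < I + i
  depth_le : ∀ v < M.next, vdepth I M v ≤ E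

/-- `M'` arises from `M` by adding at most `g` gates within time `τ`. -/
structure Run (I E : ℕ) (x : ℕ → Bool) (M M' : Mem) (g τ : ℕ) : Prop where
  inv : Inv I E M'
  next_le : M.next ≤ M'.next
  depth_eq : ∀ v < M.next, vdepth I M' v = vdepth I M v
  value_eq : ∀ v < M.next, value I x M' v = value I x M v
  gates_le : M'.gates.length ≤ M.gates.length + g
  time_le : M'.time ≤ M.time + τ

/-- `v` is a vertex of depth at most `D` with value `b`. -/
structure Good (I : ℕ) (x : ℕ → Bool) (M : Mem) (v D : ℕ) (b : Bool) : Prop where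
  lt : v < M.next
  depth_le : vdepth I M v ≤ D
  value_eq : value I x M v = b

section
variable {I E : ℕ} {x : ℕ → Bool} {M M' M'' : Mem} {g g' τ τ' u v D D' : ℕ} {b c : Bool}

theorem Inv.tick (h : Inv I E M) (k : ℕ) : Inv I E (M.tick k) := ⟨h.1, h.2, h.3⟩

theorem Run.refl (h : Inv I E M) : Run I E x M M 0 0 :=
  ⟨h, le_rfl, fun _ _ => rfl, fun _ _ => rfl, le_rfl, le_rfl⟩

theorem Run.tick (h : Inv I E M) (k : ℕ) : Run I E x M (M.tick k) 0 k :=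
  ⟨h.tick k, le_rfl, fun _ _ => rfl, fun _ _ => rfl, le_rfl, le_rfl⟩

theorem Run.trans (h : Run I E x M M' g τ) (h' : Run I E x M' M'' g' τ') :
    Run I E x M M'' (g + g') (τ + τ') where
  inv := h'.inv
  next_le := h.next_le.trans h'.next_le
  depth_eq v hv := (h'.depth_eq v (hv.trans_le h.next_le)).trans (h.depth_eq v hv)
  value_eq v hv := (h'.value_eq v (hv.trans_le h.next_le)).trans (h.value_eq v hv)
  gates_le := by have := h.gates_le; have := h'.gates_le; omega
  time_le := by have := h.time_le; have := h'.time_le; omega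

theorem Run.weaken (h : Run I E x M M' g τ) (hg : g ≤ g') (ht : τ ≤ τ') :
    Run I E x M M' g' τ' :=
  ⟨h.1, h.2, h.3, h.4, h.5.trans (by omega), h.6.trans (by omega)⟩

theorem Good.run (h : Good I x M v D b) (r : Run I E x M M' g τ) : Good I x M' v D b :=
  ⟨h.lt.trans_le r.next_le, (r.depth_eq v h.lt).trans_le h.depth_le,
    (r.value_eq v h.lt).trans h.value_eq⟩

theorem Good.weaken (h : Good I x M v D b) (hD : D ≤ D') : Good I x M v D' b :=
  ⟨h.1, h.2.trans hD, h.3⟩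

theorem Good.tick (h : Good I x M v D b) (k : ℕ) : Good I x (M.tick k) v D b := ⟨h.1, h.2, h.3⟩

theorem Inv.input (h : Inv I E M) (hv : v < I) : Good I x M v 0 (x v) :=
  ⟨by rw [h.next_eq]; omega, (labels_of_lt _ _ _ _ _ hv).le, labels_of_lt _ _ _ _ _ hv⟩

theorem newGate_spec (op : Op) (h : Inv I E M) (hu : Good I x M u D b) (hv : Good I x M v D c)
    (hD : D + 1 ≤ E) :
    Spec (newGate op u v) M fun w M' =>
      Run I E x M M' 1 1 ∧ Good I x M' w (D + 1) (op.apply b c) ∧ w = M.next := by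
  set M₁ : Mem := { next := M.next + 1, gates := M.gates ++ [⟨op, u, v⟩], time := M.time + 1 }
    with hM₁
  have e₁ : ∀ w, vdepth I M₁ w = Function.update (vdepth I M) M.next
      (max (vdepth I M u) (vdepth I M v) + 1) w := by
    intro w; rw [h.next_eq]; exact congrFun (labels_snoc I M.gates ⟨op, u, v⟩ _ _) w
  have e₂ : ∀ w, value I x M₁ w = Function.update (value I x M) M.next
      (op.apply (value I x M u) (value I x M v)) w := by
    intro w; rw [h.next_eq]; exact congrFun (labels_snoc I M.gates ⟨op, u, v⟩ _ _) w
  have hd : max (vdepth I M u) (vdepth I M v) ≤ D := max_le hu.depth_le hv.depth_le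
  have hn := h.next_eq
  have r₁ : Run I E x M M₁ 1 1 := by
    refine ⟨⟨?_, ?_, ?_⟩, ?_, ?_, ?_, ?_, ?_⟩
    · simp [M₁, hn]; omega
    · intro i hi
      rcases Nat.lt_or_ge i M.gates.length with h' | h'
      · simpa [M₁, List.getElem_append_left h'] using h.valid i h'
      · have : i = M.gates.length := by simp [M₁] at hi; omega
        subst this
        have h1 := hu.lt
        have h2 := hv.lt
        simp only [M₁, List.getElem_concat_length]
        exact ⟨by omega, by omega⟩
    · intro w hw
      rw [e₁]
      by_cases hw' : w = M.next
      · subst hw'; simp only [Function.update_self]; omega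
      · rw [Function.update_of_ne hw']
        exact h.depth_le w (by simp only [M₁] at hw; omega)
    · simp [M₁]
    · intro w hw; rw [e₁, Function.update_of_ne hw.ne]
    · intro w hw; rw [e₂, Function.update_of_ne hw.ne]
    · simp [M₁]
    · simp [M₁]
  refine ⟨r₁, ⟨?_, ?_, ?_⟩, rfl⟩
  · exact Nat.lt_succ_self M.next
  · refine (e₁ M.next).trans_le ?_
    simp only [Function.update_self]; omega
  · refine (e₂ M.next).trans ?_
    simp only [Function.update_self, hu.value_eq, hv.value_eq]

end

/-! ### Huffman coding and Kraft's inequality -/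

section
variable {I E : ℕ} {x : ℕ → Bool} {M M' : Mem} {g τ : ℕ}

/-- The elements of `l` are vertices of depth at most `a`. -/
def Vertices (I : ℕ) (M : Mem) (a : ℕ) (l : List ℕ) : Prop :=
  ∀ v ∈ l, v < M.next ∧ vdepth I M v ≤ a

theorem Vertices.run {a : ℕ} {l : List ℕ} (h : Vertices I M a l) (r : Run I E x M M' g τ) :
    Vertices I M' a l := fun v hv =>
  ⟨(h v hv).1.trans_le r.next_le, (r.depth_eq v (h v hv).1).trans_le (h v hv).2⟩

theorem Vertices.good {a : ℕ} {l : List ℕ} (h : Vertices I M a l) {v : ℕ} (hv : v ∈ l) :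
    Good I x M v a (value I x M v) := ⟨(h v hv).1, (h v hv).2, rfl⟩

theorem Run.map_value {l : List ℕ} (r : Run I E x M M' g τ) (h : ∀ v ∈ l, v < M.next) :
    l.map (value I x M') = l.map (value I x M) :=
  List.map_congr_left fun v hv => r.value_eq v (h v hv)

theorem pairUp_spec (op : Op) {a : ℕ} (ha : a + 1 ≤ E) : ∀ (l acc : List ℕ) (M : Mem),
    Inv I E M → Vertices I M a l → Vertices I M (a + 1) acc →
    Spec (pairUp op l acc) M fun c M' =>
      Run I E x M M' (l.length / 2) ((l.length + 1) / 2) ∧ Vertices I M' (a + 1) c ∧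
      c.length = acc.length + (l.length + 1) / 2 ∧
      bigOp op (c.map (value I x M')) =
        op.apply (bigOp op (acc.map (value I x M))) (bigOp op (l.map (value I x M)))
  | [], acc, M, h, _, hacc => by
    unfold pairUp
    refine Spec.pure ⟨Run.refl h, hacc, by simp, by simp⟩
  | [u], acc, M, h, hl, hacc => by
    unfold pairUp
    refine Spec.step ⟨(Run.tick h 1).weaken (by simp) (by simp), ?_, by simp, ?_⟩
    · intro v hv
      rcases List.mem_cons.1 hv with rfl | hv
      · exact ⟨(hl v (by simp)).1, (hl v (by simp)).2.trans (by omega)⟩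
      · exact hacc v hv
    · rw [value_tick, List.map_cons, bigOp_cons, Op.apply_comm]; simp
  | u :: v :: l, acc, M, h, hl, hacc => by
    unfold pairUp
    refine Spec.bind ((newGate_spec (x := x) op h (hl.good (v := u) (by simp))
      (hl.good (v := v) (by simp)) ha).mono ?_)
    rintro w M₁ ⟨r₁, hw, -⟩
    have hl' : Vertices I M a l := fun y hy => hl y (by simp [hy])
    refine (pairUp_spec op ha l (w :: acc) M₁ r₁.inv (hl'.run r₁) ?_).mono ?_
    · intro y hy
      rcases List.mem_cons.1 hy with rfl | hy
      · exact ⟨hw.lt, hw.depth_le⟩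
      · exact hacc.run r₁ y hy
    · rintro c M₂ ⟨r₂, hc, hlen, hval⟩
      refine ⟨(r₁.trans r₂).weaken ?_ ?_, hc, ?_, ?_⟩
      · simp only [List.length_cons]; omega
      · simp only [List.length_cons]; omega
      · simp only [List.length_cons] at hlen ⊢; omega
      · rw [hval, List.map_cons, bigOp_cons, hw.value_eq,
          r₁.map_value (fun y hy => (hacc y hy).1), r₁.map_value (fun y hy => (hl' y hy).1)]
        simp only [List.map_cons, bigOp_cons]
        cases op <;> simp only [Op.apply] <;>
          cases value I x M u <;> cases value I x M v <;> simp

/-- A list of vertices of depth at most `min a D` that, at arrival time `a`, leaves room for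
further vertices of total weight `W` in a tree of depth `D`. -/
structure Level (I : ℕ) (M : Mem) (D a W : ℕ) (l : List ℕ) : Prop where
  vertices : Vertices I M (min a D) l
  weight_le : l.length * 2 ^ min a D + W ≤ 2 ^ D

/-- Pairing rounds the number of vertices up to an even number. This preserves the Kraft sum bound:
for `a < D`, both `W` and `2 ^ D` are multiples of `2 ^ (a + 1)`, so `l.length * 2 ^ a + W ≤ 2 ^ D`
leaves room for the rounding. For `a ≥ D` at most one vertex is left and nothing is combined, which
is why the depths are cut off at `D`. -/
theorem pairUp_level (op : Op) {D a W : ℕ} (hD : D ≤ E) (l : List ℕ) (M : Mem)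
    (h : Inv I E M) (hl : Level I M D a W l) (hW : 2 ^ (a + 1) ∣ W) :
    Spec (pairUp op l []) M fun c M' =>
      Run I E x M M' (l.length / 2) ((l.length + 1) / 2) ∧ Level I M' D (a + 1) W c ∧
      c.length = (l.length + 1) / 2 ∧
      bigOp op (c.map (value I x M')) = bigOp op (l.map (value I x M)) := by
  rcases Nat.lt_or_ge a D with haD | haD
  · refine (pairUp_spec (x := x) op (a := a) (by omega) l [] M h ?_ (by simp [Vertices])).mono ?_
    · simpa [min_eq_left haD.le] using hl.vertices
    · rintro c M' ⟨r, hc, hlen, hval⟩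
      refine ⟨r, ⟨?_, ?_⟩, by simpa using hlen, by simpa using hval⟩
      · rwa [min_eq_left (by omega)]
      · have hw := hl.weight_le
        rw [min_eq_left haD.le] at hw
        rw [min_eq_left (by omega)]
        obtain ⟨W', rfl⟩ := hW
        obtain ⟨D', rfl⟩ : ∃ D', D = a + 1 + D' := ⟨D - (a + 1), by omega⟩
        have hp : 0 < 2 ^ a := by positivity
        simp only [pow_add, pow_one] at hw ⊢
        have h2 : l.length + 2 * W' ≤ 2 * 2 ^ D' := by
          refine Nat.le_of_mul_le_mul_left ?_ hp
          nlinarith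
        have h3 : c.length + W' ≤ 2 ^ D' := by simp at hlen; omega
        nlinarith
  · have hlen : l.length ≤ 1 := by
      have hw := hl.weight_le
      rw [min_eq_right haD] at hw
      have hp : 0 < 2 ^ D := by positivity
      by_contra hc
      have : 2 * 2 ^ D ≤ l.length * 2 ^ D := Nat.mul_le_mul_right _ (by omega)
      omega
    have e : min (a + 1) D = min a D := by omega
    match l, hlen, hl with
    | [], _, hl =>
      unfold pairUp
      exact Spec.pure ⟨Run.refl h, ⟨by rw [e]; exact hl.1, by rw [e]; exact hl.2⟩, by simp, rfl⟩
    | [u], _, hl =>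
      unfold pairUp
      exact Spec.step ⟨(Run.tick h 1).weaken (by simp) (by simp), ⟨by rw [e]; exact hl.1, by rw [e]; exact hl.2⟩, by simp, rfl⟩

/-- The contents of the buckets for the arrival times `a, …, a + r - 1`. -/
def buckets (b : ℕ → List ℕ) (a r : ℕ) : List (ℕ × ℕ) :=
  (List.range' a r).flatMap fun t => (b t).map fun v => (t, v)

theorem buckets_succ (b : ℕ → List ℕ) (a r : ℕ) :
    buckets b a (r + 1) = (b a).map (fun v => (a, v)) ++ buckets b (a + 1) r := by
  simp [buckets, List.range'_succ]

theorem buckets_congr {b b' : ℕ → List ℕ} {a r : ℕ} (h : ∀ t, a ≤ t → b t = b' t) :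
    buckets b a r = buckets b' a r := by
  induction r generalizing a with
  | zero => simp [buckets]
  | succ r ih => rw [buckets_succ, buckets_succ, h a le_rfl, ih fun t ht => h t (by omega)]

theorem buckets_update (b : ℕ → List ℕ) (t v a r : ℕ) (h : a ≤ t) (h' : t < a + r) :
    (buckets (Function.update b t (v :: b t)) a r).Perm ((t, v) :: buckets b a r) := by
  induction r generalizing a with
  | zero => omega
  | succ r ih =>
    rw [buckets_succ, buckets_succ]
    by_cases hta : t = a
    · subst hta
      rw [buckets_congr (b' := b) fun s hs => Function.update_of_ne (by omega) _ _]
      simp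
    · rw [Function.update_of_ne (Ne.symm hta)]
      exact ((ih (a + 1) (by omega) (by omega)).append_left _).trans List.perm_middle

/-- The total weight of pairs of an arrival time and a vertex. -/
def weight (items : List (ℕ × ℕ)) : ℕ := (items.map fun p => 2 ^ p.1).sum

@[simp] theorem weight_nil : weight [] = 0 := rfl
@[simp] theorem weight_cons (p : ℕ × ℕ) (l : List (ℕ × ℕ)) :
    weight (p :: l) = 2 ^ p.1 + weight l := by simp [weight]
@[simp] theorem weight_append (l l' : List (ℕ × ℕ)) :
    weight (l ++ l') = weight l + weight l' := by simp [weight]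

theorem weight_map (a : ℕ) (l : List ℕ) :
    weight (l.map fun v => (a, v)) = l.length * 2 ^ a := by
  simp [weight, Function.comp_def]

theorem dvd_weight_buckets (b : ℕ → List ℕ) (c a r : ℕ) (h : c ≤ a) :
    2 ^ c ∣ weight (buckets b a r) := by
  induction r generalizing a with
  | zero => simp [buckets]
  | succ r ih =>
    rw [buckets_succ, weight_append, weight_map]
    exact dvd_add (Dvd.dvd.mul_left (pow_dvd_pow 2 h) _) (ih _ (by omega))

theorem fillBuckets_spec (R : ℕ) : ∀ (items : List (ℕ × ℕ)) (b : ℕ → List ℕ)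
    (A : ℕ) (M : Mem), Inv I E M → (∀ p ∈ items, p.1 ≤ R) → A ≤ R →
    Spec (fillBuckets items b A) M fun s M' =>
      Run I E x M M' 0 items.length ∧ A ≤ s.2 ∧ s.2 ≤ R ∧ (∀ p ∈ items, p.1 ≤ s.2) ∧
      ∀ r, (∀ p ∈ items, p.1 < r) → (buckets s.1 0 r).Perm (items ++ buckets b 0 r)
  | [], b, A, M, h, _, hA => Spec.pure ⟨Run.refl h, le_rfl, hA, by simp, by simp⟩
  | p :: l, b, A, M, h, hp, hA => by
    unfold fillBuckets
    refine Spec.bind (Spec.step ?_)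
    refine (fillBuckets_spec R l _ _ _ (h.tick 1) (fun q hq => hp q (by simp [hq]))
      (max_le hA (hp p (by simp)))).mono ?_
    rintro s M' ⟨r₁, h1, h2, h3, h4⟩
    refine ⟨((Run.tick h 1).trans r₁).weaken (by omega) (by simp; omega),
      (le_max_left _ _).trans h1, h2, ?_, ?_⟩
    · intro q hq
      rcases List.mem_cons.1 hq with rfl | hq
      · exact (le_max_right _ _).trans h1
      · exact h3 q hq
    · intro r hr
      refine (h4 r fun q hq => hr q (by simp [hq])).trans ?_
      refine ((buckets_update b p.1 p.2 0 r (by omega)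
        (by simpa using hr p (by simp))).append_left l).trans ?_
      exact List.perm_middle

/-- Each gate replaces two vertices by one, so gates plus remaining vertices never exceed the
vertices supplied. Pairing takes at most one unit more than it has gates, and fetching the bucket
takes one unit, hence `2 * r + g`. -/
theorem huffmanLevels_spec (op : Op) {D : ℕ} (hD : D ≤ E) (b : ℕ → List ℕ) :
    ∀ (r a : ℕ) (cur : List ℕ) (M : Mem), Inv I E M →
    Level I M D a (weight (buckets b a r)) cur →
    (∀ p ∈ buckets b a r, p.2 < M.next ∧ vdepth I M p.2 ≤ p.1) →
    Spec (huffmanLevels op b r a cur) M fun c M' =>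
      (∃ g, Run I E x M M' g (2 * r + g) ∧ g + c.length ≤ cur.length + (buckets b a r).length) ∧
      Level I M' D (a + r) 0 c ∧
      (0 < cur.length + (buckets b a r).length → 0 < c.length) ∧
      bigOp op (c.map (value I x M')) = op.apply (bigOp op (cur.map (value I x M)))
        (bigOp op ((buckets b a r).map fun p => value I x M p.2))
  | 0, a, cur, M, h, hc, hb => by
    unfold huffmanLevels
    refine Spec.pure ⟨⟨0, Run.refl h, by simp [buckets]⟩, ?_, by simp [buckets], by simp [buckets]⟩
    simpa [buckets] using hc
  | r + 1, a, cur, M, h, hc, hb => by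
    unfold huffmanLevels
    refine Spec.bind (Spec.step (Spec.bind ?_))
    simp only [buckets_succ] at hc hb ⊢
    have hw := hc.weight_le
    rw [weight_append, weight_map] at hw
    -- A vertex of arrival time above `D` would by itself exceed the Kraft sum.
    have hba : b a ≠ [] → a ≤ D := by
      intro hne
      have : 0 < (b a).length := List.length_pos_of_ne_nil hne
      have h2 : 2 ^ a ≤ (b a).length * 2 ^ a := Nat.le_mul_of_pos_left _ this
      exact (Nat.pow_le_pow_iff_right (by norm_num : 1 < 2)).1 (by omega)
    have hb₁ : ∀ v ∈ b a, v < M.next ∧ vdepth I M v ≤ a := fun v hv =>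
      hb (a, v) (List.mem_append_left _ (List.mem_map.2 ⟨v, hv, rfl⟩))
    have hlev : Level I (M.tick 1) D a (weight (buckets b (a + 1) r)) (cur ++ b a) := by
      refine ⟨?_, ?_⟩
      · intro v hv
        rcases List.mem_append.1 hv with hv | hv
        · exact hc.vertices v hv
        · rw [min_eq_left (hba (List.ne_nil_of_mem hv))]
          exact hb₁ v hv
      · rw [List.length_append, add_mul]
        by_cases hne : b a = []
        · simp only [hne, List.length_nil] at hw ⊢; omega
        · rw [min_eq_left (hba hne)] at hw ⊢; omega
    refine (pairUp_level (x := x) op hD _ _ (h.tick 1) hlev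
      (dvd_weight_buckets b _ _ _ le_rfl)).mono ?_
    rintro c M₁ ⟨r₁, hl₁, hlen₁, hval₁⟩
    have r₁' := (Run.tick (x := x) h 1).trans r₁
    have hb₂ : ∀ p ∈ buckets b (a + 1) r, p.2 < M.next ∧ vdepth I M p.2 ≤ p.1 := fun p hp =>
      hb p (List.mem_append_right _ hp)
    refine (huffmanLevels_spec op hD b r (a + 1) c M₁ r₁.inv hl₁ ?_).mono ?_
    · intro p hp
      have hg : Good I x M p.2 p.1 (value I x M p.2) := ⟨(hb₂ p hp).1, (hb₂ p hp).2, rfl⟩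
      exact ⟨(hg.run r₁').1, (hg.run r₁').2⟩
    · rintro c' M₂ ⟨⟨g, r₂, hg⟩, hl₂, hpos, hval₂⟩
      simp only [List.length_append, List.length_map] at hlen₁ ⊢
      refine ⟨⟨_, (r₁'.trans r₂).weaken le_rfl ?_, ?_⟩, ?_, ?_, ?_⟩
      · simp only [List.length_append]; omega
      · simp only [List.length_append]; omega
      · rw [show a + (r + 1) = a + 1 + r by omega]; exact hl₂
      · intro hp; apply hpos; omega
      · rw [hval₂, hval₁, List.map_append, List.map_append, bigOp_append, bigOp_append,
          List.map_map, ← Op.apply_assoc]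
        have e : (buckets b (a + 1) r).map (fun p => value I x M₁ p.2) =
            (buckets b (a + 1) r).map (fun p => value I x M p.2) :=
          List.map_congr_left fun p hp => r₁'.value_eq _ (hb₂ p hp).1
        rw [e]
        rfl

theorem huffmanFinish_spec (op : Op) {D : ℕ} (hD : D ≤ E) :
    ∀ (fuel a : ℕ) (cur : List ℕ) (M : Mem), Inv I E M → Level I M D a 0 cur →
    0 < cur.length → cur.length ≤ fuel + 1 →
    Spec (huffmanFinish op fuel cur) M fun v M' =>
      (∃ g, Run I E x M M' g (2 * g) ∧ g + 1 ≤ cur.length) ∧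
      Good I x M' v D (bigOp op (cur.map (value I x M)))
  | 0, a, cur, M, h, hc, hpos, hf => by
    unfold huffmanFinish
    obtain ⟨v, rfl⟩ : ∃ v, cur = [v] := List.length_eq_one_iff.1 (by omega)
    refine Spec.pure ⟨⟨0, Run.refl h, by simp⟩, ?_⟩
    have := hc.vertices v (by simp)
    exact ⟨this.1, this.2.trans (min_le_right _ _), by simp⟩
  | fuel + 1, a, [], M, h, hc, hpos, hf => by simp at hpos
  | fuel + 1, a, [v], M, h, hc, hpos, hf => by
    unfold huffmanFinish
    refine Spec.pure ⟨⟨0, Run.refl h, by simp⟩, ?_⟩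
    have := hc.vertices v (by simp)
    exact ⟨this.1, this.2.trans (min_le_right _ _), by simp⟩
  | fuel + 1, a, u :: v :: l, M, h, hc, hpos, hf => by
    unfold huffmanFinish
    refine Spec.bind ((pairUp_level (x := x) op hD _ _ h hc (by simp)).mono ?_)
    rintro c M₁ ⟨r₁, hl₁, hlen₁, hval₁⟩
    simp only [List.length_cons] at hlen₁ hf r₁
    refine (huffmanFinish_spec op hD fuel (a + 1) c M₁ r₁.inv hl₁ (by omega) (by omega)).mono ?_
    rintro w M₂ ⟨⟨g, r₂, hg⟩, hw⟩
    refine ⟨⟨_, (r₁.trans r₂).weaken le_rfl ?_, ?_⟩, ?_⟩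
    · omega
    · simp only [List.length_cons]; omega
    · rw [← hval₁]; exact hw

/-- Kraft's inequality `weight items ≤ 2 ^ D` is kept as an invariant through all arrival times. The
time consists of one unit per item for the buckets, at most `2 * (D + 1)` for the levels, and at
most two units per gate. -/
theorem huffman_spec (op : Op) {D : ℕ} (hD : D ≤ E) (items : List (ℕ × ℕ)) (h : Inv I E M)
    (hne : items ≠ []) (hg : ∀ p ∈ items, p.2 < M.next ∧ vdepth I M p.2 ≤ p.1)
    (hw : weight items ≤ 2 ^ D) :
    Spec (huffman op items) M fun v M' =>
      Run I E x M M' (items.length - 1) (3 * items.length + 2 * D + 2) ∧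
      Good I x M' v D (bigOp op (items.map fun p => value I x M p.2)) := by
  have hle : ∀ p ∈ items, p.1 ≤ D := by
    intro p hp
    have : 2 ^ p.1 ≤ weight items :=
      List.single_le_sum (by simp) _ (List.mem_map.2 ⟨p, hp, rfl⟩)
    exact (Nat.pow_le_pow_iff_right (by norm_num : 1 < 2)).1 (this.trans hw)
  unfold huffman
  refine Spec.bind ((fillBuckets_spec (x := x) D items (fun _ => []) 0 M h hle
    (Nat.zero_le _)).mono ?_)
  rintro s M₁ ⟨r₁, -, hs, hs', hperm⟩
  replace hperm := hperm (s.2 + 1) fun p hp => Nat.lt_succ_of_le (hs' p hp)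
  have e : buckets (fun _ => []) 0 (s.2 + 1) = [] := by simp [buckets]
  rw [e, List.append_nil] at hperm
  have hwe : weight (buckets s.1 0 (s.2 + 1)) = weight items := (hperm.map _).sum_eq
  refine Spec.bind ((huffmanLevels_spec (x := x) op hD s.1 (s.2 + 1) 0 [] M₁ r₁.inv
    ⟨by simp [Vertices], by simpa [hwe] using hw⟩ ?_).mono ?_)
  · intro p hp
    have hg' := hg p (hperm.mem_iff.1 hp)
    have : Good I x M p.2 p.1 (value I x M p.2) := ⟨hg'.1, hg'.2, rfl⟩
    exact ⟨(this.run r₁).1, (this.run r₁).2⟩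
  · rintro c M₂ ⟨⟨g₂, r₂, hg₂⟩, hlev, hpos, hval⟩
    rw [hperm.length_eq] at hg₂ hpos
    have hlen : 0 < items.length := List.length_pos_of_ne_nil hne
    simp only [List.length_nil] at hg₂ hpos
    refine (huffmanFinish_spec (x := x) op hD c.length _ c M₂ r₂.inv hlev (hpos (by omega))
      (by omega)).mono ?_
    rintro v M₃ ⟨⟨g₃, r₃, hg₃⟩, hv⟩
    refine ⟨((r₁.trans r₂).trans r₃).weaken (by omega) (by omega), ?_⟩
    rw [hval] at hv
    have e₂ : bigOp op ((buckets s.1 0 (s.2 + 1)).map fun p => value I x M₁ p.2) =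
        bigOp op (items.map fun p => value I x M p.2) := by
      rw [bigOp_perm op (hperm.map _)]
      congr 1
      exact List.map_congr_left fun p hp => r₁.value_eq _ (hg p hp).1
    rwa [e₂, List.map_nil, Op.bigOp_nil_apply] at hv

end

/-! ### The table of logarithms and the leftist circuits -/

section
variable {I E : ℕ} {x : ℕ → Bool} {M M' : Mem} {g τ : ℕ}

theorem logTable_spec : ∀ (N : ℕ) (M : Mem), Inv I E M →
    Spec (logTable N) M fun f M' =>
      Run I E x M M' 0 N ∧ ∀ i, 1 ≤ i → i ≤ N → f i = Nat.log 2 i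
  | 0, M, h => Spec.pure ⟨Run.refl h, fun i _ _ => by omega⟩
  | N + 1, M, h => by
    unfold logTable
    refine Spec.bind ((logTable_spec N M h).mono ?_)
    rintro f M₁ ⟨r₁, hf⟩
    refine Spec.step ⟨r₁.trans (Run.tick r₁.inv 1), ?_⟩
    intro i h1 hi
    by_cases hiN : i = N + 1
    · subst hiN
      rw [Function.update_self]
      split_ifs with h0
      · simp [h0]
      · rw [hf _ (by omega) (by omega), Nat.log_of_one_lt_of_le (n := N + 1) (by norm_num) (by omega)]
    · rw [Function.update_of_ne hiN]; exact hf i h1 (by omega)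

/-- The value of `op` on consecutive inputs `x_p, …, x_{p+n-1}` of a leftist circuit. -/
def rangeValue (op : Op) (x : ℕ → Bool) (leaf : ℕ → ℕ) (p n : ℕ) : Bool :=
  bigOp op ((List.range' p n).map fun r => x (leaf r))

theorem rangeValue_add (op : Op) (x : ℕ → Bool) (leaf : ℕ → ℕ) (p n n' : ℕ) :
    rangeValue op x leaf p (n + n') =
      op.apply (rangeValue op x leaf p n) (rangeValue op x leaf (p + n) n') := by
  rw [rangeValue, rangeValue, rangeValue, ← bigOp_append, ← List.map_append,
    List.range'_append_1]

theorem rangeValue_one (op : Op) (x : ℕ → Bool) (leaf : ℕ → ℕ) (p : ℕ) :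
    rangeValue op x leaf p 1 = x (leaf p) := by
  simp [rangeValue]

/-- `{p, …, p + 2 ^ q - 1}` is a dyadic interval contained in `{i, …, e - 1}`. -/
structure Dyadic (i e p q : ℕ) : Prop where
  le : i ≤ p
  dvd : 2 ^ q ∣ p
  add_le : p + 2 ^ q ≤ e

/-- Dyadic intervals are nested or disjoint. This lemma and the next express this for an interval
that starts inside another one. -/
theorem dyadic_lt {i k p q : ℕ} (hi : 2 ^ k ∣ i) (hp : 2 ^ q ∣ p) (h : i < p)
    (h' : p < i + 2 ^ k) : q < k := by
  by_contra hqk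
  have h1 : 2 ^ k ∣ p - i := Nat.dvd_sub ((pow_dvd_pow 2 (by omega)).trans hp) hi
  have := Nat.le_of_dvd (by omega) h1
  omega

theorem dyadic_add_le {i k p q : ℕ} (hi : 2 ^ k ∣ i) (hp : 2 ^ q ∣ p) (hq : q ≤ k)
    (h' : p < i + 2 ^ k) : p + 2 ^ q ≤ i + 2 ^ k := by
  have h0 : 2 ^ q ∣ 2 ^ k := pow_dvd_pow 2 hq
  have h1 : 2 ^ q ∣ i + 2 ^ k - p := Nat.dvd_sub (dvd_add (h0.trans hi) h0) hp
  have := Nat.le_of_dvd (by omega) h1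
  omega

/-- The stored data of a leftist circuit are correct for all full trees on inputs
from `x_i, …, x_{e-1}`. -/
structure Covers (I : ℕ) (x : ℕ → Bool) (M : Mem) (op : Op) (leaf : ℕ → ℕ) (S : Leftist)
    (i e : ℕ) : Prop where
  good : ∀ {p q}, Dyadic i e p q →
    Good I x M (S.desc p q) q (rangeValue op x leaf p (2 ^ q))
  last : ∀ {p q}, Dyadic i e p q → S.last (S.desc p q) = p + 2 ^ q - 1
  desc : ∀ {p q}, Dyadic i e p q → S.desc p q = leaf p ∨ I ≤ S.desc p q
  high : ∀ {p}, i ≤ p → p < e → Dyadic i e p (S.high p)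
  le_high : ∀ {p q}, Dyadic i e p q → q ≤ S.high p

/-- Outside of `x_i, …, x_{e-1}` and new vertices, the data `S` and `S'` coincide. -/
structure Frame (M : Mem) (leaf : ℕ → ℕ) (S S' : Leftist) (i e : ℕ) : Prop where
  desc : ∀ p, p < i ∨ e ≤ p → S'.desc p = S.desc p
  high : ∀ p, p < i ∨ e ≤ p → S'.high p = S.high p
  last : ∀ v < M.next, (∀ p, i ≤ p → p < e → v ≠ leaf p) → S'.last v = S.last v

theorem Frame.trans {leaf : ℕ → ℕ} {S S₁ S₂ : Leftist} {i c e : ℕ}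
    (h : Frame M leaf S S₁ i c) (h' : Frame M' leaf S₁ S₂ c e) (hM : M.next ≤ M'.next)
    (hic : i ≤ c) (hce : c ≤ e) : Frame M leaf S S₂ i e where
  desc p hp := (h'.desc p (by omega)).trans (h.desc p (by omega))
  high p hp := (h'.high p (by omega)).trans (h.high p (by omega))
  last v hv hl := (h'.last v (hv.trans_le hM) fun p h1 h2 => hl p (by omega) h2).trans
    (h.last v hv fun p h1 h2 => hl p h1 (by omega))

theorem Covers.run {op : Op} {leaf : ℕ → ℕ} {S : Leftist} {i e : ℕ}
    (h : Covers I x M op leaf S i e) (r : Run I E x M M' g τ) : Covers I x M' op leaf S i e :=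
  ⟨fun d => (h.good d).run r, h.last, h.desc, h.high, h.le_high⟩

/-- Building further trees to the right does not spoil the data stored so far. The delicate array is
`last`: a vertex stored for `x_p` is either `leaf p` itself or a gate, so by injectivity of `leaf`
it is none of the inputs whose entries are overwritten later. -/
theorem Covers.frame {op : Op} {leaf : ℕ → ℕ} (hleaf : Function.Injective leaf)
    {S S' : Leftist} {i c e : ℕ} (hI : ∀ p < e, leaf p < I)
    (h : Covers I x M op leaf S i c) (r : Run I E x M M' g τ) (hf : Frame M leaf S S' c e) :
    Covers I x M' op leaf S' i c := by
  have hlt : ∀ {p q}, Dyadic i c p q → p < c := fun {p q} d => by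
    have := d.add_le; have : 0 < 2 ^ q := by positivity
    omega
  have e₁ : ∀ {p q}, Dyadic i c p q → S'.desc p q = S.desc p q := fun d => by
    rw [hf.desc _ (Or.inl (hlt d))]
  refine ⟨fun d => ?_, fun d => ?_, fun d => ?_, fun h1 h2 => ?_, fun d => ?_⟩
  · rw [e₁ d]; exact (h.good d).run r
  · rw [e₁ d, hf.last _ (h.good d).lt, h.last d]
    intro p' h1 h2 he
    have := hI p' h2
    rcases h.desc d with h3 | h3
    · rw [h3] at he
      have := hleaf he
      have := hlt d
      omega
    · omega
  · rw [e₁ d]; exact h.desc d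
  · rw [hf.high _ (Or.inl h2)]; exact h.high h1 h2
  · rw [hf.high _ (Or.inl (hlt d))]; exact h.le_high d

theorem Covers.join {op : Op} {leaf : ℕ → ℕ} {S : Leftist} {i c e : ℕ} (hce : c ≤ e)
    (h : Covers I x M op leaf S i c) (h' : Covers I x M op leaf S c e)
    (hs : ∀ p q, Dyadic i e p q → p < c → p + 2 ^ q ≤ c) : Covers I x M op leaf S i e := by
  have key : ∀ {p q}, Dyadic i e p q → Dyadic i c p q ∨ Dyadic c e p q := fun {p q} d => by
    rcases Nat.lt_or_ge p c with hp | hp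
    · exact Or.inl ⟨d.1, d.2, hs p q d hp⟩
    · exact Or.inr ⟨hp, d.2, d.3⟩
  refine ⟨fun d => ?_, fun d => ?_, fun d => ?_, fun {p} h1 h2 => ?_, fun d => ?_⟩
  · exact (key d).elim (fun d => h.good d) (fun d => h'.good d)
  · exact (key d).elim (fun d => h.last d) (fun d => h'.last d)
  · exact (key d).elim (fun d => h.desc d) (fun d => h'.desc d)
  · rcases Nat.lt_or_ge p c with hp | hp
    · have d := h.high h1 hp
      exact ⟨d.1, d.2, d.3.trans hce⟩
    · have d := h'.high hp h2
      exact ⟨h1, d.2, d.3⟩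
  · exact (key d).elim (fun d => h.le_high d) (fun d => h'.le_high d)

/-- The time counts `2 ^ k` recorded leaves, and two units (creating and recording) for each of the
`2 ^ k - 1` gates. -/
theorem buildTree_spec (op : Op) {leaf : ℕ → ℕ} (hleaf : Function.Injective leaf) :
    ∀ (k i : ℕ) (S : Leftist) (M : Mem), Inv I E M → 2 ^ k ∣ i →
    (∀ p < i + 2 ^ k, leaf p < I) → k ≤ E →
    Spec (buildTree op leaf k i S) M fun r M' =>
      Run I E x M M' (2 ^ k - 1) (3 * 2 ^ k - 2) ∧
      Covers I x M' op leaf r.2 i (i + 2 ^ k) ∧ Frame M leaf S r.2 i (i + 2 ^ k) ∧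
      r.1 = r.2.desc i k
  | 0, i, S, M, h, hi, hI, hE => by
    unfold buildTree record
    refine Spec.bind (Spec.step (Spec.pure ⟨Run.tick h 1, ?_, ?_, ?_⟩))
    · have hd : ∀ {p q}, Dyadic i (i + 2 ^ 0) p q → p = i ∧ q = 0 := fun {p q} d => by
        have h1 := d.1
        have h2 := d.3
        have h3 : q < 2 ^ q := Nat.lt_two_pow_self
        omega
      refine ⟨fun {p q} d => ?_, fun {p q} d => ?_, fun {p q} d => ?_, fun {p} h1 h2 => ?_,
        fun {p q} d => ?_⟩
      · obtain ⟨rfl, rfl⟩ := hd d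
        simpa [rangeValue_one] using (h.tick 1).input (x := x) (hI p (by simp))
      · obtain ⟨rfl, rfl⟩ := hd d
        simp
      · obtain ⟨rfl, rfl⟩ := hd d
        simp
      · obtain rfl : p = i := by omega
        simp only [Function.update_self]
        exact ⟨le_rfl, by simp, le_rfl⟩
      · obtain ⟨rfl, rfl⟩ := hd d
        simp
    · refine ⟨fun p hp => ?_, fun p hp => ?_, fun v hv hl => ?_⟩
      · exact Function.update_of_ne (by omega) _ _
      · exact Function.update_of_ne (by omega) _ _
      · exact Function.update_of_ne (hl i le_rfl (by simp)) _ _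
    · simp
  | k + 1, i, S, M, h, hi, hI, hE => by
    have hpos : 0 < 2 ^ k := by positivity
    have hk2 : 2 ^ (k + 1) = 2 ^ k + 2 ^ k := by rw [pow_succ]; omega
    have hi' : 2 ^ k ∣ i := (pow_dvd_pow 2 (by omega)).trans hi
    unfold buildTree
    refine Spec.bind ((buildTree_spec op hleaf k i S M h hi'
      (fun p hp => hI p (by omega)) (by omega)).mono ?_)
    rintro ⟨v₁, S₁⟩ M₁ ⟨r₁, c₁, f₁, e₁⟩
    refine Spec.bind ((buildTree_spec op hleaf k (i + 2 ^ k) S₁ M₁ r₁.inv (dvd_add hi' dvd_rfl)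
      (fun p hp => hI p (by omega)) (by omega)).mono ?_)
    rintro ⟨v₂, S₂⟩ M₂ ⟨r₂, c₂, f₂, e₂⟩
    dsimp only at c₁ f₁ e₁ c₂ f₂ e₂ ⊢
    have c₁' := c₁.frame hleaf (fun p hp => hI p (by omega)) r₂ f₂
    have g₁ : Good I x M₂ v₁ k (rangeValue op x leaf i (2 ^ k)) := by
      rw [e₁]
      exact (c₁.good ⟨le_rfl, hi', le_rfl⟩).run r₂
    have g₂ : Good I x M₂ v₂ k (rangeValue op x leaf (i + 2 ^ k) (2 ^ k)) := by
      rw [e₂]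
      exact c₂.good ⟨le_rfl, dvd_add hi' dvd_rfl, le_rfl⟩
    refine Spec.bind ((newGate_spec op r₂.inv g₁ g₂ hE).mono ?_)
    rintro w M₃ ⟨r₃, g₃, hw⟩
    unfold record
    refine Spec.bind (Spec.step (Spec.pure ⟨(((r₁.trans r₂).trans r₃).trans
      (Run.tick r₃.inv 1)).weaken (by omega) (by omega), ?_, ?_, ?_⟩))
    · have key : ∀ {p q}, Dyadic i (i + 2 ^ (k + 1)) p q → (p = i ∧ q = k + 1) ∨
          (¬ (p = i ∧ q = k + 1) ∧ (Dyadic i (i + 2 ^ k) p q ∨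
            Dyadic (i + 2 ^ k) (i + 2 ^ k + 2 ^ k) p q)) := fun {p q} d => by
        have hq2 : 0 < 2 ^ q := by positivity
        have d3 := d.add_le
        by_cases hq : q ≤ k
        · refine Or.inr ⟨by omega, ?_⟩
          rcases Nat.lt_or_ge p (i + 2 ^ k) with hp | hp
          · exact Or.inl ⟨d.1, d.2, dyadic_add_le hi' d.2 hq hp⟩
          · exact Or.inr ⟨hp, d.2, by omega⟩
        · left
          have d1 := d.le
          have hpi : p = i := by
            by_contra hne
            have := dyadic_lt (k := k + 1) hi d.2 (by omega) (by omega)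
            have h4 : q = k + 1 ∨ q < k + 1 := by omega
            omega
          refine ⟨hpi, ?_⟩
          have : 2 ^ q ≤ 2 ^ (k + 1) := by omega
          have := (Nat.pow_le_pow_iff_right (by norm_num : 1 < 2)).1 this
          omega
      have hlt : ∀ {p q}, (Dyadic i (i + 2 ^ k) p q ∨
            Dyadic (i + 2 ^ k) (i + 2 ^ k + 2 ^ k) p q) → S₂.desc p q < M₂.next := fun d =>
        d.elim (fun d => (c₁'.good d).lt) (fun d => (c₂.good d).lt)
      have hdesc : ∀ {p q}, ¬ (p = i ∧ q = k + 1) →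
          Function.update S₂.desc i (Function.update (S₂.desc i) (k + 1) w) p q
            = S₂.desc p q := fun {p q} hn => by
        by_cases hp : p = i
        · subst hp
          rw [Function.update_self, Function.update_of_ne (by omega)]
        · rw [Function.update_of_ne hp]
      refine ⟨fun {p q} d => ?_, fun {p q} d => ?_, fun {p q} d => ?_, fun {p} h1 h2 => ?_,
        fun {p q} d => ?_⟩
      · rcases key d with ⟨rfl, rfl⟩ | ⟨hn, d'⟩
        · simp only [Function.update_self]
          rw [hk2, rangeValue_add]
          exact g₃.tick 1
        · simp only [hdesc hn]
          exact d'.elim (fun d => ((c₁'.good d).run r₃).tick 1)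
            (fun d => ((c₂.good d).run r₃).tick 1)
      · rcases key d with ⟨rfl, rfl⟩ | ⟨hn, d'⟩
        · simp only [Function.update_self]
        · simp only [hdesc hn]
          rw [Function.update_of_ne (by have := hlt d'; omega)]
          exact d'.elim (fun d => c₁'.last d) (fun d => c₂.last d)
      · rcases key d with ⟨rfl, rfl⟩ | ⟨hn, d'⟩
        · simp only [Function.update_self]
          right
          have := r₂.inv.next_eq
          omega
        · simp only [hdesc hn]
          exact d'.elim (fun d => c₁'.desc d) (fun d => c₂.desc d)
      · dsimp only
        by_cases hp : p = i
        · subst hp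
          rw [Function.update_self]
          exact ⟨le_rfl, hi, le_rfl⟩
        · rw [Function.update_of_ne hp]
          rcases Nat.lt_or_ge p (i + 2 ^ k) with hp | hp
          · have d := c₁'.high h1 hp
            exact ⟨d.1, d.2, by have := d.3; omega⟩
          · have d := c₂.high hp (by omega)
            exact ⟨by omega, d.2, by have := d.3; omega⟩
      · dsimp only
        rcases key d with ⟨rfl, rfl⟩ | ⟨hn, d'⟩
        · simp
        · by_cases hp : p = i
          · subst hp
            rw [Function.update_self]
            have d3 := d.add_le
            have : 2 ^ q ≤ 2 ^ (k + 1) := by omega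
            exact (Nat.pow_le_pow_iff_right (by norm_num : 1 < 2)).1 this
          · rw [Function.update_of_ne hp]
            exact d'.elim (fun d => c₁'.le_high d) (fun d => c₂.le_high d)
    · have f := f₁.trans f₂ r₁.next_le (by omega) (by omega)
      refine ⟨fun p hp => ?_, fun p hp => ?_, fun v hv hl => ?_⟩
      · dsimp only
        rw [Function.update_of_ne (by omega)]
        exact f.desc p (by omega)
      · dsimp only
        rw [Function.update_of_ne (by omega)]
        exact f.high p (by omega)
      · dsimp only
        have := r₁.next_le
        have := r₂.next_le
        rw [Function.update_of_ne (by omega)]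
        exact f.last v hv fun p h1 h2 => hl p h1 (by omega)
    · simp

/-- The hypothesis on `K` says that the start is aligned to a power of two exceeding the number of
remaining inputs. Hence the next block, of size `2 ^ log₂ n`, is itself aligned, and the condition
persists with that block's exponent as the new `K`. -/
theorem leftistLoop_spec (op : Op) {leaf lg : ℕ → ℕ} (hleaf : Function.Injective leaf) :
    ∀ (fuel i n : ℕ) (S : Leftist) (M : Mem), Inv I E M → n ≤ fuel →
    (∃ K, 2 ^ K ∣ i ∧ n < 2 ^ K) → (∀ r, 1 ≤ r → r ≤ n → lg r = Nat.log 2 r) →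
    (∀ p < i + n, leaf p < I) → n ≤ 2 ^ E →
    Spec (leftistLoop op leaf lg fuel i n S) M fun S' M' =>
      Run I E x M M' (n - 1) (3 * n) ∧ Covers I x M' op leaf S' i (i + n) ∧
      Frame M leaf S S' i (i + n)
  | fuel, i, 0, S, M, h, hf, hK, hlg, hI, hE => by
    have : leftistLoop op leaf lg fuel i 0 S = Pure.pure S := by
      cases fuel <;> simp [leftistLoop]
    rw [this]
    refine Spec.pure ⟨Run.refl h, ?_, ⟨fun _ _ => rfl, fun _ _ => rfl, fun _ _ _ => rfl⟩⟩
    have hd : ∀ {p q}, ¬ Dyadic i (i + 0) p q := fun {p q} d => by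
      have h1 := d.1; have h3 := d.3
      have : 0 < 2 ^ q := by positivity
      omega
    exact ⟨fun d => (hd d).elim, fun d => (hd d).elim, fun d => (hd d).elim,
      fun h1 h2 => by omega, fun d => (hd d).elim⟩
  | fuel + 1, i, n + 1, S, M, h, hf, ⟨K, hK, hnK⟩, hlg, hI, hE => by
    unfold leftistLoop
    rw [if_neg (by omega)]
    refine Spec.bind (Spec.step ?_)
    rw [hlg _ (by omega) le_rfl]
    set k := Nat.log 2 (n + 1) with hk
    have hk1 : 2 ^ k ≤ n + 1 := Nat.pow_log_le_self 2 (by omega)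
    have hk2 : n + 1 < 2 ^ (k + 1) := Nat.lt_pow_succ_log_self (by norm_num) _
    have hkK : k < K := (Nat.pow_lt_pow_iff_right (by norm_num : 1 < 2)).1 (hk1.trans_lt hnK)
    have hi : 2 ^ k ∣ i := (pow_dvd_pow 2 hkK.le).trans hK
    have hp2 : 2 ^ (k + 1) = 2 ^ k + 2 ^ k := by rw [pow_succ]; omega
    have hpos : 0 < 2 ^ k := by positivity
    refine Spec.bind ((buildTree_spec (x := x) op hleaf k i S _ (h.tick 1) hi
      (fun p hp => hI p (by omega)) ?_).mono ?_)
    · exact (Nat.pow_le_pow_iff_right (by norm_num : 1 < 2)).1 (hk1.trans hE)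
    rintro ⟨v, S₁⟩ M₁ ⟨r₁, c₁, f₁, -⟩
    refine (leftistLoop_spec op hleaf fuel (i + 2 ^ k) (n + 1 - 2 ^ k) S₁ M₁ r₁.inv (by omega)
      ⟨k, dvd_add hi dvd_rfl, by omega⟩ (fun r h1 h2 => hlg r h1 (by omega))
      (fun p hp => hI p (by omega)) (by omega)).mono ?_
    rintro S₂ M₂ ⟨r₂, c₂, f₂⟩
    have ee : i + 2 ^ k + (n + 1 - 2 ^ k) = i + (n + 1) := by omega
    rw [ee] at c₂ f₂
    have c₁' := c₁.frame hleaf hI r₂ f₂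
    have f₁' : Frame M leaf S S₁ i (i + 2 ^ k) := ⟨f₁.1, f₁.2, f₁.3⟩
    refine ⟨(((Run.tick h 1).trans r₁).trans r₂).weaken (by omega) (by omega),
      c₁'.join (by omega) c₂ ?_, f₁'.trans f₂ r₁.next_le (by omega) (by omega)⟩
    -- No dyadic interval crosses the end of the first block: one starting at `i` has size less than
    -- `2 ^ (k + 1)`, and one starting later inside the block is nested in it.
    intro p q d hp
    have d1 := d.le
    have d3 := d.add_le
    by_cases hpi : p = i
    · subst hpi
      have : 2 ^ q < 2 ^ (k + 1) := by omega
      have := (Nat.pow_lt_pow_iff_right (by norm_num : 1 < 2)).1 this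
      have : 2 ^ q ≤ 2 ^ k := Nat.pow_le_pow_right (by norm_num) (by omega)
      omega
    · exact dyadic_add_le hi d.dvd (dyadic_lt hi d.dvd (by omega) hp).le hp

theorem buildLeftist_spec (op : Op) {leaf lg : ℕ → ℕ} (hleaf : Function.Injective leaf) (n : ℕ)
    (h : Inv I E M) (hlg : ∀ r, 1 ≤ r → r ≤ n → lg r = Nat.log 2 r)
    (hI : ∀ p < n, leaf p < I) (hE : n ≤ 2 ^ E) :
    Spec (buildLeftist op leaf lg n) M fun S M' =>
      Run I E x M M' (n - 1) (3 * n) ∧ Covers I x M' op leaf S 0 n := by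
  -- The start `0` is divisible by every power of two, so `K = n` serves as initial exponent.
  refine (leftistLoop_spec (x := x) op hleaf n 0 n _ M h le_rfl ⟨n, dvd_zero _, Nat.lt_two_pow_self⟩ hlg
    (by simpa using hI) hE).mono ?_
  rintro S M' ⟨r, c, -⟩
  exact ⟨r, by simpa using c⟩

end

/-! ### Combinatorics of boundary tree sequences -/

/-- `l` is a sequence of full trees on the consecutive inputs `x_i, …, x_{e-1}`. -/
def Tiles (S : Leftist) : ℕ → ℕ → List BTree → Prop
  | i, e, [] => i = e
  | i, e, T :: l => T.start = i ∧ T.root = S.desc i T.dep ∧ 2 ^ T.dep ∣ i ∧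
      Tiles S (i + 2 ^ T.dep) e l

/-- A sequence of full trees each of which is as large as possible. -/
def Greedy (S : Leftist) : ℕ → ℕ → List BTree → Prop
  | i, e, [] => i = e
  | i, e, T :: l => T.start = i ∧ T.root = S.desc i T.dep ∧ 2 ^ T.dep ∣ i ∧ i + 2 ^ T.dep ≤ e ∧
      (∀ q, 2 ^ q ∣ i → i + 2 ^ q ≤ e → q ≤ T.dep) ∧ Greedy S (i + 2 ^ T.dep) e l

def Ascending (l : List BTree) : Prop := l.Pairwise fun T T' => T.dep < T'.dep

def Descending (l : List BTree) : Prop := l.Pairwise fun T T' => T'.dep < T.dep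

/-- The number of inputs of a sequence of full trees. -/
def treesSize (l : List BTree) : ℕ := (l.map fun T => 2 ^ T.dep).sum

@[simp] theorem treesSize_nil : treesSize [] = 0 := rfl
@[simp] theorem treesSize_cons (T : BTree) (l : List BTree) :
    treesSize (T :: l) = 2 ^ T.dep + treesSize l := by simp [treesSize]
@[simp] theorem treesSize_append (l l' : List BTree) :
    treesSize (l ++ l') = treesSize l + treesSize l' := by simp [treesSize]
@[simp] theorem treesSize_reverse (l : List BTree) : treesSize l.reverse = treesSize l := by
  simp [treesSize, List.sum_reverse]

theorem two_pow_le_iff {a b : ℕ} : 2 ^ a ≤ 2 ^ b ↔ a ≤ b :=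
  Nat.pow_le_pow_iff_right (by norm_num)

theorem two_pow_lt_iff {a b : ℕ} : 2 ^ a < 2 ^ b ↔ a < b :=
  Nat.pow_lt_pow_iff_right (by norm_num)

theorem dep_le_of_mem {l : List BTree} {T : BTree} (h : T ∈ l) : 2 ^ T.dep ≤ treesSize l :=
  List.single_le_sum (by simp) _ (List.mem_map.2 ⟨T, h, rfl⟩)

theorem Descending.bounds {l : List BTree} (h : Descending l) {p : ℕ} (hp : ∀ T ∈ l, T.dep < p) :
    l.length ≤ p ∧ treesSize l < 2 ^ p := by
  induction l generalizing p with
  | nil => simp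
  | cons T l ih =>
    obtain ⟨h1, h2⟩ := List.pairwise_cons.1 h
    obtain ⟨h3, h4⟩ := ih h2 h1
    have h5 := hp T (by simp)
    have h6 : 2 ^ (T.dep + 1) ≤ 2 ^ p := two_pow_le_iff.2 h5
    rw [pow_succ] at h6
    simp only [List.length_cons, treesSize_cons]
    omega

theorem Descending.two_pow_length_le {l : List BTree} (h : Descending l) :
    2 ^ l.length ≤ treesSize l + 1 := by
  induction l with
  | nil => simp
  | cons T l ih =>
    obtain ⟨h1, h2⟩ := List.pairwise_cons.1 h
    have h3 := (Descending.bounds h2 h1).1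
    have h4 : 2 ^ l.length ≤ 2 ^ T.dep := two_pow_le_iff.2 h3
    have := ih h2
    simp only [List.length_cons, treesSize_cons, pow_succ]
    omega

theorem Ascending.reverse {l : List BTree} (h : Ascending l) : Descending l.reverse :=
  List.pairwise_reverse.2 h

theorem Ascending.bounds {l : List BTree} (h : Ascending l) {p : ℕ} (hp : ∀ T ∈ l, T.dep < p) :
    l.length ≤ p ∧ treesSize l < 2 ^ p := by
  simpa using h.reverse.bounds (p := p) (by simpa using hp)

theorem Ascending.two_pow_length_le {l : List BTree} (h : Ascending l) :
    2 ^ l.length ≤ treesSize l + 1 := by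
  simpa using h.reverse.two_pow_length_le

/-- A strictly monotone sequence of `k` depths has at least `2 ^ k - 1` inputs. For the two monotone
parts combine this with `4 * A * B ≤ (A + B) ^ 2`. For `h` inputs and `b` trees it says `b ≤ 2 *
log₂ (h + 2) - 2`, the source of the size estimate. -/
theorem sq_two_pow_le {u w : List BTree} (hu : Ascending u) (hw : Descending w) :
    2 ^ ((u ++ w).length + 2) ≤ (treesSize (u ++ w) + 2) ^ 2 := by
  have h1 := hu.two_pow_length_le
  have h2 := hw.two_pow_length_le
  rw [List.length_append, treesSize_append, pow_add, pow_add]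
  have h3 : 2 ^ u.length + 2 ^ w.length ≤ treesSize u + treesSize w + 2 := by omega
  have h4 := Nat.pow_le_pow_left h3 2
  refine le_trans ?_ h4
  zify
  nlinarith [sq_nonneg ((2 : ℤ) ^ u.length - 2 ^ w.length)]

section
variable {S : Leftist} {i c e : ℕ} {l l' : List BTree}

theorem Tiles.size (h : Tiles S i e l) : i + treesSize l = e := by
  induction l generalizing i with
  | nil => simpa [Tiles] using h
  | cons T l ih =>
    have := ih h.2.2.2
    simp only [treesSize_cons]; omega

theorem tiles_append : Tiles S i e (l ++ l') ↔ ∃ c, Tiles S i c l ∧ Tiles S c e l' := by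
  induction l generalizing i with
  | nil => simp [Tiles]
  | cons T l ih =>
    simp only [List.cons_append, Tiles, ih]
    constructor
    · rintro ⟨h1, h2, h3, c, h4, h5⟩
      exact ⟨c, ⟨h1, h2, h3, h4⟩, h5⟩
    · rintro ⟨c, ⟨h1, h2, h3, h4⟩, h5⟩
      exact ⟨h1, h2, h3, c, h4, h5⟩

theorem Greedy.tiles (h : Greedy S i e l) : Tiles S i e l := by
  induction l generalizing i with
  | nil => exact h
  | cons T l ih => exact ⟨h.1, h.2.1, h.2.2.1, ih h.2.2.2.2.2⟩

theorem BTree.eq_of {T T' : BTree} (h₁ : T.start = T'.start) (h₂ : T.dep = T'.dep)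
    (h₃ : T.root = T'.root) : T = T' := by
  cases T; cases T'; simp_all

/-- Lets the sequence recomputed by `boundary` be identified with the one for which gates are being
counted. -/
theorem Greedy.unique (h : Greedy S i e l) (h' : Greedy S i e l') : l = l' := by
  induction l generalizing i l' with
  | nil =>
    cases l' with
    | nil => rfl
    | cons T' l' =>
      have h1 : i = e := h
      have h2 := h'.2.2.2.1
      have : 0 < 2 ^ T'.dep := by positivity
      omega
  | cons T l ih =>
    have h2 := h.2.2.2.1
    have hp : 0 < 2 ^ T.dep := by positivity
    cases l' with
    | nil =>
      have h1 : i = e := h'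
      omega
    | cons T' l' =>
      have hd : T.dep = T'.dep := le_antisymm
        (h'.2.2.2.2.1 _ h.2.2.1 h.2.2.2.1) (h.2.2.2.2.1 _ h'.2.2.1 h'.2.2.2.1)
      have hT : T = T' := BTree.eq_of (h.1.trans h'.1.symm) hd
        (by rw [h.2.1, h'.2.1, hd])
      subst hT
      rw [ih h.2.2.2.2.2 h'.2.2.2.2.2]

/-- From an aligned start only the available space limits the trees, and their sizes are the binary
digits of `e - i` in decreasing order. -/
theorem Greedy.descending (h : Greedy S i e l) {p : ℕ} (hi : 2 ^ p ∣ i) (he : e < i + 2 ^ p) :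
    Descending l ∧ ∀ T ∈ l, T.dep < p := by
  induction l generalizing i p with
  | nil => simp [Descending]
  | cons T l ih =>
    obtain ⟨-, -, h3, h4, h5, h6⟩ := h
    have hlt : T.dep < p := two_pow_lt_iff.1 (by omega)
    have he' : e < i + 2 ^ (T.dep + 1) := by
      by_contra hc
      have := h5 (T.dep + 1) ((pow_dvd_pow 2 hlt).trans hi) (by omega)
      omega
    rw [pow_succ] at he'
    obtain ⟨h7, h8⟩ := ih h6 (p := T.dep) (dvd_add h3 dvd_rfl) (by omega)
    refine ⟨List.pairwise_cons.2 ⟨h8, h7⟩, ?_⟩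
    intro T' hT'
    rcases List.mem_cons.1 hT' with rfl | hT'
    · exact hlt
    · exact (h8 T' hT').trans hlt

theorem two_pow_succ_dvd_add {k i : ℕ} (h : 2 ^ k ∣ i) (h' : ¬ 2 ^ (k + 1) ∣ i) :
    2 ^ (k + 1) ∣ i + 2 ^ k := by
  obtain ⟨r, rfl⟩ := h
  have hr : ¬ 2 ∣ r := fun ⟨s, hs⟩ => h' ⟨s, by rw [hs, pow_succ]; ring⟩
  obtain ⟨s, hs⟩ : 2 ∣ r + 1 := by omega
  exact ⟨s, by rw [pow_succ, mul_assoc, ← hs]; ring⟩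

/-- As long as a larger tree would fit, it is alignment that limits the current tree. Then the next
start is aligned to a higher power of two and the next tree is deeper, if there is space for it.
Once space becomes the limit, `Greedy.descending` applies to the rest. -/
theorem Greedy.unimodal (h : Greedy S i e l) :
    ∃ u w, l = u ++ w ∧ Ascending u ∧ Descending w := by
  induction l generalizing i with
  | nil => exact ⟨[], [], rfl, by simp [Ascending], by simp [Descending]⟩
  | cons T l ih =>
    obtain ⟨-, -, h3, h4, h5, h6⟩ := h
    by_cases he : e < i + 2 ^ (T.dep + 1)
    · rw [pow_succ] at he
      obtain ⟨h7, h8⟩ := h6.descending (p := T.dep) (dvd_add h3 dvd_rfl) (by omega)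
      exact ⟨[], T :: l, rfl, by simp [Ascending], List.pairwise_cons.2 ⟨h8, h7⟩⟩
    · have hnd : ¬ 2 ^ (T.dep + 1) ∣ i := fun hd => by
        have := h5 _ hd (by omega); omega
      have hd := two_pow_succ_dvd_add h3 hnd
      by_cases he' : e < i + 2 ^ T.dep + 2 ^ (T.dep + 1)
      · exact ⟨[T], l, rfl, by simp [Ascending], (h6.descending hd he').1⟩
      · obtain ⟨u, w, rfl, hu, hw⟩ := ih h6
        refine ⟨T :: u, w, rfl, ?_, hw⟩
        refine List.pairwise_cons.2 ⟨?_, hu⟩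
        cases u with
        | nil => simp
        | cons T' u =>
          have h7 : T.dep + 1 ≤ T'.dep := h6.2.2.2.2.1 _ hd (by omega)
          intro T'' hT''
          rcases List.mem_cons.1 hT'' with rfl | hT''
          · omega
          · have := (List.pairwise_cons.1 hu).1 T'' hT''
            omega

/-- All later trees together are smaller than the current one, so no tree of twice its size fits.
With the ascending case below, this shows that both sides of a removed middle segment are again
boundary tree sequences. -/
theorem Tiles.greedy_of_descending (h : Tiles S i e l) (hl : Descending l) : Greedy S i e l := by
  induction l generalizing i with
  | nil => exact h
  | cons T l ih =>
    have hsz := h.size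
    obtain ⟨h1, h2, h3, h4⟩ := h
    obtain ⟨h5, h6⟩ := List.pairwise_cons.1 hl
    have h7 := (Descending.bounds h6 h5).2
    rw [treesSize_cons] at hsz
    refine ⟨h1, h2, h3, by omega, fun q _ hq => ?_, ih h4 h6⟩
    have : 2 ^ q < 2 ^ (T.dep + 1) := by rw [pow_succ]; omega
    have := two_pow_lt_iff.1 this
    omega

/-- The next start is a multiple of `2 ^ (T.dep + 1)`, hence the current start is not: alignment
forbids a larger tree. -/
theorem Tiles.greedy_of_ascending (h : Tiles S i e l) (hl : Ascending l) : Greedy S i e l := by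
  induction l generalizing i with
  | nil => exact h
  | cons T l ih =>
    have hsz := h.size
    obtain ⟨h1, h2, h3, h4⟩ := h
    obtain ⟨h5, h6⟩ := List.pairwise_cons.1 hl
    rw [treesSize_cons] at hsz
    refine ⟨h1, h2, h3, by omega, fun q hqi hq => ?_, ih h4 h6⟩
    cases l with
    | nil =>
      rw [treesSize_nil] at hsz
      exact two_pow_le_iff.1 (by omega)
    | cons T' l =>
      have h7 : T.dep < T'.dep := h5 T' (by simp)
      by_contra hc
      have h8 : 2 ^ (T.dep + 1) ∣ i := (pow_dvd_pow 2 (by omega)).trans hqi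
      have h9 : 2 ^ (T.dep + 1) ∣ i + 2 ^ T.dep := (pow_dvd_pow 2 h7).trans h4.2.2.1
      have h10 := Nat.le_of_dvd (by positivity) ((Nat.dvd_add_right h8).1 h9)
      have := two_pow_le_iff.1 h10
      omega

/-- Aligned trees starting inside an aligned block cannot cross its end, so every tiling has a cut
there. -/
theorem Tiles.exists_append {k p : ℕ} (hi : 2 ^ k ∣ i) (he : i + 2 ^ k ≤ e)
    (h : Tiles S p e l) (hp : i < p) (hp' : p ≤ i + 2 ^ k) :
    ∃ l₁ l₂, l = l₁ ++ l₂ ∧ Tiles S (i + 2 ^ k) e l₂ := by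
  induction l generalizing p with
  | nil =>
    have : p = e := h
    exact ⟨[], [], rfl, by simp only [Tiles]; omega⟩
  | cons T l ih =>
    by_cases hpk : p = i + 2 ^ k
    · exact ⟨[], T :: l, rfl, hpk ▸ h⟩
    · obtain ⟨h1, h2, h3, h4⟩ := h
      have hlt := dyadic_lt hi h3 hp (by omega)
      have hle := dyadic_add_le hi h3 hlt.le (by omega)
      obtain ⟨l₁, l₂, rfl, h5⟩ := ih h4 (by omega) hle
      exact ⟨T :: l₁, l₂, rfl, h5⟩

/-- The greedy sequence is a shortest tiling. This is used to see that adding `t_j` to the symmetric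
inputs adds at most one boundary tree. -/
theorem Greedy.length_le (h : Greedy S i e l) (h' : Tiles S i e l') : l.length ≤ l'.length := by
  induction l generalizing i l' with
  | nil => simp
  | cons T l ih =>
    obtain ⟨-, -, h3, h4, h5, h6⟩ := h
    have hp : 0 < 2 ^ T.dep := by positivity
    cases l' with
    | nil =>
      have : i = e := h'
      omega
    | cons T' l' =>
      have hsz := h'.size
      obtain ⟨-, -, h7, h8⟩ := h'
      rw [treesSize_cons] at hsz
      have hle : T'.dep ≤ T.dep := h5 _ h7 (by omega)
      have hle' : 2 ^ T'.dep ≤ 2 ^ T.dep := two_pow_le_iff.2 hle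
      have hp' : 0 < 2 ^ T'.dep := by positivity
      obtain ⟨l₁, l₂, rfl, h9⟩ := Tiles.exists_append h3 h4 h8 (by omega) (by omega)
      have := ih h6 h9
      simp only [List.length_cons, List.length_append]
      omega

theorem Greedy.le (h : Greedy S i e l) : i ≤ e := by
  have := h.tiles.size; omega

end

/-! ### Computing boundary tree sequences and symmetric trees -/

section
variable {I E : ℕ} {x : ℕ → Bool} {M M' : Mem} {op : Op} {leaf lg : ℕ → ℕ} {S : Leftist} {N : ℕ}

/-- The trees with left-most input `x_i` have all depths up to `high i`, so the minimum with the
logarithm of the remaining length is the greedy choice. Two units are spent per tree and no gate is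
created. -/
theorem boundaryLoop_spec (hS : Covers I x M' op leaf S 0 N)
    (hlg : ∀ r, 1 ≤ r → r ≤ N → lg r = Nat.log 2 r) :
    ∀ (fuel i e : ℕ) (M : Mem), i ≤ e → e ≤ N → e - i ≤ fuel →
    Spec (boundaryLoop S lg fuel i e) M fun l M₁ =>
      M₁ = M.tick (2 * l.length) ∧ Greedy S i e l
  | 0, i, e, M, hie, heN, hf => Spec.pure ⟨rfl, by simp only [Greedy]; omega⟩
  | fuel + 1, i, e, M, hie, heN, hf => by
    unfold boundaryLoop
    split_ifs with h
    · refine Spec.bind (Spec.step (Spec.bind (Spec.step ?_)))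
      rw [hlg _ (by omega) (by omega)]
      set j := min (Nat.log 2 (e - i)) (S.high i) with hj
      have hh := hS.high (Nat.zero_le i) (show i < N by omega)
      have hpow : 2 ^ j ≤ e - i :=
        (two_pow_le_iff.2 (min_le_left _ _)).trans (Nat.pow_log_le_self 2 (by omega))
      have hdvd : 2 ^ j ∣ i := (pow_dvd_pow 2 (min_le_right _ _)).trans hh.dvd
      have hpos : 0 < 2 ^ j := by positivity
      rw [hS.last ⟨Nat.zero_le _, hdvd, by omega⟩]
      rw [show i + 2 ^ j - 1 + 1 = i + 2 ^ j by omega]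
      refine Spec.bind ((boundaryLoop_spec hS hlg fuel (i + 2 ^ j) e _ (by omega) heN
        (by omega)).mono ?_)
      rintro l M₁ ⟨rfl, hl⟩
      refine Spec.pure ⟨?_, rfl, rfl, hdvd, by dsimp only; omega, ?_, hl⟩
      · simp only [Mem.tick, List.length_cons]
        congr 1
        omega
      · intro q hq hqe
        refine le_min ?_ (hS.le_high ⟨Nat.zero_le _, hq, by omega⟩)
        exact Nat.le_log_of_pow_le (by norm_num) (by omega)
    · exact Spec.pure ⟨rfl, by simp only [Greedy]; omega⟩

theorem boundary_spec (hS : Covers I x M' op leaf S 0 N)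
    (hlg : ∀ r, 1 ≤ r → r ≤ N → lg r = Nat.log 2 r) {i e : ℕ} (hie : i ≤ e) (heN : e ≤ N) :
    Spec (boundary S lg i e) M fun l M₁ => M₁ = M.tick (2 * l.length) ∧ Greedy S i e l :=
  boundaryLoop_spec hS hlg (e - i) i e M hie heN le_rfl

theorem Tiles.vertices (hS : Covers I x M op leaf S 0 N) {i e : ℕ} {l : List BTree}
    (h : Tiles S i e l) (heN : e ≤ N) :
    ∀ T ∈ l, T.root < M.next ∧ vdepth I M T.root ≤ T.dep := by
  induction l generalizing i with
  | nil => simp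
  | cons T l ih =>
    have hsz := h.size
    obtain ⟨-, h2, h3, h4⟩ := h
    rw [treesSize_cons] at hsz
    intro T' hT'
    rcases List.mem_cons.1 hT' with rfl | hT'
    · rw [h2]
      have := hS.good (p := i) (q := T'.dep) ⟨Nat.zero_le _, h3, by omega⟩
      exact ⟨this.1, this.2⟩
    · exact ih h4 T' hT'

theorem Tiles.bigOp_eq (hS : Covers I x M op leaf S 0 N) {i e : ℕ} {l : List BTree}
    (h : Tiles S i e l) (heN : e ≤ N) :
    bigOp op (l.map fun T => value I x M T.root) = rangeValue op x leaf i (e - i) := by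
  induction l generalizing i with
  | nil =>
    have : i = e := h
    simp [this, rangeValue]
  | cons T l ih =>
    have hsz := h.size
    obtain ⟨-, h2, h3, h4⟩ := h
    rw [treesSize_cons] at hsz
    have hg := hS.good (p := i) (q := T.dep) ⟨Nat.zero_le _, h3, by omega⟩
    rw [List.map_cons, bigOp_cons, ih h4, h2, hg.value_eq,
      show e - i = 2 ^ T.dep + (e - (i + 2 ^ T.dep)) by omega, rangeValue_add]

theorem symTree_spec {D : ℕ} (hD : D ≤ E) (h : Inv I E M) (B : List BTree) (L : List (ℕ × ℕ))
    (hne : 0 < B.length + L.length) (hB : ∀ T ∈ B, T.root < M.next ∧ vdepth I M T.root ≤ T.dep)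
    (hL : ∀ p ∈ L, p.2 < M.next ∧ vdepth I M p.2 ≤ p.1)
    (hw : treesSize B + weight L ≤ 2 ^ D) :
    Spec (symTree op B L) M fun v M' =>
      Run I E x M M' (B.length + L.length - 1) (3 * (B.length + L.length) + 2 * D + 2) ∧
      Good I x M' v D (op.apply (bigOp op (B.map fun T => value I x M T.root))
        (bigOp op (L.map fun p => value I x M p.2))) := by
  have := huffman_spec (x := x) op hD (B.map (fun T => (T.dep, T.root)) ++ L) h ?_ ?_ ?_
  · simp only [List.length_append, List.length_map, List.map_append, bigOp_append,
      List.map_map] at this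
    exact this
  · intro h0
    have := congrArg List.length h0
    simp at this
    simp [this] at hne
  · intro p hp
    rcases List.mem_append.1 hp with hp | hp
    · obtain ⟨T, hT, rfl⟩ := List.mem_map.1 hp
      exact hB T hT
    · exact hL p hp
  · have e : weight (B.map fun T => (T.dep, T.root)) = treesSize B := by
      simp [weight, treesSize, Function.comp_def]
    rwa [weight_append, e]

end

/-! ### Splitting off a triangular subset -/

section
variable {M : Mem}

theorem splitBefore_spec (a : ℕ) : ∀ (l : List BTree) (M : Mem),
    Spec (splitBefore a l) M fun r M' => (∃ k ≤ l.length, M' = M.tick k) ∧ l = r.1 ++ r.2 ∧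
      (∀ T ∈ r.1, T.dep ≠ a) ∧ ∀ T l', r.2 = T :: l' → T.dep = a
  | [], M => Spec.pure ⟨⟨0, le_rfl, rfl⟩, rfl, by simp, by simp⟩
  | T :: l, M => by
    unfold splitBefore
    refine Spec.bind (Spec.step ?_)
    by_cases h : T.dep = a
    · simp only [h, decide_true, if_true]
      refine Spec.pure ⟨⟨1, by simp, rfl⟩, rfl, by simp, ?_⟩
      rintro T' l' he
      obtain ⟨rfl, -⟩ := List.cons.inj he
      exact h
    · simp only [h, decide_false, Bool.false_eq_true, if_false]
      refine Spec.bind ((splitBefore_spec a l _).mono ?_)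
      rintro r M₁ ⟨⟨k, hk, rfl⟩, h1, h2, h3⟩
      refine Spec.pure ⟨⟨1 + k, by simp; omega, ?_⟩, ?_, ?_, h3⟩
      · simp [Mem.tick, add_assoc]
      · simp [← h1]
      · intro T' hT'
        rcases List.mem_cons.1 hT' with rfl | hT'
        · exact h
        · exact h2 T' hT'

theorem countDepths_spec : ∀ (l : List BTree) (M : Mem),
    Spec (countDepths l) M fun c M' =>
      M' = M.tick l.length ∧ ∀ a, c a = (l.map BTree.dep).count a
  | [], M => Spec.pure ⟨rfl, by simp⟩
  | T :: l, M => by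
    unfold countDepths
    refine Spec.bind ((countDepths_spec l M).mono ?_)
    rintro c M₁ ⟨rfl, hc⟩
    refine Spec.step ⟨by simp [Mem.tick, add_assoc], fun a => ?_⟩
    by_cases h : a = T.dep
    · subst h; simp [hc]
    · rw [Function.update_of_ne h, hc, List.map_cons, List.count_cons_of_ne (Ne.symm h)]

theorem maxRepeated_spec (c : ℕ → ℕ) : ∀ (a : ℕ) (M : Mem),
    Spec (maxRepeated c a) M fun D M' => (∃ k ≤ a + 1, M' = M.tick k) ∧ D ≤ a ∧
      (∀ b, D < b → b ≤ a → c b < 2) ∧ (D = 0 ∨ 2 ≤ c D)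
  | 0, M => Spec.step ⟨⟨1, le_rfl, rfl⟩, le_rfl, by omega, Or.inl rfl⟩
  | a + 1, M => by
    unfold maxRepeated
    refine Spec.bind (Spec.step ?_)
    by_cases h : 2 ≤ c (a + 1)
    · simp only [h, decide_true, if_true]
      exact Spec.pure ⟨⟨1, by omega, rfl⟩, le_rfl, by omega, Or.inr h⟩
    · simp only [h, decide_false, Bool.false_eq_true, if_false]
      refine (maxRepeated_spec c a _).mono ?_
      rintro D M₁ ⟨⟨k, hk, rfl⟩, h1, h2, h3⟩
      refine ⟨⟨1 + k, by omega, by simp [Mem.tick, add_assoc]⟩, by omega, fun b hb hb' => ?_, h3⟩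
      by_cases hba : b = a + 1
      · subst hba; omega
      · exact h2 b hb (by omega)

theorem sum_Ico_two_pow {lo hi : ℕ} (h : lo ≤ hi) :
    ∑ a ∈ Finset.Ico lo hi, 2 ^ a + 2 ^ lo = 2 ^ hi := by
  induction hi, h using Nat.le_induction with
  | base => simp
  | succ n hn ih => rw [Finset.sum_Ico_succ_top hn, pow_succ]; omega

/-- Distinct depths in `[lo, hi)` contribute at most the full geometric sum `2 ^ hi - 2 ^ lo`. -/
theorem treesSize_add_le {l : List BTree} (h : (l.map BTree.dep).Nodup) {lo hi : ℕ}
    (hlh : lo ≤ hi) (hlo : ∀ T ∈ l, lo ≤ T.dep) (hhi : ∀ T ∈ l, T.dep < hi) :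
    treesSize l + 2 ^ lo ≤ 2 ^ hi := by
  rw [← sum_Ico_two_pow hlh]
  have e : treesSize l = ∑ a ∈ (l.map BTree.dep).toFinset, 2 ^ a := by
    rw [List.sum_toFinset _ h, List.map_map]
    rfl
  rw [e]
  refine Nat.add_le_add_right (Finset.sum_le_sum_of_subset ?_) _
  intro a ha
  obtain ⟨T, hT, rfl⟩ := List.mem_map.1 (List.mem_toFinset.1 ha)
  exact Finset.mem_Ico.2 ⟨hlo T hT, hhi T hT⟩

theorem Ascending.nodup {l : List BTree} (h : Ascending l) : (l.map BTree.dep).Nodup :=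
  List.pairwise_map.2 (h.imp fun h => h.ne)

theorem Descending.nodup {l : List BTree} (h : Descending l) : (l.map BTree.dep).Nodup :=
  List.pairwise_map.2 (h.imp fun h => h.ne')

theorem append_cons_inj_of_forall_ne {a : ℕ} {p q l m : List BTree} {T T' : BTree}
    (h : p ++ T :: l = q ++ T' :: m) (hp : ∀ X ∈ p, X.dep ≠ a) (hq : ∀ X ∈ q, X.dep ≠ a)
    (hT : T.dep = a) (hT' : T'.dep = a) : p = q ∧ T = T' ∧ l = m := by
  induction p generalizing q with
  | nil =>
    cases q with
    | nil => simpa using h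
    | cons X q =>
      obtain ⟨rfl, -⟩ := List.cons.inj h
      exact absurd hT (hq T (by simp))
  | cons X p ih =>
    cases q with
    | nil =>
      obtain ⟨rfl, -⟩ := List.cons.inj h
      exact absurd hT' (hp X (by simp))
    | cons Y q =>
      obtain ⟨rfl, h'⟩ := List.cons.inj h
      obtain ⟨rfl, rfl, rfl⟩ := ih h' (fun X hX => hp X (by simp [hX]))
        (fun X hX => hq X (by simp [hX]))
      exact ⟨rfl, rfl, rfl⟩

theorem dvd_treesSize {l : List BTree} {k : ℕ} (h : ∀ T ∈ l, k ≤ T.dep) :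
    2 ^ k ∣ treesSize l :=
  List.dvd_sum fun a ha => by
    obtain ⟨T, hT, rfl⟩ := List.mem_map.1 ha
    exact pow_dvd_pow 2 (h T hT)

theorem exists_split_of_mem {l : List BTree} {a : ℕ} (h : a ∈ l.map BTree.dep) :
    ∃ p T f, l = p ++ T :: f ∧ T.dep = a := by
  obtain ⟨T, hT, rfl⟩ := List.mem_map.1 h
  obtain ⟨p, f, rfl⟩ := List.append_of_mem hT
  exact ⟨p, T, f, rfl, rfl⟩

/-- A tree of depth `d - 1` is a deepest one, so it sits at the peak. If there is none, some depth
must occur twice, since distinct depths below `d - 1` give fewer than `2 ^ (d - 1)` inputs. The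
largest such `D` occurs once on each slope. The trees strictly between are deeper with distinct
depths, those outside each end total less than `2 ^ D`, and rounding to multiples of `2 ^ (D + 1)`
determines the size of the middle part exactly. -/
theorem triangularSubset_spec {u w : List BTree} (hu : Ascending u) (hw : Descending w) {d : ℕ}
    (hd : 2 ≤ d) (hle : 2 ^ (d - 1) ≤ treesSize (u ++ w)) (hlt : treesSize (u ++ w) < 2 ^ d) :
    Spec (triangularSubset (u ++ w) d) M fun r M' =>
      (∃ k ≤ 4 * (u ++ w).length + d, M' = M.tick k) ∧
      ∃ u' w', u = r.1 ++ u' ∧ w = w' ++ r.2.2 ∧ r.2.1 = u' ++ w' ∧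
        treesSize (u' ++ w') = 2 ^ (d - 1) := by
  have hdep : ∀ T ∈ u ++ w, T.dep < d := fun T hT =>
    two_pow_lt_iff.1 ((dep_le_of_mem hT).trans_lt hlt)
  unfold triangularSubset
  refine Spec.bind ((splitBefore_spec (d - 1) (u ++ w) M).mono ?_)
  rintro ⟨p, q⟩ M₁ ⟨⟨k₁, hk₁, rfl⟩, h1, h2, h3⟩
  cases q with
  | cons T l =>
    dsimp only at h1 h2 h3 ⊢
    have hT : T.dep = d - 1 := h3 T l rfl
    refine Spec.pure ⟨⟨k₁, by omega, rfl⟩, ?_⟩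
    have hgt : ∀ T' ∈ u ++ w, ¬ d - 1 < T'.dep := fun T' hT' => by
      have := hdep T' hT'; omega
    have hsz : treesSize [T] = 2 ^ (d - 1) := by simp [hT]
    rcases List.append_eq_append_iff.1 h1 with ⟨a, rfl, rfl⟩ | ⟨c, rfl, hc⟩
    · cases a with
      | nil => exact ⟨[], [T], by simp, by simp, rfl, hsz⟩
      | cons X a =>
        have := (List.pairwise_cons.1 hw).1 T (by simp)
        exact absurd (hT ▸ this) (hgt X (by simp))
    · cases c with
      | nil => exact ⟨[], [T], by simp, by simpa using hc.symm, rfl, hsz⟩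
      | cons X c =>
        obtain ⟨rfl, rfl⟩ := List.cons.inj hc
        cases c with
        | nil => exact ⟨[T], [], by simp, by simp, rfl, hsz⟩
        | cons Y c =>
          have := (List.pairwise_cons.1 (List.pairwise_append.1 hu).2.1).1 Y (by simp)
          exact absurd (hT ▸ this) (hgt Y (by simp))
  | nil =>
    dsimp only at h1 h2 h3 ⊢
    rw [List.append_nil] at h1
    subst h1
    have hdep' : ∀ T ∈ u ++ w, T.dep < d - 1 := fun T hT => by
      have := hdep T hT; have := h2 T hT; omega
    refine Spec.bind ((countDepths_spec (u ++ w) _).mono ?_)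
    rintro c M₂ ⟨rfl, hc⟩
    refine Spec.bind ((maxRepeated_spec c (d - 2) _).mono ?_)
    rintro D M₃ ⟨⟨k₂, hk₂, rfl⟩, hD, hD₁, hD₂⟩
    -- The search returns `0` by default; this excludes that `0` is returned without being repeated.
    have hDc : 2 ≤ c D := by
      by_contra hcon
      have hD0 : D = 0 := by omega
      subst hD0
      have hnd : ((u ++ w).map BTree.dep).Nodup := by
        rw [List.nodup_iff_count_le_one]
        intro a
        rw [← hc]
        rcases Nat.eq_zero_or_pos a with rfl | ha
        · omega
        · by_cases had : a ≤ d - 2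
          · have := hD₁ a ha had; omega
          · rw [hc, List.count_eq_zero_of_not_mem]
            · omega
            · intro hm
              obtain ⟨T, hT, rfl⟩ := List.mem_map.1 hm
              have := hdep' T hT
              omega
      have := treesSize_add_le hnd (Nat.zero_le (d - 1)) (fun _ _ => Nat.zero_le _) hdep'
      omega
    have hcu : ∀ a, (u.map BTree.dep).count a ≤ 1 := List.nodup_iff_count_le_one.1 hu.nodup
    have hcw : ∀ a, (w.map BTree.dep).count a ≤ 1 := List.nodup_iff_count_le_one.1 hw.nodup
    have hca : ∀ a, c a = (u.map BTree.dep).count a + (w.map BTree.dep).count a := fun a => by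
      rw [hc, List.map_append, List.count_append]
    have hcD := hca D
    have hDu := hcu D
    have hDw := hcw D
    obtain ⟨u₁, T₁, u₂, rfl, hT₁⟩ := exists_split_of_mem (l := u) (a := D)
      (List.count_pos_iff.1 (by omega))
    obtain ⟨w₁, T₂, w₂, rfl, hT₂⟩ := exists_split_of_mem (l := w) (a := D)
      (List.count_pos_iff.1 (by omega))
    have hu' := List.pairwise_append.1 hu
    have hw' := List.pairwise_append.1 hw
    have hu₁ : ∀ T ∈ u₁, T.dep < D := fun T hT => hT₁ ▸ hu'.2.2 T hT T₁ (by simp)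
    have hu₂ : ∀ T ∈ u₂, D < T.dep := fun T hT =>
      hT₁ ▸ (List.pairwise_cons.1 hu'.2.1).1 T hT
    have hw₁ : ∀ T ∈ w₁, D < T.dep := fun T hT => hT₂ ▸ hw'.2.2 T hT T₂ (by simp)
    have hw₂ : ∀ T ∈ w₂, T.dep < D := fun T hT =>
      hT₂ ▸ (List.pairwise_cons.1 hw'.2.1).1 T hT
    refine Spec.bind ((splitBefore_spec D _ _).mono ?_)
    rintro ⟨p, q⟩ M₄ ⟨⟨k₃, hk₃, rfl⟩, h4, h5, h6⟩
    dsimp only at h4 h5 h6 ⊢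
    cases q with
    | nil =>
      rw [List.append_nil] at h4
      exact absurd hT₁ (h5 T₁ (h4 ▸ by simp))
    | cons T l =>
      rw [List.append_assoc, List.cons_append] at h4
      obtain ⟨rfl, rfl, rfl⟩ := append_cons_inj_of_forall_ne h4 (fun T hT => (hu₁ T hT).ne) h5
        hT₁ (h6 T l rfl)
      dsimp only
      refine Spec.bind ((splitBefore_spec D _ _).mono ?_)
      rintro ⟨p', q'⟩ M₅ ⟨⟨k₄, hk₄, rfl⟩, h7, h8, h9⟩
      dsimp only at h7 h8 h9 ⊢
      cases q' with
      | nil =>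
        rw [List.append_nil] at h7
        exact absurd hT₂ (h8 T₂ (h7 ▸ by simp))
      | cons T' l' =>
        rw [← List.append_assoc] at h7
        obtain ⟨rfl, rfl, rfl⟩ := append_cons_inj_of_forall_ne h7 (fun T hT => by
          rcases List.mem_append.1 hT with hT | hT
          · exact (hu₂ T hT).ne'
          · exact (hw₁ T hT).ne') h8 hT₂ (h9 T' l' rfl)
        refine Spec.pure ⟨⟨k₁ + (u₁ ++ T₁ :: u₂ ++ (w₁ ++ T₂ :: w₂)).length + k₂ + k₃ + k₄, ?_, ?_⟩,
          T₁ :: u₂, w₁ ++ [T₂], rfl, by simp, by simp, ?_⟩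
        · simp only [List.length_append, List.length_cons] at hk₁ hk₃ hk₄ ⊢
          omega
        · simp [Mem.tick, add_assoc]
        · have hnd : ((u₂ ++ w₁).map BTree.dep).Nodup := by
            rw [List.nodup_iff_count_le_one]
            intro a
            by_cases ha : a ∈ (u₂ ++ w₁).map BTree.dep
            · obtain ⟨T, hT, rfl⟩ := List.mem_map.1 ha
              have hTD : D < T.dep := by
                rcases List.mem_append.1 hT with hT | hT
                · exact hu₂ T hT
                · exact hw₁ T hT
              have hTd : T.dep < d - 1 := hdep' T (by
                rcases List.mem_append.1 hT with hT | hT <;> simp [hT])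
              have := hD₁ _ hTD (by omega)
              rw [hca] at this
              simp only [List.map_append, List.map_cons, List.count_append, List.count_cons]
                at this ⊢
              omega
            · rw [List.count_eq_zero_of_not_mem ha]; omega
          have hs := treesSize_add_le hnd (show D + 1 ≤ d - 1 by omega) (fun T hT => by
            rcases List.mem_append.1 hT with hT | hT
            · exact hu₂ T hT
            · exact hw₁ T hT) (fun T hT => hdep' T (by
                rcases List.mem_append.1 hT with hT | hT <;> simp [hT]))
          have hdv : 2 ^ (D + 1) ∣ treesSize (u₂ ++ w₁) := dvd_treesSize fun T hT => by
            rcases List.mem_append.1 hT with hT | hT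
            · exact hu₂ T hT
            · exact hw₁ T hT
          have hb₁ := (Ascending.bounds hu'.1 hu₁).2
          have hb₂ := (Descending.bounds (List.pairwise_cons.1 hw'.2.1).2 hw₂).2
          simp only [treesSize_append, treesSize_cons, treesSize_nil, hT₁, hT₂] at hle hs hdv ⊢
          -- In units of `2 ^ (D + 1)`, the trees strictly between have size `s` and the target is
          -- `t`. Distinct depths give `s + 1 ≤ t`, and the total size is less than `s + 2`, so `t =
          -- s + 1`, which is the size of the chosen set.
          obtain ⟨t, ht⟩ : 2 ^ (D + 1) ∣ 2 ^ (d - 1) := pow_dvd_pow 2 (by omega)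
          obtain ⟨s, hs'⟩ := hdv
          have hpD : 0 < 2 ^ D := by positivity
          rw [pow_succ] at hs hs' ht
          have h10 : 2 ^ D * 2 * t < 2 ^ D * 2 * (s + 2) := by nlinarith
          have h11 := Nat.lt_of_mul_lt_mul_left h10
          have h12 : 2 ^ D * 2 * (s + 1) ≤ 2 ^ D * 2 * t := by nlinarith
          have h13 := Nat.le_of_mul_le_mul_left h12 (by positivity)
          have : t = s + 1 := by omega
          subst this
          nlinarith

end

/-! ### Inequalities for `mu`: every split leads to the previous level -/

theorem mu_sub_two_mul {ξ : ℚ} {d : ℕ} (n : ℕ) (hd : 1 ≤ d) :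
    (mu ξ d n - 2) * d = ξ * ((2 : ℚ) ^ d - n - 2) := by
  have : (d : ℚ) ≠ 0 := by positivity
  rw [mu, add_sub_cancel_right, div_mul_cancel₀ _ this]

theorem le_mu_iff {ξ : ℚ} {d n : ℕ} (hd : 1 ≤ d) (y : ℚ) :
    y ≤ mu ξ d n ↔ (y - 2) * d ≤ ξ * ((2 : ℚ) ^ d - n - 2) := by
  have : (0 : ℚ) < d := by positivity
  rw [← mu_sub_two_mul n hd, mul_le_mul_iff_left₀ this]
  constructor <;> intro h <;> linarith

theorem mu_lt_iff {ξ : ℚ} {d n : ℕ} (hd : 1 ≤ d) (y : ℚ) :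
    mu ξ d n < y ↔ ξ * ((2 : ℚ) ^ d - n - 2) < (y - 2) * d := by
  rw [← not_le, le_mu_iff hd, not_le]

section
variable {ξ : ℚ}

/-- Guarantees that the bounded search for the minimum depth succeeds. It rests on `d ^ 2 ≤ 2 ^ d`,
which fails among `d ≥ 3` only for `d = 3`, treated separately. -/
theorem le_mu_self (h1 : 1.995 ≤ ξ) {n m : ℕ} (hm : 3 ≤ m) {d : ℕ} (hd : n + m ≤ d) :
    (m : ℚ) ≤ mu ξ d n := by
  rw [le_mu_iff (by omega)]
  have hp : d ^ 2 ≤ 2 ^ d ∨ d = 3 := by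
    rcases Nat.lt_or_ge d 4 with h | h
    · right; omega
    · left
      clear hd
      induction d, h using Nat.le_induction with
      | base => norm_num
      | succ k hk ih => rw [pow_succ 2 k]; nlinarith
  have hd' : (n : ℚ) + m ≤ d := by exact_mod_cast hd
  have hm' : (3 : ℚ) ≤ m := by exact_mod_cast hm
  have hn : (0 : ℚ) ≤ n := by positivity
  rcases hp with hp | rfl
  · have hp' : (d : ℚ) ^ 2 ≤ 2 ^ d := by exact_mod_cast hp
    have h2 : (0 : ℚ) ≤ 2 ^ d - n - 2 := by nlinarith
    nlinarith
  · have : n = 0 := by omega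
    have : m = 3 := by omega
    subst_vars
    norm_num; linarith

theorem two_pow_sub_gt (h1 : 1.995 ≤ ξ) (h2 : ξ < 2) {d n m : ℕ} (hd : 1 ≤ d) (hm : 3 ≤ m) (h : (m : ℚ) ≤ mu ξ d n) :
    (m - 2) * d < 2 * ((2 : ℚ) ^ d - n - 2) := by
  rw [le_mu_iff hd] at h
  have hm' : (3 : ℚ) ≤ m := by exact_mod_cast hm
  have hd' : (1 : ℚ) ≤ d := by exact_mod_cast hd
  have hpos : 0 < (2 : ℚ) ^ d - n - 2 := by
    by_contra hc
    nlinarith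
  nlinarith

theorem add_two_le_two_pow (h1 : 1.995 ≤ ξ) {d n m : ℕ} (hd : 1 ≤ d) (hm : 2 ≤ m) (h : (m : ℚ) ≤ mu ξ d n) :
    n + 2 ≤ 2 ^ d := by
  rw [le_mu_iff hd] at h
  have hm' : (2 : ℚ) ≤ m := by exact_mod_cast hm
  have hd' : (1 : ℚ) ≤ d := by exact_mod_cast hd
  have hpos : 0 ≤ (2 : ℚ) ^ d - n - 2 := by
    by_contra hc
    nlinarith
  have : ((n + 2 : ℕ) : ℚ) ≤ ((2 ^ d : ℕ) : ℚ) := by push_cast; linarith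
  exact_mod_cast this

theorem add_three_le_two_pow (h1 : 1.995 ≤ ξ) (h2 : ξ < 2) {d n m : ℕ} (hd : 1 ≤ d) (hm : 3 ≤ m) (h : (m : ℚ) ≤ mu ξ d n) :
    n + 3 ≤ 2 ^ d := by
  have h := two_pow_sub_gt h1 h2 hd hm h
  have hm' : (3 : ℚ) ≤ m := by exact_mod_cast hm
  have hd' : (1 : ℚ) ≤ d := by exact_mod_cast hd
  have : ((n + 2 : ℕ) : ℚ) < ((2 ^ d : ℕ) : ℚ) := by push_cast; nlinarith
  have : n + 2 < 2 ^ d := by exact_mod_cast this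
  omega

/-- Together with the two preceding lemmas this supplies the Kraft sums of the direct constructions:
`n + 1` for the symmetric inputs and `t_0`, plus `1`, `2` or `4` for the vertex in `L`. -/
theorem add_five_le_two_pow (h1 : 1.995 ≤ ξ) (h2 : ξ < 2) {d n m : ℕ} (hd : 1 ≤ d) (hm : 4 ≤ m) (h : (m : ℚ) ≤ mu ξ d n) :
    n + 5 ≤ 2 ^ d := by
  have h := two_pow_sub_gt h1 h2 hd (by omega) h
  have hm' : (4 : ℚ) ≤ m := by exact_mod_cast hm
  have hd' : (1 : ℚ) ≤ d := by exact_mod_cast hd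
  have : ((n + 2 + d : ℕ) : ℚ) < ((2 ^ d : ℕ) : ℚ) := by push_cast; nlinarith
  have : n + 2 + d < 2 ^ d := by exact_mod_cast this
  have h4 : d = 1 ∨ d = 2 ∨ 2 < d := by omega
  rcases h4 with rfl | rfl | h4 <;> omega

theorem le_mu_three (h1 : 1.995 ≤ ξ) (h2 : ξ < 2) {d n m : ℕ} (hd : 1 ≤ d) (hd' : d ≤ 3) (hm : 3 ≤ m)
    (h : (m : ℚ) ≤ mu ξ d n) : (m : ℚ) ≤ mu ξ 3 n := by
  have h' := two_pow_sub_gt h1 h2 hd hm h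
  have hm' : (3 : ℚ) ≤ m := by exact_mod_cast hm
  have hn : (0 : ℚ) ≤ n := by positivity
  rw [le_mu_iff (by norm_num)]
  interval_cases d
  · norm_num at h'; linarith
  · norm_num at h' ⊢; nlinarith
  · rwa [le_mu_iff (by norm_num)] at h

theorem le_five_of_le_mu_three (h1 : 1.995 ≤ ξ) (h2 : ξ < 2) {n m : ℕ} (h : (m : ℚ) ≤ mu ξ 3 n) : m ≤ 5 := by
  by_contra hm
  have h := two_pow_sub_gt h1 h2 (by norm_num) (by omega) h
  have hn : (0 : ℚ) ≤ n := by positivity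
  have hm' : (6 : ℚ) ≤ m := by exact_mod_cast (by omega : 6 ≤ m)
  norm_num at h
  linarith

theorem le_one_of_five_le_mu_three (h1 : 1.995 ≤ ξ) (h2 : ξ < 2) {n : ℕ} (h : ((5 : ℕ) : ℚ) ≤ mu ξ 3 n) : n ≤ 1 := by
  have h := two_pow_sub_gt h1 h2 (by norm_num) (by omega) h
  by_contra hn
  have hn' : (2 : ℚ) ≤ n := by exact_mod_cast (by omega : 2 ≤ n)
  norm_num at h
  linarith

/-- The numerator is unchanged, as `2 ^ (d + 1) - n = 2 ^ d - (n - 2 ^ d)`, and the denominator only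
decreases. -/
theorem le_mu_symmetricSplit {d n m : ℕ} (hm : 2 ≤ m) (hn : 2 ^ d ≤ n) (hd : 1 ≤ d)
    (h : (m : ℚ) ≤ mu ξ (d + 1) n) : (m : ℚ) ≤ mu ξ d (n - 2 ^ d) := by
  rw [le_mu_iff (by omega)] at h
  rw [le_mu_iff hd]
  push_cast [hn] at h ⊢
  rw [pow_succ] at h
  have hm' : (2 : ℚ) ≤ m := by exact_mod_cast hm
  nlinarith

/-- If too many symmetric inputs were present, level `d + 1` would not accommodate more alternating
inputs than level `d` does without any. In an alternating split this makes `mu ξ d n` at least `2`,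
so an odd prefix exists. -/
theorem add_two_le_of_mu_lt (h1 : 1.995 ≤ ξ) (h2 : ξ < 2) {d n m : ℕ} (hd : 3 ≤ d) (hm : (m : ℚ) ≤ mu ξ (d + 1) n)
    (hm' : mu ξ d 0 < m) : n + 2 ≤ 2 ^ d := by
  rw [le_mu_iff (by omega)] at hm
  rw [mu_lt_iff (by omega)] at hm'
  have hN : 2 * (d + 1) ≤ 2 ^ d := by
    clear hm hm'
    induction d, hd using Nat.le_induction with
    | base => norm_num
    | succ k hk ih => rw [pow_succ]; omega
  have hN' : 2 * ((d : ℚ) + 1) ≤ 2 ^ d := by exact_mod_cast hN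
  push_cast at hm hm'
  rw [pow_succ] at hm
  have hd' : (3 : ℚ) ≤ d := by exact_mod_cast hd
  suffices h : 0 ≤ (2 : ℚ) ^ d - n - 2 by
    have : ((n + 2 : ℕ) : ℚ) ≤ ((2 ^ d : ℕ) : ℚ) := by push_cast; linarith
    exact_mod_cast this
  set N : ℚ := 2 ^ d
  set D : ℚ := (d : ℚ)
  have e1 : ξ * (N - 0 - 2) * (D + 1) ≤ (m - 2) * D * (D + 1) :=
    mul_le_mul_of_nonneg_right hm'.le (by linarith)
  have e2 : ((m : ℚ) - 2) * (D + 1) * D ≤ ξ * (N * 2 - n - 2) * D :=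
    mul_le_mul_of_nonneg_right hm (by linarith)
  have e3 : ξ * ((N - 0 - 2) * (D + 1)) ≤ ξ * ((N * 2 - n - 2) * D) := by linarith
  have e4 := le_of_mul_le_mul_left e3 (by linarith)
  nlinarith

/-- The heart of the depth bound. With `k = 2 * h + 1` the claim reads `(m - 2) * d ≤ ξ * (2 ^ d - 3
/ 2) + k * (d - ξ / 2)`, which is most restrictive for small `k` and large `m`. Inserting the bounds
for both and `ξ < 2` leaves `3 * (d + 1) * d ≤ 2 ^ (d + 1) * (d - 1) + 4`. -/
theorem le_mu_alternatingSplit (h1 : 1.995 ≤ ξ) (h2 : ξ < 2) {d n m h : ℕ} (hd : 3 ≤ d) (hm : (m : ℚ) ≤ mu ξ (d + 1) n)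
    (hn : n + 2 ≤ 2 ^ d)
    (hk : mu ξ d n - 2 < ((2 * h + 1 : ℕ) : ℚ)) :
    (m : ℚ) - (2 * h + 1 : ℕ) ≤ mu ξ d h := by
  rw [le_mu_iff (by omega)] at hm ⊢
  have hk' : ξ * ((2 : ℚ) ^ d - n - 2) < (2 * h + 1) * d := by
    have := mu_sub_two_mul (ξ := ξ) n (show 1 ≤ d by omega)
    have hdp : (0 : ℚ) < d := by positivity
    push_cast at hk
    nlinarith
  push_cast at hm ⊢
  rw [pow_succ] at hm
  -- Equality holds at `d = 3`.
  have hN : 3 * (d + 1) * d ≤ 2 ^ (d + 1) * (d - 1) + 4 := by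
    clear hm hk hk' hn
    induction d, hd using Nat.le_induction with
    | base => norm_num
    | succ k hk ih =>
      rw [pow_succ]
      obtain ⟨r, rfl⟩ : ∃ r, k = r + 3 := ⟨k - 3, by omega⟩
      have : 16 ≤ 2 ^ (r + 3 + 1) := by
        rw [show r + 3 + 1 = r + 4 by omega, pow_add]
        have : 1 ≤ 2 ^ r := Nat.one_le_two_pow
        omega
      simp only [show r + 3 - 1 = r + 2 by omega, show r + 3 + 1 - 1 = r + 3 by omega] at ih ⊢
      nlinarith
  have hN' : (3 : ℚ) * (d + 1) * d ≤ 2 ^ d * 2 * (d - 1) + 4 := by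
    have : ((3 * (d + 1) * d : ℕ) : ℚ) ≤ ((2 ^ (d + 1) * (d - 1) + 4 : ℕ) : ℚ) := by
      exact_mod_cast hN
    push_cast [show 1 ≤ d by omega] at this
    rw [pow_succ] at this
    linarith
  have hd' : (3 : ℚ) ≤ d := by exact_mod_cast hd
  have hn' : (n : ℚ) + 2 ≤ 2 ^ d := by exact_mod_cast hn
  set N : ℚ := 2 ^ d
  set D : ℚ := (d : ℚ)
  set K : ℚ := 2 * (h : ℚ) + 1 with hK
  have hh : (h : ℚ) = (K - 1) / 2 := by rw [hK]; ring
  rw [hh]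
  have hq : 0 ≤ N - n - 2 := by linarith
  have e1 : ((m : ℚ) - 2) * (D + 1) * (2 * D ^ 2) ≤ ξ * (N * 2 - n - 2) * (2 * D ^ 2) :=
    mul_le_mul_of_nonneg_right (by linarith) (by positivity)
  have e2 : 0 ≤ (2 * D - ξ) * (D + 1) := by nlinarith
  have e3 : ξ * (N - n - 2) * ((2 * D - ξ) * (D + 1)) ≤ K * D * ((2 * D - ξ) * (D + 1)) :=
    mul_le_mul_of_nonneg_right hk'.le e2
  have e4 : (N - n - 2) * ((2 * D - 2) * (D + 1)) ≤ (N - n - 2) * ((2 * D - ξ) * (D + 1)) :=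
    mul_le_mul_of_nonneg_left (mul_le_mul_of_nonneg_right (by linarith) (by linarith)) hq
  have e5 : 2 * (2 * N - n - 2) * D ^ 2 ≤
      (N - n - 2) * ((2 * D - ξ) * (D + 1)) + 2 * D * (N - 3 / 2) * (D + 1) := by
    linarith
  have e6 := mul_le_mul_of_nonneg_left e5 (show 0 ≤ ξ by linarith)
  have hpos : 0 < 2 * D * (D + 1) := by nlinarith
  refine le_of_mul_le_mul_right ?_ hpos
  linarith

end

/-! ### Paying for the boundary trees created by alternating splits -/

/-- Bounds the number of boundary trees that the alternating splits at levels up to `5` create. -/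
def smallExtra (m : ℕ) : ℕ := if m ≤ 4 then 0 else if m = 5 then 1 else if m ≤ 8 then 3 else 8 * m / 13

/-- Bounds the number, per alternating input, of boundary trees that the alternating splits at
levels up to `d` create. -/
def extraRatio (d : ℕ) : ℚ :=
  if d ≤ 5 then 8 / 13 else if d = 6 then 8 / 13 + 2 / 7
  else 167 / 100 - 800 / 399 * ((d : ℚ) ^ 2 - 2 * d - 1) / 2 ^ d

/-- Bounds the number of boundary trees that the alternating splits at levels up to `d` create
in a run on `m` alternating inputs. -/
def extraBound (d m : ℕ) : ℚ := if d ≤ 5 then smallExtra m else extraRatio d * m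

theorem smallExtra_le (m : ℕ) : (smallExtra m : ℚ) ≤ 8 / 13 * m := by
  have : 13 * smallExtra m ≤ 8 * m := by
    unfold smallExtra
    split_ifs <;> omega
  have : (13 : ℚ) * smallExtra m ≤ 8 * m := by exact_mod_cast this
  linarith

/-- The closed form telescopes to this increment. It is the quotient of the bound `2 * d - 8` on the
new boundary trees and the lower bound `399 / 200 * 2 ^ d / d` on `m`. -/
theorem extraRatio_succ {d : ℕ} (hd : 7 ≤ d) :
    extraRatio (d + 1) = extraRatio d + 400 / 399 * (d * (d - 4)) / 2 ^ d := by
  unfold extraRatio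
  simp only [show ¬ d + 1 ≤ 5 by omega, show ¬ d + 1 = 6 by omega, show ¬ d ≤ 5 by omega,
    show ¬ d = 6 by omega, if_false, pow_succ (2 : ℚ) d]
  push_cast
  field_simp
  ring

theorem extraRatio_five : extraRatio 5 = 8 / 13 := by simp [extraRatio]
theorem extraRatio_six : extraRatio 6 = 8 / 13 + 2 / 7 := by simp [extraRatio]
theorem extraRatio_seven : extraRatio 7 = 167 / 100 - 800 / 399 * 34 / 128 := by
  norm_num [extraRatio]

theorem extraRatio_le_succ (d : ℕ) : extraRatio d ≤ extraRatio (d + 1) := by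
  have h : d ≤ 4 ∨ d = 5 ∨ d = 6 ∨ 7 ≤ d := by omega
  rcases h with h | rfl | rfl | h
  · unfold extraRatio
    rw [if_pos (by omega), if_pos (by omega)]
  · rw [extraRatio_five, extraRatio_six]; norm_num
  · rw [extraRatio_six, extraRatio_seven]; norm_num
  · rw [extraRatio_succ h]
    have : (7 : ℚ) ≤ d := by exact_mod_cast h
    have : 0 ≤ (d : ℚ) * (d - 4) := by nlinarith
    have : 0 ≤ 400 / 399 * ((d : ℚ) * (d - 4)) / 2 ^ d := by positivity
    linarith

theorem extraRatio_mono : Monotone extraRatio := monotone_nat_of_le_succ extraRatio_le_succ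

theorem extraRatio_le (d : ℕ) : extraRatio d ≤ 167 / 100 := by
  refine (extraRatio_mono (show d ≤ d + 7 by omega)).trans ?_
  unfold extraRatio
  rw [if_neg (by omega), if_neg (by omega)]
  push_cast
  have : (0 : ℚ) ≤ d := by positivity
  have : 0 ≤ ((d : ℚ) + 7) ^ 2 - 2 * (d + 7) - 1 := by nlinarith
  have : 0 ≤ 800 / 399 * (((d : ℚ) + 7) ^ 2 - 2 * (d + 7) - 1) / 2 ^ (d + 7) := by positivity
  linarith

theorem extraBound_mono {d d' : ℕ} (h : d ≤ d') (m : ℕ) : extraBound d m ≤ extraBound d' m := by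
  unfold extraBound
  split_ifs with h1 h2 h2
  · exact le_rfl
  · have := extraRatio_mono (show 5 ≤ d' by omega)
    rw [extraRatio_five] at this
    exact (smallExtra_le m).trans (mul_le_mul_of_nonneg_right this (by positivity))
  · omega
  · exact mul_le_mul_of_nonneg_right (extraRatio_mono h) (by positivity)

theorem extraBound_le (d m : ℕ) : extraBound d m ≤ 167 / 100 * m := by
  refine (extraBound_mono (show d ≤ d + 6 by omega) m).trans ?_
  rw [extraBound, if_neg (by omega)]
  exact mul_le_mul_of_nonneg_right (extraRatio_le _) (by positivity)

theorem extraBound_nonneg (d m : ℕ) : 0 ≤ extraBound d m := by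
  refine le_trans ?_ (extraBound_mono (Nat.zero_le d) m)
  simp [extraBound]

theorem extraBound_five (d : ℕ) (hd : 3 ≤ d) : 1 ≤ extraBound d 5 := by
  refine le_trans ?_ (extraBound_mono hd 5)
  norm_num [extraBound, smallExtra]

theorem le_of_two_pow_le {b B X h : ℕ} (hb : 2 ^ (b + 2) ≤ (h + 2) ^ 2) (hX : h ≤ X)
    (hB : (X + 2) ^ 2 < 2 ^ (B + 3)) : b ≤ B := by
  have h1 : (h + 2) ^ 2 ≤ (X + 2) ^ 2 := Nat.pow_le_pow_left (by omega) 2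
  have := two_pow_lt_iff.1 ((hb.trans h1).trans_lt hB)
  omega

/-- The finitely many splits into parts at level `3`; the next lemma treats level `4`. There the
split of `13` into `7 + 6` with two new trees gives `3 + 3 + 2 = 8`, the origin of the ratio `8 /
13`. -/
theorem smallExtra_split_four {m h b : ℕ} (hm : 6 ≤ m) (hm' : m ≤ 8) (hh : h ≤ 2)
    (hb : 2 ^ (b + 2) ≤ (h + 2) ^ 2) :
    smallExtra (2 * h + 1) + smallExtra (m - (2 * h + 1)) + b ≤ smallExtra m := by
  have h0 : h = 0 → b ≤ 0 := fun h0 => le_of_two_pow_le hb h0.le (by norm_num)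
  have h1 : h = 1 → b ≤ 1 := fun h1 => le_of_two_pow_le hb h1.le (by norm_num)
  have h2 : b ≤ 2 := le_of_two_pow_le hb hh (by norm_num)
  unfold smallExtra
  interval_cases h <;> interval_cases m <;> norm_num <;> omega

theorem smallExtra_split_five {m h b : ℕ} (hm : 9 ≤ m) (hm' : m ≤ 13) (hh : h ≤ 3)
    (hb : 2 ^ (b + 2) ≤ (h + 2) ^ 2) :
    smallExtra (2 * h + 1) + smallExtra (m - (2 * h + 1)) + b ≤ smallExtra m := by
  have h0 : h = 0 → b ≤ 0 := fun h0 => le_of_two_pow_le hb h0.le (by norm_num)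
  have h1 : h = 1 → b ≤ 1 := fun h1 => le_of_two_pow_le hb h1.le (by norm_num)
  have h2 : b ≤ 2 := le_of_two_pow_le hb hh (by norm_num)
  unfold smallExtra
  interval_cases h <;> interval_cases m <;> norm_num <;> omega

/-- The hypotheses bound `m` from below and `h` from above, both at order `2 ^ d / d`. For `d = 5`
this means at most `4` new trees for at least `14` inputs, hence the increment `2 / 7`; for `d = 6`
at most `5` for at least `23`; from then on `b ≤ 2 * d - 8`. -/
theorem boundary_le_extraRatio {d m h b : ℕ} (hd : 5 ≤ d)
    (hm : 399 / 200 * ((2 : ℚ) ^ d - 2) < (m - 2) * d)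
    (hh : (2 * (h : ℚ) - 1) * d < 2 * ((2 : ℚ) ^ d - 2)) (hb : 2 ^ (b + 2) ≤ (h + 2) ^ 2) :
    extraRatio d * m + b ≤ extraRatio (d + 1) * m := by
  have hcase : d = 5 ∨ d = 6 ∨ 7 ≤ d := by omega
  rcases hcase with rfl | rfl | hd
  · have hm' : 13 < m := by
      have : ((13 : ℕ) : ℚ) < m := by norm_num at hm; push_cast; linarith
      exact_mod_cast this
    have hh' : h < 7 := by
      have : (h : ℚ) < (7 : ℕ) := by norm_num at hh; push_cast; linarith
      exact_mod_cast this
    have hb' : b ≤ 4 := le_of_two_pow_le hb (show h ≤ 6 by omega) (by norm_num)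
    have hb'' : (b : ℚ) ≤ 4 := by exact_mod_cast hb'
    have hm'' : (14 : ℚ) ≤ m := by exact_mod_cast hm'
    rw [extraRatio_five, extraRatio_six]
    linarith
  · have hm' : 22 < m := by
      have : ((22 : ℕ) : ℚ) < m := by norm_num at hm; push_cast; linarith
      exact_mod_cast this
    have hh' : h < 11 := by
      have : (h : ℚ) < (11 : ℕ) := by norm_num at hh; push_cast; linarith
      exact_mod_cast this
    have hb' : b ≤ 5 := le_of_two_pow_le hb (show h ≤ 10 by omega) (by norm_num)
    have hb'' : (b : ℚ) ≤ 5 := by exact_mod_cast hb'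
    have hm'' : (23 : ℚ) ≤ m := by exact_mod_cast hm'
    rw [extraRatio_six, extraRatio_seven]
    linarith
  · rw [extraRatio_succ hd]
    have hd' : (7 : ℚ) ≤ d := by exact_mod_cast hd
    have hb' : b ≤ 2 * d - 8 := by
      rcases hd.eq_or_lt with rfl | hd8
      · have hh' : h < 19 := by
          have : (h : ℚ) < (19 : ℕ) := by norm_num at hh; push_cast; linarith
          exact_mod_cast this
        exact le_of_two_pow_le hb (show h ≤ 18 by omega) (by norm_num)
      -- From `d ≥ 8` on, `2 ^ d / d ≤ 2 ^ (d - 3) = 32 * 2 ^ r`.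
      · obtain ⟨r, rfl⟩ : ∃ r, d = r + 8 := ⟨d - 8, by omega⟩
        have hr : (1 : ℚ) ≤ 2 ^ r := one_le_pow₀ (by norm_num)
        have hh' : h ≤ 32 * 2 ^ r := by
          have e : (h : ℚ) < 32 * 2 ^ r + 1 := by
            rw [pow_add] at hh
            push_cast at hh
            have hr0 : (0 : ℚ) ≤ r := by positivity
            by_contra hc
            nlinarith
          have : h < 32 * 2 ^ r + 1 := by exact_mod_cast e
          omega
        refine le_of_two_pow_le hb hh' ?_
        have hr' : 1 ≤ 2 ^ r := Nat.one_le_two_pow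
        rw [show 2 * (r + 8) - 8 + 3 = r + r + 11 by omega, pow_add, pow_add]
        nlinarith
    have hb'' : (b : ℚ) ≤ 2 * d - 8 := by
      have : ((b + 8 : ℕ) : ℚ) ≤ ((2 * d : ℕ) : ℚ) := by exact_mod_cast (by omega : b + 8 ≤ 2 * d)
      push_cast at this
      linarith
    have hN : (0 : ℚ) < 2 ^ d := by positivity
    have hm' : 399 / 200 * (2 : ℚ) ^ d ≤ m * d := by nlinarith
    have key : (2 * (d : ℚ) - 8) * 2 ^ d ≤ 400 / 399 * (d * (d - 4)) * m := by
      nlinarith [mul_le_mul_of_nonneg_left hm' (show (0 : ℚ) ≤ d - 4 by linarith)]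
    have : 2 * (d : ℚ) - 8 ≤ 400 / 399 * (d * (d - 4)) / 2 ^ d * m := by
      rw [div_mul_eq_mul_div, le_div_iff₀ hN]
      exact key
    linarith

/-- The number `b` of boundary trees that an alternating split creates is paid for by the
difference of the bounds. -/
theorem extraBound_split {ξ : ℚ} (h1 : 1.995 ≤ ξ) (h2 : ξ < 2) {d n m h b : ℕ} (hd : 3 ≤ d)
    (hm : (m : ℚ) ≤ mu ξ (d + 1) n) (hm' : mu ξ d 0 < m) (hk : ((2 * h + 1 : ℕ) : ℚ) ≤ mu ξ d n)
    (hkm : 2 * h + 1 < m) (hb : 2 ^ (b + 2) ≤ (h + 2) ^ 2) :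
    extraBound d (2 * h + 1) + extraBound d (m - (2 * h + 1)) + b ≤ extraBound (d + 1) m := by
  have hn := add_two_le_of_mu_lt h1 h2 hd hm hm'
  have hn' : (n : ℚ) + 2 ≤ 2 ^ d := by exact_mod_cast hn
  have hn0 : (0 : ℚ) ≤ n := by positivity
  -- `f1` bounds `m` from below because the simple split was not possible; `f3` bounds `h` from
  -- above because the prefix fits into level `d`.
  have f1 : 399 / 200 * ((2 : ℚ) ^ d - 2) < (m - 2) * d := by
    rw [mu_lt_iff (by omega)] at hm'
    refine lt_of_le_of_lt ?_ hm'
    push_cast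
    have : (0 : ℚ) ≤ 2 ^ d - 0 - 2 := by linarith
    nlinarith
  have f3 : (2 * (h : ℚ) - 1) * d < 2 * ((2 : ℚ) ^ d - 2) := by
    rw [le_mu_iff (by omega)] at hk
    push_cast at hk
    have h8 : (8 : ℚ) ≤ 2 ^ d := by
      have : 2 ^ 3 ≤ 2 ^ d := two_pow_le_iff.2 hd
      exact_mod_cast this
    have e1 : ξ * ((2 : ℚ) ^ d - n - 2) ≤ ξ * (2 ^ d - 2) :=
      mul_le_mul_of_nonneg_left (by linarith) (by linarith)
    have e2 : ξ * ((2 : ℚ) ^ d - 2) < 2 * (2 ^ d - 2) :=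
      mul_lt_mul_of_pos_right h2 (by linarith)
    linarith
  rcases Nat.lt_or_ge d 5 with hd5 | hd5
  · have hm3 : 3 ≤ m := by
      have : (2 : ℚ) < m := by
        by_contra hc
        have : (0 : ℚ) ≤ d := by positivity
        nlinarith
      exact_mod_cast this
    have f2 := two_pow_sub_gt h1 h2 (by omega) hm3 hm
    simp only [extraBound, show d ≤ 5 by omega, show d + 1 ≤ 5 by omega, if_true]
    have hcase : d = 3 ∨ d = 4 := by omega
    have : smallExtra (2 * h + 1) + smallExtra (m - (2 * h + 1)) + b ≤ smallExtra m := by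
      rcases hcase with rfl | rfl
      · have m1 : 5 < m := by
          have : ((5 : ℕ) : ℚ) < m := by norm_num at f1; push_cast; linarith
          exact_mod_cast this
        have m2 : m < 9 := by
          have : (m : ℚ) < (9 : ℕ) := by norm_num at f2; push_cast; linarith
          exact_mod_cast this
        have m3 : h < 3 := by
          have : (h : ℚ) < (3 : ℕ) := by norm_num at f3; push_cast; linarith
          exact_mod_cast this
        exact smallExtra_split_four (by omega) (by omega) (by omega) hb
      · have m1 : 8 < m := by
          have : ((8 : ℕ) : ℚ) < m := by norm_num at f1; push_cast; linarith
          exact_mod_cast this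
        have m2 : m < 14 := by
          have : (m : ℚ) < (14 : ℕ) := by norm_num at f2; push_cast; linarith
          exact_mod_cast this
        have m3 : h < 4 := by
          have : (h : ℚ) < (4 : ℕ) := by norm_num at f3; push_cast; linarith
          exact_mod_cast this
        exact smallExtra_split_five (by omega) (by omega) (by omega) hb
    exact_mod_cast this
  · have h4 : extraBound d (2 * h + 1) + extraBound d (m - (2 * h + 1)) ≤ extraRatio d * m := by
      have e : ∀ y, extraBound d y ≤ extraRatio d * y := fun y => by
        unfold extraBound
        split_ifs with hd'
        · have : d = 5 := by omega
          rw [this, extraRatio_five]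
          exact smallExtra_le y
        · exact le_rfl
      have e1 := e (2 * h + 1)
      have e2 := e (m - (2 * h + 1))
      rw [Nat.cast_sub hkm.le] at e2
      linarith
    have h5 := boundary_le_extraRatio hd5 f1 f3 hb
    rw [extraBound.eq_def (d + 1), if_neg (by omega)]
    linarith

/-! ### The blocks of the recursion -/

/-- The operation of the leftist circuit that contains `t_j`. -/
def opOf (j : ℕ) : Op := if j % 2 = 0 then Op.and else Op.or

/-- The leftist circuit that contains `t_j`. -/
def Setup.side (P : Setup) (j : ℕ) : Leftist := if j % 2 = 0 then P.S₀ else P.S₁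

/-- The inputs of the leftist circuit that contains `t_j`. -/
def leafOf (j p : ℕ) : ℕ := 2 * p + j % 2

def leafTree (op : Op) (S : Leftist) (lg : ℕ → ℕ) (a₁ b₁ a₂ e : ℕ) (L : List (ℕ × ℕ)) : Alg ℕ := do
  let B₁ ← boundary S lg a₁ b₁
  let B₂ ← boundary S lg a₂ (e + 1)
  symTree op (B₁ ++ B₂) L

def alternatingSplit (P : Setup) (fuel a₁ b₁ a₂ j m k : ℕ) : Alg ℕ := do
  let u ← grinchuk P fuel a₁ b₁ a₂ j k
  let v ← grinchuk P fuel 0 0 (position P.q (j + 1)) (j + k) (m - k)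
  newGate (opOf j) u v

def symmetricSplit (P : Setup) (fuel a₁ b₁ a₂ e j m d : ℕ) : Alg ℕ := do
  let B₁ ← boundary (P.side j) P.lg a₁ b₁
  let B₂ ← boundary (P.side j) P.lg a₂ e
  let r ← triangularSubset (B₁ ++ B₂) d
  let u ← symTree (opOf j) r.2.1 []
  let a ← step ((r.1.head?.map (fun T => T.start)).getD 0)
  let b ← step ((r.1.getLast?.map (fun T => T.start + 2 ^ T.dep)).getD 0)
  let c ← step ((r.2.2.head?.map (fun T => T.start)).getD e)
  let v ← grinchuk P fuel a b c j m
  newGate (opOf j) u v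

def simpleSplit (P : Setup) (fuel a₁ b₁ a₂ e j m : ℕ) : Alg ℕ := do
  let B₁ ← boundary (P.side j) P.lg a₁ b₁
  let B₂ ← boundary (P.side j) P.lg a₂ e
  let u ← symTree (opOf j) (B₁ ++ B₂) []
  let v ← grinchuk P fuel 0 0 e j m
  newGate (opOf j) u v

/-- The branches are definitionally the blocks above, so each of them can be analysed separately. -/
theorem grinchuk_succ (P : Setup) (fuel a₁ b₁ a₂ j m : ℕ) :
    grinchuk P (fuel + 1) a₁ b₁ a₂ j m = (do
      let e ← step (position P.q j)
      if m ≤ 1 then leafTree (opOf j) (P.side j) P.lg a₁ b₁ a₂ e []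
      else if m = 2 then leafTree (opOf j) (P.side j) P.lg a₁ b₁ a₂ e [(0, P.q + j + 1)]
      else do
        let d ← minDepth P.ξ ((b₁ - a₁) + (e - a₂)) m ((b₁ - a₁) + (e - a₂) + m) 1
        if d ≤ 3 then
          if m = 3 then do
            let u ← newGate (opOf j).dual (P.q + j + 1) (P.q + j + 2)
            leafTree (opOf j) (P.side j) P.lg a₁ b₁ a₂ e [(1, u)]
          else if m = 4 then do
            let u ← newGate (opOf j) (P.q + j + 2) (P.q + j + 3)
            let v ← newGate (opOf j).dual (P.q + j + 1) u
            leafTree (opOf j) (P.side j) P.lg a₁ b₁ a₂ e [(2, v)]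
          else alternatingSplit P fuel a₁ b₁ a₂ j m 3
        else if 2 ^ (d - 1) ≤ (b₁ - a₁) + (e - a₂) then symmetricSplit P fuel a₁ b₁ a₂ e j m d
        else do
          let simple ← step (decide ((m : ℚ) ≤ mu P.ξ (d - 1) 0))
          if simple then simpleSplit P fuel a₁ b₁ a₂ e j m
          else do
            let k ← oddPrefix P.ξ (d - 1) ((b₁ - a₁) + (e - a₂))
            alternatingSplit P fuel a₁ b₁ a₂ j m k) := rfl

theorem position_zero (j : ℕ) : position 0 j = j / 2 := by simp [position]

theorem minDepth_spec (ξ : ℚ) (n m : ℕ) : ∀ (fuel d : ℕ) (M : Mem),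
    Spec (minDepth ξ n m fuel d) M fun r M' => d ≤ r ∧ (∃ k ≤ r + 1 - d, M' = M.tick k) ∧
      (∀ d', d ≤ d' → (m : ℚ) ≤ mu ξ d' n → r ≤ d') ∧ ((m : ℚ) ≤ mu ξ r n ∨ r = d + fuel)
  | 0, d, M => Spec.pure ⟨le_rfl, ⟨0, by omega, rfl⟩, fun d' h _ => h, Or.inr rfl⟩
  | fuel + 1, d, M => by
    unfold minDepth
    refine Spec.bind (Spec.step ?_)
    by_cases h : (m : ℚ) ≤ mu ξ d n
    · simp only [h, decide_true, if_true]
      exact Spec.pure ⟨le_rfl, ⟨1, by omega, rfl⟩, fun d' h _ => h, Or.inl h⟩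
    · simp only [h, decide_false, Bool.false_eq_true, if_false]
      refine (minDepth_spec ξ n m fuel (d + 1) _).mono ?_
      rintro r M₁ ⟨h1, ⟨k, hk, rfl⟩, h2, h3⟩
      refine ⟨by omega, ⟨1 + k, by omega, by simp [Mem.tick, add_assoc]⟩, fun d' hd hd' => ?_,
        h3.imp_right (by omega)⟩
      rcases hd.eq_or_lt with rfl | hd
      · exact absurd hd' h
      · exact h2 d' hd hd'

theorem oddPrefix_spec {ξ : ℚ} {d n : ℕ} (h : 1 ≤ mu ξ d n) (M : Mem) :
    Spec (oddPrefix ξ d n) M fun k M' => M' = M.tick 1 ∧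
      ∃ h, k = 2 * h + 1 ∧ (k : ℚ) ≤ mu ξ d n ∧ mu ξ d n - 2 < k := by
  unfold oddPrefix
  refine Spec.bind (Spec.step (Spec.pure ⟨rfl, ?_⟩))
  have h1 : 1 ≤ ⌊mu ξ d n⌋₊ := Nat.le_floor (by simpa using h)
  have h2 := Nat.floor_le (show 0 ≤ mu ξ d n by linarith)
  have h3 := Nat.lt_floor_add_one (mu ξ d n)
  set f := ⌊mu ξ d n⌋₊
  split_ifs with hf
  · exact ⟨f / 2, by omega, h2, by linarith⟩
  · refine ⟨f / 2 - 1, by omega, ?_, ?_⟩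
    · push_cast [h1]; linarith
    · push_cast [h1]; linarith

/-! ### And-Or paths -/

theorem alternating_cons_cons (op : Op) (a b : Bool) (l : List Bool) :
    alternating op (a :: b :: l) = op.apply a (alternating op.dual (b :: l)) := by
  simp [alternating]

@[simp] theorem Op.dual_dual (op : Op) : op.dual.dual = op := by cases op <;> rfl

/-- The values of `t_j, …, t_{j+m-1}`. -/
def inputRange (x : ℕ → Bool) (j m : ℕ) : List Bool := (List.range' j m).map x

theorem inputRange_succ (x : ℕ → Bool) (j m : ℕ) :
    inputRange x j (m + 1) = x j :: inputRange x (j + 1) m := by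
  simp [inputRange, List.range'_succ]

/-- Distributivity: if `G = A ∧ (B ∨ C)`, then `a ∧ (b ∨ G) = (a ∧ (b ∨ A)) ∧ ((b ∨ B) ∨ C)`.
Peeling off two inputs at a time, every second one joins the symmetric inputs of the dual part. -/
theorem alternating_split (x : ℕ → Bool) (op : Op) : ∀ (h j r : ℕ),
    alternating op (inputRange x j (2 * h + 1 + (r + 1))) =
      op.apply (alternating op (inputRange x j (2 * h + 1)))
        (op.dual.apply (rangeValue op.dual x (leafOf (j + 1)) ((j + 1) / 2) h)
          (alternating op.dual (inputRange x (j + (2 * h + 1)) (r + 1))))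
  | 0, j, r => by
    simp only [Nat.mul_zero, zero_add, rangeValue, List.range'_zero, List.map_nil,
      Op.bigOp_nil_apply]
    rw [show 1 + (r + 1) = r + 1 + 1 by omega, inputRange_succ x j, inputRange_succ x (j + 1),
      alternating_cons_cons, inputRange_succ x j 0]
    simp [inputRange, alternating]
  | h + 1, j, r => by
    have ih := alternating_split x op h (j + 2) r
    have e1 : (j + 2 + 1) / 2 = (j + 1) / 2 + 1 := by omega
    have e2 : leafOf (j + 2 + 1) = leafOf (j + 1) := by
      funext p; simp only [leafOf]; omega
    have e3 : leafOf (j + 1) ((j + 1) / 2) = j + 1 := by simp only [leafOf]; omega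
    rw [e1, e2] at ih
    have e4 : rangeValue op.dual x (leafOf (j + 1)) ((j + 1) / 2) (h + 1) =
        op.dual.apply (x (j + 1)) (rangeValue op.dual x (leafOf (j + 1)) ((j + 1) / 2 + 1) h) := by
      rw [rangeValue, List.range'_succ, List.map_cons, bigOp_cons, e3]
      rfl
    rw [e4, show 2 * (h + 1) + 1 + (r + 1) = 2 * h + 1 + (r + 1) + 1 + 1 by omega,
      show 2 * (h + 1) + 1 = 2 * h + 1 + 1 + 1 by omega,
      show j + (2 * h + 1 + 1 + 1) = j + 2 + (2 * h + 1) by omega,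
      inputRange_succ x j, inputRange_succ x (j + 1), inputRange_succ x j,
      inputRange_succ x (j + 1)]
    have e5 : ∀ m, 0 < m → ∃ b l, inputRange x (j + 1 + 1) m = b :: l := fun m hm => by
      obtain ⟨m, rfl⟩ : ∃ m', m = m' + 1 := ⟨m - 1, by omega⟩
      exact ⟨_, _, inputRange_succ x _ m⟩
    obtain ⟨b, l, hl⟩ := e5 (2 * h + 1 + (r + 1)) (by omega)
    obtain ⟨b', l', hl'⟩ := e5 (2 * h + 1) (by omega)
    rw [show j + 2 = j + 1 + 1 by omega, hl, hl'] at ih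
    rw [hl, hl', alternating_cons_cons, alternating_cons_cons, alternating_cons_cons,
      alternating_cons_cons, Op.dual_dual, ih]
    generalize alternating op (b' :: l') = A
    generalize rangeValue _ _ _ _ _ = B
    generalize alternating op.dual _ = C
    cases op <;> cases x j <;> cases x (j + 1) <;> cases A <;> cases B <;> cases C <;> rfl

/-! ### States of the recursion -/

/-- The symmetric inputs of a recursive call, with their boundary tree sequences. -/
structure SymState (S : Leftist) (a₁ b₁ a₂ e : ℕ) (l₁ l₂ : List BTree) : Prop where
  left : Greedy S a₁ b₁ l₁
  right : Greedy S a₂ e l₂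
  le : b₁ ≤ e
  shape : l₁ = [] ∨ Ascending l₁ ∧ Descending l₂

/-- The data that the recursion uses are correct. -/
structure Ready (I : ℕ) (x : ℕ → Bool) (M : Mem) (P : Setup) : Prop where
  q_eq : P.q = 0
  lg_eq : ∀ r, 1 ≤ r → r ≤ I → P.lg r = Nat.log 2 r
  covers : ∀ j, Covers I x M (opOf j) (leafOf j) (P.side j) 0 ((I + 1 - j % 2) / 2)

/-- The value of `f(s, t)` or its dual function. -/
def target (x : ℕ → Bool) (a₁ b₁ a₂ j m : ℕ) : Bool :=
  (opOf j).apply ((opOf j).apply (rangeValue (opOf j) x (leafOf j) a₁ (b₁ - a₁))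
    (rangeValue (opOf j) x (leafOf j) a₂ (j / 2 - a₂))) (alternating (opOf j) (inputRange x j m))

theorem opOf_succ (j : ℕ) : opOf (j + 1) = (opOf j).dual := by
  have h : j % 2 = 0 ∨ j % 2 = 1 := by omega
  rcases h with h | h
  · have : (j + 1) % 2 = 1 := by omega
    simp [opOf, h, this, Op.dual]
  · have : (j + 1) % 2 = 0 := by omega
    simp [opOf, h, this, Op.dual]

theorem opOf_add_odd (j h : ℕ) : opOf (j + (2 * h + 1)) = (opOf j).dual := by
  rw [← opOf_succ]
  simp only [opOf, show (j + (2 * h + 1)) % 2 = (j + 1) % 2 by omega]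

theorem leafOf_add_odd (j h : ℕ) : leafOf (j + (2 * h + 1)) = leafOf (j + 1) := by
  funext p
  simp only [leafOf]; omega

theorem leafOf_half (j : ℕ) : leafOf j (j / 2) = j := by simp only [leafOf]; omega

section
variable {I E : ℕ} {x : ℕ → Bool} {M M' : Mem} {P : Setup} {g τ : ℕ}
variable {S : Leftist} {a₁ b₁ a₂ e : ℕ} {l₁ l₂ : List BTree}

theorem Ready.run (h : Ready I x M P) (r : Run I E x M M' g τ) : Ready I x M' P :=
  ⟨h.1, h.2, fun j => (h.3 j).run r⟩

theorem Ready.lg (h : Ready I x M P) (j : ℕ) :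
    ∀ r, 1 ≤ r → r ≤ (I + 1 - j % 2) / 2 → P.lg r = Nat.log 2 r :=
  fun r h1 h2 => h.lg_eq r h1 (by omega)

theorem SymState.unimodal (h : SymState S a₁ b₁ a₂ e l₁ l₂) :
    ∃ u w, l₁ ++ l₂ = u ++ w ∧ Ascending u ∧ Descending w ∧ ((l₁ = [] ∧ l₂ = u ++ w) ∨
      (l₁ = u ∧ l₂ = w)) := by
  rcases h.shape with rfl | ⟨h1, h2⟩
  · obtain ⟨u, w, rfl, hu, hw⟩ := h.right.unimodal
    exact ⟨u, w, rfl, hu, hw, Or.inl ⟨rfl, rfl⟩⟩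
  · exact ⟨l₁, l₂, rfl, h1, h2, Or.inr ⟨rfl, rfl⟩⟩

theorem SymState.size (h : SymState S a₁ b₁ a₂ e l₁ l₂) :
    treesSize (l₁ ++ l₂) = (b₁ - a₁) + (e - a₂) := by
  have h1 := h.left.tiles.size
  have h2 := h.right.tiles.size
  rw [treesSize_append]; omega

theorem SymState.length_le (h : SymState S a₁ b₁ a₂ e l₁ l₂) {d : ℕ}
    (hd : (b₁ - a₁) + (e - a₂) < 2 ^ d) : (l₁ ++ l₂).length ≤ 2 * d := by
  obtain ⟨u, w, huw, hu, hw, -⟩ := h.unimodal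
  rw [← h.size, huw] at hd
  have hlt : ∀ T ∈ u ++ w, T.dep < d := fun T hT =>
    two_pow_lt_iff.1 ((dep_le_of_mem hT).trans_lt hd)
  have h1 := (hu.bounds fun T hT => hlt T (List.mem_append_left _ hT)).1
  have h2 := (hw.bounds fun T hT => hlt T (List.mem_append_right _ hT)).1
  rw [huw, List.length_append]
  omega

theorem SymState.vertices {op : Op} {leaf : ℕ → ℕ} {N : ℕ} (hS : Covers I x M op leaf S 0 N)
    (h : SymState S a₁ b₁ a₂ e l₁ l₂) (he : e ≤ N) :
    ∀ T ∈ l₁ ++ l₂, T.root < M.next ∧ vdepth I M T.root ≤ T.dep := fun T hT =>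
  (List.mem_append.1 hT).elim (h.left.tiles.vertices hS (h.le.trans he) T)
    (h.right.tiles.vertices hS he T)

theorem SymState.value {op : Op} {leaf : ℕ → ℕ} {N : ℕ} (hS : Covers I x M op leaf S 0 N)
    (h : SymState S a₁ b₁ a₂ e l₁ l₂) (he : e ≤ N) :
    bigOp op ((l₁ ++ l₂).map fun T => value I x M T.root) =
      op.apply (rangeValue op x leaf a₁ (b₁ - a₁)) (rangeValue op x leaf a₂ (e - a₂)) := by
  rw [List.map_append, bigOp_append, h.left.tiles.bigOp_eq hS (h.le.trans he),
    h.right.tiles.bigOp_eq hS he]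

theorem SymState.empty (S : Leftist) {a e : ℕ} {l : List BTree} (h : Greedy S a e l) :
    SymState S 0 0 a e [] l := ⟨rfl, h, Nat.zero_le _, Or.inl rfl⟩

theorem tiles_getLast {i c : ℕ} {l : List BTree} (h : Tiles S i c l) (hl : l ≠ []) :
    l.getLast?.map (fun T => T.start + 2 ^ T.dep) = some c := by
  induction l generalizing i with
  | nil => exact absurd rfl hl
  | cons T l ih =>
    cases l with
    | nil =>
      have h1 := h.1
      have h2 : i + 2 ^ T.dep = c := h.2.2.2
      simp [h1, h2]
    | cons T' l =>
      rw [List.getLast?_cons_cons]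
      exact ih h.2.2.2 (by simp)

/-- The default `0` represents an empty left part as the interval from `0` to `0`; correspondingly
an empty right part below starts at `e`. -/
theorem tiles_prefix {i c : ℕ} {l : List BTree} (h : Tiles S i c l) :
    Tiles S ((l.head?.map (fun T => T.start)).getD 0)
      ((l.getLast?.map (fun T => T.start + 2 ^ T.dep)).getD 0) l ∧
      (l.getLast?.map (fun T => T.start + 2 ^ T.dep)).getD 0 ≤ c := by
  cases l with
  | nil => exact ⟨rfl, Nat.zero_le _⟩
  | cons T l =>
    rw [tiles_getLast h (by simp)]
    have h1 := h.1
    simp only [List.head?_cons, Option.map_some, Option.getD_some, h1]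
    exact ⟨h, le_rfl⟩

theorem tiles_suffix {c e : ℕ} {l : List BTree} (h : Tiles S c e l) :
    Tiles S ((l.head?.map (fun T => T.start)).getD e) e l := by
  cases l with
  | nil => rfl
  | cons T l =>
    have h1 := h.1
    simp only [List.head?_cons, Option.map_some, Option.getD_some, h1]
    exact h

/-- The removed segment contains the peak, so an ascending prefix and a descending suffix remain.
Both are greedy, hence no boundary tree is broken up or newly created. -/
theorem SymState.remove (h : SymState S a₁ b₁ a₂ e l₁ l₂) {u w p u' w' f : List BTree}
    (hu : Ascending u) (hw : Descending w)
    (huw : (l₁ = [] ∧ l₂ = u ++ w) ∨ (l₁ = u ∧ l₂ = w)) (hp : u = p ++ u') (hf : w = w' ++ f) :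
    SymState S ((p.head?.map (fun T => T.start)).getD 0)
      ((p.getLast?.map (fun T => T.start + 2 ^ T.dep)).getD 0)
      ((f.head?.map (fun T => T.start)).getD e) e p f := by
  subst hp hf
  have hpa : Ascending p := (List.pairwise_append.1 hu).1
  have hfd : Descending f := (List.pairwise_append.1 hw).2.1
  have key : ∃ i c c', Tiles S i c p ∧ c ≤ e ∧ Tiles S c' e f := by
    rcases huw with ⟨-, rfl⟩ | ⟨rfl, rfl⟩
    · have ht := h.right.tiles
      rw [List.append_assoc] at ht
      obtain ⟨c, h1, h2⟩ := tiles_append.1 ht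
      rw [← List.append_assoc] at h2
      obtain ⟨c', h3, h4⟩ := tiles_append.1 h2
      have := h2.size
      exact ⟨_, c, c', h1, by omega, h4⟩
    · obtain ⟨c, h1, h2⟩ := tiles_append.1 h.left.tiles
      obtain ⟨c', h3, h4⟩ := tiles_append.1 h.right.tiles
      have := h2.size
      have := h.le
      exact ⟨_, c, c', h1, by omega, h4⟩
  obtain ⟨i, c, c', h1, h2, h3⟩ := key
  obtain ⟨h4, h5⟩ := tiles_prefix h1
  exact ⟨h4.greedy_of_ascending hpa, (tiles_suffix h3).greedy_of_descending hfd, h5.trans h2,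
    Or.inr ⟨hpa, hfd⟩⟩

end

/-! ### Correctness, size and running time of the individual cases -/

section
variable {I E : ℕ} {x : ℕ → Bool} {M M' : Mem} {P : Setup} {g τ : ℕ}
variable {S : Leftist} {a₁ b₁ a₂ e : ℕ} {l₁ l₂ : List BTree}

/-- Including `t_j` costs at most one additional boundary tree, which the root of the Huffman tree
saves again. The time uses that there are at most `2 * D + 1` boundary trees. -/
theorem leafTree_spec {op : Op} {leaf lg : ℕ → ℕ} {N D : ℕ} {L : List (ℕ × ℕ)}
    (hS : Covers I x M op leaf S 0 N) (hlg : ∀ r, 1 ≤ r → r ≤ N → lg r = Nat.log 2 r)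
    (h : Inv I E M) (hs : SymState S a₁ b₁ a₂ e l₁ l₂) (he : e + 1 ≤ N) (hD : D ≤ E)
    (hL : ∀ p ∈ L, p.2 < M.next ∧ vdepth I M p.2 ≤ p.1)
    (hw : (b₁ - a₁) + (e - a₂) + 1 + weight L ≤ 2 ^ D) :
    Spec (leafTree op S lg a₁ b₁ a₂ e L) M fun v M' =>
      ∃ g, Run I E x M M' g (12 * D + 5 * L.length + 7) ∧
        g ≤ l₁.length + l₂.length + L.length ∧
        Good I x M' v D (op.apply (op.apply (op.apply (rangeValue op x leaf a₁ (b₁ - a₁))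
          (rangeValue op x leaf a₂ (e - a₂))) (x (leaf e)))
          (bigOp op (L.map fun p => value I x M p.2))) := by
  have hb := hs.le
  have ha := hs.right.le
  unfold leafTree
  refine Spec.bind ((boundary_spec hS hlg hs.left.le (by omega)).mono ?_)
  rintro B₁ M₁ ⟨rfl, hB₁⟩
  obtain rfl := hB₁.unique hs.left
  refine Spec.bind ((boundary_spec hS hlg (show a₂ ≤ e + 1 by omega) he).mono ?_)
  rintro B₂ M₂ ⟨rfl, hB₂⟩
  have hlen : B₂.length ≤ l₂.length + 1 := by
    have : Tiles S a₂ (e + 1) (l₂ ++ [⟨e, 0, S.desc e 0⟩]) :=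
      tiles_append.2 ⟨e, hs.right.tiles, by simp [Tiles]⟩
    simpa using hB₂.length_le this
  have hlen' := hs.length_le (d := D) (by omega)
  rw [List.length_append] at hlen'
  have hsz₁ := hs.left.tiles.size
  have hsz₂ := hB₂.tiles.size
  have hpos : 0 < B₂.length := by
    rcases B₂ with _ | ⟨T, B₂⟩
    · rw [treesSize_nil] at hsz₂; omega
    · simp
  refine (symTree_spec (x := x) hD ((h.tick _).tick _) (B₁ ++ B₂) L
    (by simp only [List.length_append]; omega) ?_ hL ?_).mono ?_
  · intro T hT
    rcases List.mem_append.1 hT with hT | hT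
    · exact hs.left.tiles.vertices hS (by omega) T hT
    · exact hB₂.tiles.vertices hS he T hT
  · rw [treesSize_append]; omega
  · rintro v M₃ ⟨r, hv⟩
    refine ⟨_, (((Run.tick h _).trans (Run.tick (h.tick _) _)).trans r).weaken le_rfl ?_, ?_, ?_⟩
    · simp only [List.length_append]; omega
    · simp only [List.length_append]; omega
    · have e₁ : bigOp op ((B₁ ++ B₂).map fun T => value I x M T.root) =
          op.apply (op.apply (rangeValue op x leaf a₁ (b₁ - a₁))
          (rangeValue op x leaf a₂ (e - a₂))) (x (leaf e)) := by
        rw [List.map_append, bigOp_append, hs.left.tiles.bigOp_eq hS (by omega),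
          hB₂.tiles.bigOp_eq hS he, show e + 1 - a₂ = e - a₂ + 1 by omega, rangeValue_add,
          show a₂ + (e - a₂) = e by omega, rangeValue_one, Op.apply_assoc]
      simp only [value_tick] at hv
      rwa [e₁] at hv

/-- The outcome of a recursive call: a vertex of depth at most `d` with value `b`, with fewer
than `B` new gates, within time proportional to the number of new gates, with some time left. -/
def Outcome (I E : ℕ) (x : ℕ → Bool) (M : Mem) (rest d : ℕ) (B : ℚ) (b : Bool) (v : ℕ)
    (M' : Mem) : Prop :=
  ∃ g τ, Run I E x M M' g τ ∧ τ + rest ≤ 100 * E * (2 * g + 1) ∧ (g : ℚ) + 1 ≤ B ∧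
    Good I x M' v d b

theorem Outcome.prepend {rest k d : ℕ} {B : ℚ} {b : Bool} {v : ℕ} (r : Run I E x M M' 0 k)
    {M'' : Mem} (h : Outcome I E x M' (rest + k) d B b v M'') :
    Outcome I E x M rest d B b v M'' := by
  obtain ⟨g, τ, h1, h2, h3, h4⟩ := h
  exact ⟨g, k + τ, (r.trans h1).weaken (by omega) le_rfl, by omega, h3, h4⟩

theorem Outcome.weaken {rest rest' d d' : ℕ} {B B' : ℚ} {b : Bool} {v : ℕ}
    (h : Outcome I E x M rest d B b v M') (hr : rest' ≤ rest) (hd : d ≤ d') (hB : B ≤ B') :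
    Outcome I E x M rest' d' B' b v M' := by
  obtain ⟨g, τ, h1, h2, h3, h4⟩ := h
  exact ⟨g, τ, h1, by omega, h3.trans hB, h4.weaken hd⟩

/-- The number `if m = 4 then 5 else m` is the Kraft sum of `t_j` and `L`: `1` for `t_j`, and `2 ^
(m - 2)` for the vertex in `L` if `m ≥ 2`. -/
theorem grinchuk_leaf {fuel j m D : ℕ} (hP : Ready I x M P) (h : Inv I E M)
    (hs : SymState (P.side j) a₁ b₁ a₂ (j / 2) l₁ l₂) (hj : j + m ≤ I) (hm : 1 ≤ m)
    (hm' : m ≤ 2 ∨ m ≤ 4 ∧ (m : ℚ) ≤ mu P.ξ 3 ((b₁ - a₁) + (j / 2 - a₂)))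
    (hw : (b₁ - a₁) + (j / 2 - a₂) + (if m = 4 then 5 else m) ≤ 2 ^ D) (hD : 1 ≤ D)
    (hDE : D ≤ E) :
    Spec (grinchuk P (fuel + 1) a₁ b₁ a₂ j m) M
      (Outcome I E x M 0 D (l₁.length + l₂.length + m) (target x a₁ b₁ a₂ j m)) := by
  have hq := hP.q_eq
  have hE : 1 ≤ E := hD.trans hDE
  have he : j / 2 + 1 ≤ (I + 1 - j % 2) / 2 := by omega
  have hbig : ∀ t g, t ≤ 100 * E → t ≤ 100 * E * (2 * g + 1) := fun t g ht =>
    ht.trans (Nat.le_mul_of_pos_right _ (by omega))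
  rw [grinchuk_succ]
  refine Spec.bind (Spec.step ?_)
  rw [hq, position_zero]
  simp only [zero_add]
  have r₀ := Run.tick (x := x) h 1
  have P₀ := hP.run r₀
  have h₀ := r₀.inv
  have hcase : m = 1 ∨ m = 2 ∨ m = 3 ∨ m = 4 := by omega
  rcases hcase with rfl | rfl | hm34
  · rw [if_pos le_rfl]
    refine (leafTree_spec (P₀.covers j) (P₀.lg j) h₀ hs he hDE (by simp) (by simpa using hw)).mono ?_
    rintro v M₁ ⟨g, r, hg, hv⟩
    refine ⟨g, _, (r₀.trans r).weaken (by omega) le_rfl, hbig _ _ ?_, ?_, ?_⟩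
    · simp only [List.length_nil]; omega
    · have : g ≤ l₁.length + l₂.length := by simpa using hg
      push_cast
      have : (g : ℚ) ≤ l₁.length + l₂.length := by exact_mod_cast this
      linarith
    · convert hv using 1
      rw [target, inputRange_succ, leafOf_half]
      simp [inputRange, alternating]
  · rw [if_neg (by norm_num), if_pos rfl]
    have i₁ := h₀.input (x := x) (v := j + 1) (by omega)
    refine (leafTree_spec (P₀.covers j) (P₀.lg j) h₀ hs he hDE ?_
      (by norm_num at hw ⊢; omega)).mono ?_
    · intro p hp
      obtain rfl := List.mem_singleton.1 hp
      exact ⟨i₁.lt, i₁.depth_le⟩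
    rintro v M₁ ⟨g, r, hg, hv⟩
    refine ⟨g, _, (r₀.trans r).weaken (by omega) le_rfl, hbig _ _ ?_, ?_, ?_⟩
    · simp only [List.length_cons, List.length_nil]; omega
    · have : g ≤ l₁.length + l₂.length + 1 := by simpa using hg
      have : (g : ℚ) ≤ l₁.length + l₂.length + 1 := by exact_mod_cast this
      push_cast
      linarith
    · convert hv using 1
      rw [target, inputRange_succ, inputRange_succ, leafOf_half]
      simp only [List.map_cons, List.map_nil, bigOp_singleton, i₁.value_eq]
      simp [inputRange, alternating, Op.apply_assoc]
  · rw [if_neg (by omega), if_neg (by omega)]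
    have hmu := (hm'.resolve_left (by omega)).2
    refine Spec.bind ((minDepth_spec P.ξ _ m _ 1 _).mono ?_)
    rintro d M₁ ⟨hd1, ⟨k, hk, rfl⟩, hdle, -⟩
    have hd3 : d ≤ 3 := hdle 3 (by norm_num) hmu
    rw [if_pos hd3]
    have r₁ := r₀.trans (Run.tick (x := x) h₀ k)
    have P₁ := hP.run r₁
    have h₁ := r₁.inv
    have i₁ := h₁.input (x := x) (v := j + 1) (by omega)
    have i₂ := h₁.input (x := x) (v := j + 2) (by omega)
    rcases hm34 with rfl | rfl
    · rw [if_pos rfl]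
      refine Spec.bind ((newGate_spec (opOf j).dual h₁ i₁ i₂ hE).mono ?_)
      rintro u M₂ ⟨r₂, hu, -⟩
      have P₂ := P₁.run r₂
      refine (leafTree_spec (P₂.covers j) (P₂.lg j) r₂.inv hs he hDE ?_
        (by norm_num at hw ⊢; omega)).mono ?_
      · intro p hp
        obtain rfl := List.mem_singleton.1 hp
        exact ⟨hu.lt, hu.depth_le⟩
      rintro v M₃ ⟨g, r, hg, hv⟩
      refine ⟨_, _, (r₁.trans r₂).trans r, hbig _ _ ?_, ?_, ?_⟩
      · simp only [List.length_cons, List.length_nil]; omega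
      · have : g ≤ l₁.length + l₂.length + 1 := by simpa using hg
        have : (g : ℚ) ≤ l₁.length + l₂.length + 1 := by exact_mod_cast this
        push_cast
        linarith
      · convert hv using 1
        rw [target, inputRange_succ, inputRange_succ, inputRange_succ, leafOf_half]
        simp only [List.map_cons, List.map_nil, bigOp_singleton, hu.value_eq]
        simp [inputRange, alternating, Op.apply_assoc]
    · rw [if_neg (by norm_num), if_pos rfl]
      have i₃ := h₁.input (x := x) (v := j + 3) (by omega)
      have hD2 : 2 ≤ D := by
        by_contra hc
        have : D = 1 := by omega
        subst this
        simp at hw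
      refine Spec.bind ((newGate_spec (opOf j) h₁ i₂ i₃ hE).mono ?_)
      rintro u M₂ ⟨r₂, hu, -⟩
      have P₂ := P₁.run r₂
      refine Spec.bind ((newGate_spec (opOf j).dual r₂.inv ((i₁.run r₂).weaken (Nat.zero_le 1)) hu
        (by omega)).mono ?_)
      rintro v M₃ ⟨r₃, hv, -⟩
      have P₃ := P₂.run r₃
      refine (leafTree_spec (P₃.covers j) (P₃.lg j) r₃.inv hs he hDE ?_
        (by norm_num at hw ⊢; omega)).mono ?_
      · intro p hp
        obtain rfl := List.mem_singleton.1 hp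
        exact ⟨hv.lt, hv.depth_le⟩
      rintro w M₄ ⟨g, r, hg, hw⟩
      refine ⟨_, _, ((r₁.trans r₂).trans r₃).trans r, hbig _ _ ?_, ?_, ?_⟩
      · simp only [List.length_cons, List.length_nil]; omega
      · have : g ≤ l₁.length + l₂.length + 1 := by simpa using hg
        have : (g : ℚ) ≤ l₁.length + l₂.length + 1 := by exact_mod_cast this
        push_cast
        linarith
      · convert hw using 1
        rw [target, inputRange_succ, inputRange_succ, inputRange_succ, inputRange_succ, leafOf_half]
        simp only [List.map_cons, List.map_nil, bigOp_singleton, hv.value_eq]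
        simp [inputRange, alternating, Op.apply_assoc]

/-- With one new gate, `2 * (g₁ + g₂ + 1) + 1` exceeds `(2 * g₁ + 1) + (2 * g₂ + 1)` by one. This
frees `100 * E` units of time; one pays for the gate, and `99 * E` are left for the preceding work
of the call. -/
theorem alternatingSplit_spec {fuel j m h d : ℕ} {B₁ B₂ : ℚ} (hP : Ready I x M P)
    (hE : d + 1 ≤ E) (hkm : 2 * h + 1 < m)
    (h₁ : Spec (grinchuk P fuel a₁ b₁ a₂ j (2 * h + 1)) M
      (Outcome I E x M 0 d B₁ (target x a₁ b₁ a₂ j (2 * h + 1))))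
    (h₂ : ∀ M', Inv I E M' → Ready I x M' P →
      Spec (grinchuk P fuel 0 0 ((j + 1) / 2) (j + (2 * h + 1)) (m - (2 * h + 1))) M'
        (Outcome I E x M' 0 d B₂
          (target x 0 0 ((j + 1) / 2) (j + (2 * h + 1)) (m - (2 * h + 1))))) :
    Spec (alternatingSplit P fuel a₁ b₁ a₂ j m (2 * h + 1)) M
      (Outcome I E x M (99 * E) (d + 1) (B₁ + B₂) (target x a₁ b₁ a₂ j m)) := by
  unfold alternatingSplit
  rw [hP.q_eq, position_zero]
  refine Spec.bind (h₁.mono ?_)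
  rintro u M₁ ⟨g₁, τ₁, r₁, ht₁, hB₁, hu⟩
  refine Spec.bind ((h₂ M₁ r₁.inv (hP.run r₁)).mono ?_)
  rintro v M₂ ⟨g₂, τ₂, r₂, ht₂, hB₂, hv⟩
  refine (newGate_spec (opOf j) r₂.inv (hu.run r₂) hv hE).mono ?_
  rintro w M₃ ⟨r₃, hw, -⟩
  refine ⟨_, _, (r₁.trans r₂).trans r₃, ?_, ?_, ?_⟩
  · have : 1 ≤ E := by omega
    nlinarith
  · push_cast; linarith
  · convert hw using 1
    obtain ⟨r, rfl⟩ : ∃ r, m = 2 * h + 1 + (r + 1) := ⟨m - (2 * h + 2), by omega⟩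
    rw [show 2 * h + 1 + (r + 1) - (2 * h + 1) = r + 1 by omega]
    simp only [target]
    rw [opOf_add_odd, leafOf_add_odd, alternating_split,
      show (j + (2 * h + 1)) / 2 - (j + 1) / 2 = h by omega]
    simp [rangeValue, Op.apply_assoc]

/-- The tree on `s'` has one gate fewer than boundary trees, and the final gate makes up for this.
So the cost is exactly the number of removed boundary trees, and the others are left to the
recursive call. Since `s'` has exactly `2 ^ d` inputs, its tree has depth at most `d`. -/
theorem symmetricSplit_spec {fuel j m d : ℕ} {T : ℚ} (hP : Ready I x M P) (h : Inv I E M)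
    (hs : SymState (P.side j) a₁ b₁ a₂ (j / 2) l₁ l₂) (hj : j < I) (hd : 1 ≤ d)
    (hE : d + 1 ≤ E) (hn : 2 ^ d ≤ (b₁ - a₁) + (j / 2 - a₂))
    (hn' : (b₁ - a₁) + (j / 2 - a₂) < 2 ^ (d + 1))
    (hrec : ∀ M' a b c p f, Inv I E M' → Ready I x M' P →
      SymState (P.side j) a b c (j / 2) p f →
      (b - a) + (j / 2 - c) = (b₁ - a₁) + (j / 2 - a₂) - 2 ^ d →
      Spec (grinchuk P fuel a b c j m) M'
        (Outcome I E x M' 0 d (p.length + f.length + T) (target x a b c j m))) :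
    Spec (symmetricSplit P fuel a₁ b₁ a₂ (j / 2) j m (d + 1)) M
      (Outcome I E x M (99 * E) (d + 1) (l₁.length + l₂.length + T) (target x a₁ b₁ a₂ j m)) := by
  have he : j / 2 ≤ (I + 1 - j % 2) / 2 := by omega
  have hS := hP.covers j
  have hb := hs.le
  unfold symmetricSplit
  refine Spec.bind ((boundary_spec hS (hP.lg j) hs.left.le (by omega)).mono ?_)
  rintro B₁ M₁ ⟨rfl, hB₁⟩
  obtain rfl := hB₁.unique hs.left
  refine Spec.bind ((boundary_spec hS (hP.lg j) hs.right.le he).mono ?_)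
  rintro B₂ M₂ ⟨rfl, hB₂⟩
  obtain rfl := hB₂.unique hs.right
  have hlen := hs.length_le hn'
  have hsz := hs.size
  have hvert := hs.vertices hS he
  have hval := hs.value hS he
  obtain ⟨u, w, huw, hu, hw, hor⟩ := hs.unimodal
  rw [huw] at hlen hsz hvert hval ⊢
  refine Spec.bind ((triangularSubset_spec hu hw (d := d + 1) (by omega)
    (by rw [hsz]; exact hn) (by rw [hsz]; exact hn')).mono ?_)
  rintro ⟨p, K, f⟩ M₃ ⟨⟨k, hk, rfl⟩, u', w', hp, hf, rfl, hK⟩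
  dsimp only at hp hf ⊢
  have hs' := hs.remove hu hw hor hp hf
  have hKlen : 0 < (u' ++ w').length := List.length_pos_iff.2 fun h0 => by
    rw [h0, treesSize_nil] at hK
    have : 0 < 2 ^ (d + 1 - 1) := by positivity
    omega
  have huw' : u ++ w = p ++ ((u' ++ w') ++ f) := by simp [hp, hf]
  rw [Nat.add_sub_cancel] at hK
  have hvert' : ∀ X ∈ u' ++ w', X.root < M.next ∧ vdepth I M X.root ≤ X.dep := fun X hX =>
    hvert X (by rw [huw']; exact List.mem_append_right _ (List.mem_append_left _ hX))
  have hi := ((h.tick (2 * B₁.length)).tick (2 * B₂.length)).tick k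
  have r₀ : Run I E x M (((M.tick (2 * B₁.length)).tick (2 * B₂.length)).tick k) 0
      (2 * B₁.length + 2 * B₂.length + k) :=
    ((Run.tick h _).trans (Run.tick (h.tick _) _)).trans (Run.tick ((h.tick _).tick _) _)
  refine Spec.bind ((symTree_spec (x := x) (D := d) (op := opOf j) (by omega) hi (u' ++ w') []
    (by simpa using hKlen) hvert' (by simp) (by simp [hK])).mono ?_)
  rintro y M₄ ⟨r₁, hy⟩
  refine Spec.bind (Spec.step (Spec.bind (Spec.step (Spec.bind (Spec.step ?_)))))
  have r₂ := ((Run.tick (x := x) r₁.inv 1).trans (Run.tick (r₁.inv.tick 1) 1)).trans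
    (Run.tick ((r₁.inv.tick 1).tick 1) 1)
  have r₃ := (r₀.trans r₁).trans r₂
  refine Spec.bind ((hrec _ _ _ _ p f r₂.inv (hP.run r₃) hs' ?_).mono ?_)
  · rw [← hs'.size, ← hsz, huw', treesSize_append, treesSize_append, treesSize_append, hK]
    omega
  · rintro z M₅ ⟨g, τ, r₄, ht, hB, hz⟩
    refine (newGate_spec (opOf j) r₄.inv ((hy.run r₂).run r₄) hz hE).mono ?_
    rintro v M₆ ⟨r₅, hv, -⟩
    have hll := congrArg List.length (huw.trans huw')
    have hll' := congrArg List.length huw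
    simp only [List.length_append] at hll hll' hlen hk hKlen
    refine ⟨_, _, (r₃.trans r₄).trans r₅, ?_, ?_, ?_⟩
    · simp only [List.length_append, List.length_nil]
      have : 100 * E * (2 * (0 + (u'.length + w'.length + 0 - 1) + (0 + 0 + 0) + g + 1) + 1) =
          100 * E * (2 * g + 1) + 200 * E * (u'.length + w'.length) := by
        rw [show 0 + (u'.length + w'.length + 0 - 1) + (0 + 0 + 0) + g + 1 =
          u'.length + w'.length + g by omega]
        ring
      rw [this]
      have : 200 * E * 1 ≤ 200 * E * (u'.length + w'.length) := Nat.mul_le_mul_left _ hKlen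
      omega
    · simp only [List.length_append, List.length_nil]
      rw [show 0 + (u'.length + w'.length + 0 - 1) + (0 + 0 + 0) + g + 1 =
          u'.length + w'.length + g by omega]
      have hll'' : (B₁.length : ℚ) + B₂.length =
        p.length + (u'.length + w'.length + f.length) := by exact_mod_cast hll
      push_cast
      linarith
    · convert hv using 1
      have e₁ := hs'.value hS he
      simp only [target]
      rw [← hval, ← e₁, huw']
      simp only [value_tick, List.map_append, bigOp_append, List.map_nil, Op.apply_bigOp_nil]
      generalize bigOp (opOf j) (List.map _ p) = X₁
      generalize bigOp (opOf j) (List.map _ u') = X₂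
      generalize bigOp (opOf j) (List.map _ w') = X₃
      generalize bigOp (opOf j) (List.map _ f) = X₄
      generalize alternating _ _ = X₅
      cases opOf j <;> cases X₁ <;> cases X₂ <;> cases X₃ <;> cases X₄ <;> cases X₅ <;> rfl

theorem simpleSplit_spec {fuel j m d : ℕ} {T : ℚ} (hP : Ready I x M P) (h : Inv I E M)
    (hs : SymState (P.side j) a₁ b₁ a₂ (j / 2) l₁ l₂) (hj : j < I)
    (hE : d + 1 ≤ E) (hn : 0 < (b₁ - a₁) + (j / 2 - a₂))
    (hn' : (b₁ - a₁) + (j / 2 - a₂) < 2 ^ d)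
    (hrec : ∀ M', Inv I E M' → Ready I x M' P →
      Spec (grinchuk P fuel 0 0 (j / 2) j m) M'
        (Outcome I E x M' 0 d T (target x 0 0 (j / 2) j m))) :
    Spec (simpleSplit P fuel a₁ b₁ a₂ (j / 2) j m) M
      (Outcome I E x M (99 * E) (d + 1) (l₁.length + l₂.length + T) (target x a₁ b₁ a₂ j m)) := by
  have he : j / 2 ≤ (I + 1 - j % 2) / 2 := by omega
  have hS := hP.covers j
  have hb := hs.le
  unfold simpleSplit
  refine Spec.bind ((boundary_spec hS (hP.lg j) hs.left.le (by omega)).mono ?_)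
  rintro B₁ M₁ ⟨rfl, hB₁⟩
  obtain rfl := hB₁.unique hs.left
  refine Spec.bind ((boundary_spec hS (hP.lg j) hs.right.le he).mono ?_)
  rintro B₂ M₂ ⟨rfl, hB₂⟩
  obtain rfl := hB₂.unique hs.right
  have hlen := hs.length_le hn'
  have hsz := hs.size
  have hvert := hs.vertices hS he
  have hval := hs.value hS he
  have hlen0 : 0 < (B₁ ++ B₂).length := List.length_pos_iff.2 fun h0 => by
    rw [h0, treesSize_nil] at hsz
    omega
  have r₀ : Run I E x M ((M.tick (2 * B₁.length)).tick (2 * B₂.length)) 0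
      (2 * B₁.length + 2 * B₂.length) := (Run.tick h _).trans (Run.tick (h.tick _) _)
  refine Spec.bind ((symTree_spec (x := x) (D := d) (op := opOf j) (by omega) r₀.inv (B₁ ++ B₂) []
    (by simpa using hlen0) hvert (by simp) (by simp [hsz, hn'.le])).mono ?_)
  rintro y M₄ ⟨r₁, hy⟩
  refine Spec.bind ((hrec _ r₁.inv (hP.run (r₀.trans r₁))).mono ?_)
  rintro z M₅ ⟨g, τ, r₄, ht, hB, hz⟩
  refine (newGate_spec (opOf j) r₄.inv (hy.run r₄) hz hE).mono ?_
  rintro v M₆ ⟨r₅, hv, -⟩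
  simp only [List.length_append] at hlen hlen0
  refine ⟨_, _, ((r₀.trans r₁).trans r₄).trans r₅, ?_, ?_, ?_⟩
  · simp only [List.length_append, List.length_nil]
    rw [show 0 + (B₁.length + B₂.length + 0 - 1) + g + 1 = B₁.length + B₂.length + g by omega]
    have : 100 * E * (2 * (B₁.length + B₂.length + g) + 1) =
        100 * E * (2 * g + 1) + 200 * E * (B₁.length + B₂.length) := by ring
    rw [this]
    have : 200 * E * 1 ≤ 200 * E * (B₁.length + B₂.length) := Nat.mul_le_mul_left _ hlen0
    omega
  · simp only [List.length_append, List.length_nil]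
    rw [show 0 + (B₁.length + B₂.length + 0 - 1) + g + 1 = B₁.length + B₂.length + g by omega]
    push_cast
    linarith
  · convert hv using 1
    simp only [target]
    rw [← hval]
    simp [rangeValue]

end

/-! ### The induction over the recursion -/

section
variable {I E : ℕ} {x : ℕ → Bool} {M M' : Mem} {P : Setup} {g τ : ℕ}

theorem Ready.exists_greedy (hP : Ready I x M P) (j : ℕ) {i e : ℕ} (hie : i ≤ e)
    (he : e ≤ (I + 1 - j % 2) / 2) : ∃ l, Greedy (P.side j) i e l ∧
      2 ^ (l.length + 2) ≤ (e - i + 2) ^ 2 := by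
  have h : Greedy (P.side j) i e _ := (boundary_spec (M := M) (hP.covers j) (hP.lg j) hie he).2
  refine ⟨_, h, ?_⟩
  have hsz := h.tiles.size
  obtain ⟨u, w, huw, hu, hw⟩ := h.unimodal
  rw [huw] at hsz ⊢
  have := sq_two_pow_le hu hw
  rwa [show treesSize (u ++ w) = e - i by omega] at this

theorem lt_of_le_mu_of_mu_lt {ξ : ℚ} (h0 : 0 ≤ ξ) {d n m k : ℕ} (hd : 1 ≤ d)
    (hk : (k : ℚ) ≤ mu ξ d n) (hm : mu ξ d 0 < m) : k < m := by
  have : mu ξ d n ≤ mu ξ d 0 := by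
    rw [le_mu_iff hd, mu_sub_two_mul n hd]
    exact mul_le_mul_of_nonneg_left (by push_cast; linarith [show (0 : ℚ) ≤ n by positivity]) h0
  have : (k : ℚ) < m := by linarith
  exact_mod_cast this

theorem lt_two_pow_of_le_mu {ξ : ℚ} (h0 : 0 ≤ ξ) (h2 : ξ < 2) {d n h : ℕ} (hd : 3 ≤ d)
    (hk : ((2 * h + 1 : ℕ) : ℚ) ≤ mu ξ d n) : h < 2 ^ d := by
  rw [le_mu_iff (by omega)] at hk
  push_cast at hk
  have hn : (0 : ℚ) ≤ n := by positivity
  have hd' : (3 : ℚ) ≤ d := by exact_mod_cast hd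
  have hp : (0 : ℚ) < 2 ^ d := by positivity
  have : (h : ℚ) < ((2 ^ d : ℕ) : ℚ) := by
    by_contra hc
    push_cast at hc
    have h8 : (8 : ℚ) ≤ 2 ^ d := by
      have : 2 ^ 3 ≤ 2 ^ d := two_pow_le_iff.2 hd
      exact_mod_cast this
    have e1 : ξ * ((2 : ℚ) ^ d - n - 2) ≤ ξ * 2 ^ d :=
      mul_le_mul_of_nonneg_left (by linarith) h0
    have e2 : ξ * (2 : ℚ) ^ d ≤ 2 * 2 ^ d := mul_le_mul_of_nonneg_right h2.le hp.le
    nlinarith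
  exact_mod_cast this

/-- The level `d` is any one that admits the input; the algorithm works with the least level `D ≤
d`, and all bounds are monotone in the level. Recursive calls are made at level `D - 1`, so `d`
rounds of recursion suffice. -/
theorem grinchuk_spec (h1 : 1.995 ≤ P.ξ) (h2 : P.ξ < 2) :
    ∀ (fuel d a₁ b₁ a₂ j m : ℕ) (l₁ l₂ : List BTree) (M : Mem), Ready I x M P → Inv I E M →
    SymState (P.side j) a₁ b₁ a₂ (j / 2) l₁ l₂ → j + m ≤ I → 1 ≤ m → 1 ≤ d → d ≤ E → d ≤ fuel →
    (b₁ - a₁) + (j / 2 - a₂) < 2 ^ d → (m : ℚ) ≤ mu P.ξ d ((b₁ - a₁) + (j / 2 - a₂)) →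
    Spec (grinchuk P fuel a₁ b₁ a₂ j m) M
      (Outcome I E x M 0 d (l₁.length + l₂.length + (m + extraBound d m))
        (target x a₁ b₁ a₂ j m))
  | 0, d, a₁, b₁, a₂, j, m, l₁, l₂, M, hP, h, hs, hj, hm, hd, hdE, hf, hn, hmu => by omega
  | fuel + 1, d, a₁, b₁, a₂, j, m, l₁, l₂, M, hP, h, hs, hj, hm, hd, hdE, hf, hn, hmu => by
    have hjI : j < I := by omega
    by_cases hleaf : m ≤ 2 ∨ m ≤ 4 ∧ (m : ℚ) ≤ mu P.ξ 3 ((b₁ - a₁) + (j / 2 - a₂))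
    · refine (grinchuk_leaf hP h hs hj hm hleaf ?_ hd hdE).mono fun v M' ho =>
        ho.weaken le_rfl le_rfl ?_
      · split_ifs with hm4
        · exact add_five_le_two_pow h1 h2 hd (by omega) hmu
        · have hcase : m = 1 ∨ m = 2 ∨ m = 3 := by omega
          rcases hcase with rfl | rfl | rfl
          · omega
          · exact add_two_le_two_pow h1 hd le_rfl hmu
          · exact add_three_le_two_pow h1 h2 hd le_rfl hmu
      · have := extraBound_nonneg d m
        linarith
    · have hm3 : 3 ≤ m := by omega
      rw [grinchuk_succ]
      refine Spec.bind (Spec.step ?_)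
      rw [hP.q_eq, position_zero, if_neg (by omega), if_neg (by omega)]
      set n := (b₁ - a₁) + (j / 2 - a₂) with hnn
      refine Spec.bind ((minDepth_spec P.ξ n m _ 1 _).mono ?_)
      rintro D M₁ ⟨hD1, ⟨k, hk, rfl⟩, hdle, hor⟩
      have hDd : D ≤ d := hdle d hd hmu
      have hDmu : (m : ℚ) ≤ mu P.ξ D n := by
        rcases hor with hor | hor
        · exact hor
        · exact le_mu_self h1 hm3 (by omega)
      have r₀ := (Run.tick (x := x) h 1).trans (Run.tick (h.tick 1) k)
      have P₀ := hP.run r₀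
      have h₀ := r₀.inv
      -- It suffices to treat the least level `D`, with `1 + k` units reserved for the steps already
      -- taken.
      suffices hsuff : Spec _ ((M.tick 1).tick k) (Outcome I E x ((M.tick 1).tick k) (1 + k) D
          (l₁.length + l₂.length + (m + extraBound D m)) (target x a₁ b₁ a₂ j m)) by
        refine hsuff.mono fun v M' ho => ?_
        have ho' : Outcome I E x _ (0 + (1 + k)) D _ _ v M' := ho.weaken (by omega) le_rfl le_rfl
        refine (Outcome.prepend r₀ ho').weaken le_rfl hDd ?_
        have := extraBound_mono hDd m
        linarith
      by_cases hD3 : D ≤ 3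
      · have hmu3 := le_mu_three h1 h2 hD1 hD3 hm3 hDmu
        have hm5 : m = 5 := by
          have := le_five_of_le_mu_three h1 h2 hmu3
          by_contra hne
          exact hleaf (Or.inr ⟨by omega, hmu3⟩)
        subst hm5
        rw [if_pos hD3, if_neg (by norm_num), if_neg (by norm_num)]
        have hn1 := le_one_of_five_le_mu_three h1 h2 hmu3
        have hD : D = 3 := by
          have := add_five_le_two_pow h1 h2 hD1 (by norm_num) hDmu
          interval_cases D <;> omega
        subst hD
        obtain ⟨fuel, rfl⟩ : ∃ f, fuel = f + 1 := ⟨fuel - 1, by omega⟩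
        obtain ⟨l, hl, hlen⟩ := P₀.exists_greedy (j + (2 * 1 + 1)) (i := (j + 1) / 2)
          (e := (j + (2 * 1 + 1)) / 2) (by omega) (by omega)
        have hl1 : l.length ≤ 1 :=
          le_of_two_pow_le hlen (show _ ≤ 1 by omega) (by norm_num)
        -- Both parts are realized directly with depth `2`: their Kraft sums are `n + 3 ≤ 4` and `1
        -- + 2 ≤ 4`. The one symmetric input of the second part gives at most one boundary tree,
        -- which `extraBound 3 5` pays for.
        refine (alternatingSplit_spec (h := 1) P₀ (show 2 + 1 ≤ E by omega) (by norm_num)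
          (grinchuk_leaf P₀ h₀ hs (by omega) (by omega) (Or.inr ⟨by omega, ?_⟩)
            (by norm_num; omega) (by norm_num) (by omega))
          (fun M' hM' PM' => grinchuk_leaf PM' hM' (SymState.empty _ hl) (by omega) (by omega)
            (Or.inl (by omega)) (by norm_num; omega) (by norm_num) (by omega))).mono ?_
        · refine le_trans ?_ hmu3
          norm_num
        · intro v M' ho
          refine ho.weaken (by omega) le_rfl ?_
          have := extraBound_five 3 le_rfl
          have : (l.length : ℚ) ≤ 1 := by exact_mod_cast hl1
          simp only [List.length_nil]
          push_cast
          linarith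
      · obtain ⟨d', rfl⟩ : ∃ d', D = d' + 1 := ⟨D - 1, by omega⟩
        have hd3 : 3 ≤ d' := by omega
        have hn2 := add_two_le_two_pow h1 hD1 (by omega) hDmu
        rw [if_neg hD3, Nat.add_sub_cancel]
        have hmono := extraBound_mono (show d' ≤ d' + 1 by omega) m
        by_cases hsym : 2 ^ d' ≤ n
        · rw [if_pos hsym]
          refine (symmetricSplit_spec (T := m + extraBound d' m) P₀ h₀ hs hjI (by omega) (by omega)
            hsym (by omega) ?_).mono fun v M' ho =>
              ho.weaken (by omega) le_rfl (by linarith)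
          intro M' a b c p f hM' PM' hs' hn'
          rw [← hnn] at hn'
          rw [pow_succ] at hn2
          refine grinchuk_spec h1 h2 fuel d' a b c j m p f M' PM' hM' hs' hj hm (by omega) (by omega)
            (by omega) (by omega) ?_
          rw [hn']
          exact le_mu_symmetricSplit (by omega) hsym (by omega) hDmu
        · rw [if_neg hsym]
          refine Spec.bind (Spec.step ?_)
          have r₁ := Run.tick (x := x) h₀ 1
          have P₁ := P₀.run r₁
          have h₁ := r₁.inv
          by_cases hsimple : (m : ℚ) ≤ mu P.ξ d' 0
          · simp only [hsimple, decide_true, if_true]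
            -- With `n = 0` the smaller level would already be admissible, contradicting minimality.
            have hn0 : 0 < n := by
              by_contra hc
              have hc' : n = 0 := by omega
              have := hdle d' (by omega) (by rwa [hc'])
              omega
            refine (simpleSplit_spec (T := m + extraBound d' m) P₁ h₁ hs hjI (d := d') (by omega)
              hn0 (by omega) ?_).mono fun v M' ho =>
                Outcome.prepend r₁ (ho.weaken (by omega) le_rfl (by linarith))
            intro M' hM' PM'
            have := grinchuk_spec h1 h2 fuel d' 0 0 (j / 2) j m [] [] M' PM' hM'
              (SymState.empty _ rfl) hj hm (by omega) (by omega) (by omega) (by simp)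
              (by simpa using hsimple)
            simpa using this
          · simp only [hsimple, decide_false, Bool.false_eq_true, if_false]
            have hm0 := not_le.1 hsimple
            have hn3 := add_two_le_of_mu_lt h1 h2 hd3 hDmu hm0
            have hmu1 : 1 ≤ mu P.ξ d' n := by
              rw [le_mu_iff (by omega)]
              have hn3' : (n : ℚ) + 2 ≤ 2 ^ d' := by exact_mod_cast hn3
              have : (0 : ℚ) ≤ d' := by positivity
              have : 0 ≤ P.ξ * ((2 : ℚ) ^ d' - n - 2) := mul_nonneg (by linarith) (by linarith)
              linarith
            refine Spec.bind ((oddPrefix_spec hmu1 _).mono ?_)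
            rintro k' M₂ ⟨rfl, s, rfl, hk1, hk2⟩
            have r₂ := r₁.trans (Run.tick (x := x) h₁ 1)
            have P₂ := P₀.run r₂
            have h₂ := r₂.inv
            have hkm := lt_of_le_mu_of_mu_lt (by linarith) (by omega) hk1 hm0
            have hs2 := lt_two_pow_of_le_mu (by linarith) h2 hd3 hk1
            obtain ⟨l, hl, hlen⟩ := P₂.exists_greedy (j + (2 * s + 1)) (i := (j + 1) / 2)
              (e := (j + (2 * s + 1)) / 2) (by omega) (by omega)
            have hse : (j + (2 * s + 1)) / 2 - (j + 1) / 2 = s := by omega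
            rw [hse] at hlen
            have hT := extraBound_split h1 h2 hd3 hDmu hm0 hk1 hkm hlen
            refine (alternatingSplit_spec (d := d') P₂ (by omega) hkm
              (grinchuk_spec h1 h2 fuel d' a₁ b₁ a₂ j (2 * s + 1) l₁ l₂ _ P₂ h₂ hs (by omega)
                (by omega) (by omega) (by omega) (by omega) (by omega) hk1)
              (fun M' hM' PM' => grinchuk_spec h1 h2 fuel d' 0 0 ((j + 1) / 2) (j + (2 * s + 1))
                (m - (2 * s + 1)) [] l M' PM' hM' (SymState.empty _ hl) (by omega) (by omega)
                (by omega) (by omega) (by omega) (by rw [hse]; omega) ?_)).mono ?_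
            · rw [hse, Nat.sub_self, zero_add, Nat.cast_sub hkm.le]
              exact le_mu_alternatingSplit h1 h2 hd3 hDmu hn3 hk2
            · intro v M' ho
              have : Outcome I E x _ (1 + k + (1 + 1)) (d' + 1) _ _ v M' :=
                ho.weaken (by omega) le_rfl le_rfl
              refine (Outcome.prepend r₂ this).weaken le_rfl le_rfl ?_
              rw [Nat.cast_sub hkm.le]
              simp only [List.length_nil]
              push_cast at hT ⊢
              linarith

end

/-! ### The complete run -/

theorem grinchukLeftistRun_spec {ξ : ℚ} (h1 : 1.995 ≤ ξ) (h2 : ξ < 2) {m d : ℕ} (hm : 2 ≤ m)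
    (hd : 1 ≤ d) (hdm : d ≤ m) (hmu : (m : ℚ) ≤ mu ξ d 0) (x : ℕ → Bool) :
    Spec (grinchukLeftistRun ξ 0 m) { next := m, gates := [], time := 0 } fun v M' =>
      Inv m d M' ∧ Good m x M' v d (alternating .and (inputRange x 0 m)) ∧
      ∃ g : ℕ, M'.gates.length ≤ (m - 2) + g ∧ (g : ℚ) + 1 ≤ 267 / 100 * m ∧
        M'.time ≤ 5 * m + 100 * d * (2 * g + 1) := by
  have h₀ : Inv m d { next := m, gates := [], time := 0 } :=
    ⟨rfl, fun i hi => by simp at hi, fun v hv => by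
      rw [vdepth, labels_of_lt _ _ _ _ _ hv]; exact Nat.zero_le _⟩
  -- Needed because all gates count for the depth: the trees of both leftist circuits must have
  -- depth at most `d` too.
  have hE : (m + 1) / 2 ≤ 2 ^ d := by
    rw [le_mu_iff hd] at hmu
    have hm' : (2 : ℚ) ≤ m := by exact_mod_cast hm
    have hd' : (1 : ℚ) ≤ d := by exact_mod_cast hd
    have h3 : (2 : ℚ) ≤ 2 ^ d := by
      have : 2 ^ 1 ≤ 2 ^ d := two_pow_le_iff.2 hd
      exact_mod_cast this
    push_cast at hmu
    have : (m : ℚ) ≤ ((2 * 2 ^ d : ℕ) : ℚ) := by push_cast; nlinarith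
    have : m ≤ 2 * 2 ^ d := by exact_mod_cast this
    omega
  have hleaf₀ : (fun p => if p < 0 then p else 0 + 2 * (p - 0)) = leafOf 0 := by
    funext p; simp [leafOf]
  have hleaf₁ : (fun p => 0 + (2 * p + 1)) = leafOf 1 := by
    funext p; simp [leafOf]
  have hinj : ∀ j, Function.Injective (leafOf j) := fun j p p' h => by
    simp only [leafOf] at h; omega
  unfold grinchukLeftistRun
  simp only [Nat.zero_add m, Nat.zero_add ((m + 1) / 2), hleaf₀, hleaf₁]
  refine Spec.bind ((logTable_spec (x := x) m _ h₀).mono ?_)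
  rintro lg M₁ ⟨r₁, hlg⟩
  refine Spec.bind ((buildLeftist_spec (x := x) .and (hinj 0) ((m + 1) / 2) r₁.inv
    (fun r h h' => hlg r h (by omega)) (fun p hp => by simp only [leafOf]; omega) hE).mono ?_)
  rintro S₀ M₂ ⟨r₂, c₀⟩
  refine Spec.bind ((buildLeftist_spec (x := x) .or (hinj 1) (m / 2) r₂.inv
    (fun r h h' => hlg r h (by omega)) (fun p hp => by simp only [leafOf]; omega)
    (by omega)).mono ?_)
  rintro S₁ M₃ ⟨r₃, c₁⟩
  have c₀' := c₀.run r₃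
  have hready : Ready m x M₃ ⟨ξ, 0, lg, S₀, S₁⟩ := by
    refine ⟨rfl, hlg, fun j => ?_⟩
    have hj : j % 2 = 0 ∨ j % 2 = 1 := by omega
    rcases hj with hj | hj
    · have e : leafOf j = leafOf 0 := by funext p; simp [leafOf, hj]
      rw [e]
      simpa [opOf, Setup.side, hj] using c₀'
    · have e : leafOf j = leafOf 1 := by funext p; simp [leafOf, hj]
      rw [e]
      simpa [opOf, Setup.side, hj] using c₁
  refine (grinchuk_spec h1 h2 m d 0 0 0 0 m [] [] M₃ hready r₃.inv (SymState.empty _ rfl)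
    (by omega) (by omega) hd le_rfl hdm (by simp) (by simpa using hmu)).mono ?_
  rintro v M' ⟨g, τ, r, ht, hg, hv⟩
  have rr := ((r₁.trans r₂).trans r₃).trans r
  refine ⟨r.inv, ?_, g, ?_, ?_, ?_⟩
  · convert hv using 1
    simp [target, rangeValue, opOf]
  · have := rr.gates_le
    simp only [List.length_nil] at this
    omega
  · have := extraBound_le d m
    simp only [List.length_nil] at hg
    push_cast at hg
    linarith
  · have := rr.time_le
    simp only at this
    omega

/-! ### The least level in terms of logarithms -/

theorem exists_minDepth {ξ : ℚ} (h1 : 1.995 ≤ ξ) {m : ℕ} (hm : 2 ≤ m) :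
    ∃ d, 1 ≤ d ∧ d ≤ m ∧ (m : ℚ) ≤ mu ξ d 0 ∧ (m = 2 ∧ d = 1 ∨ ∃ y, d = y + 1 ∧ 1 ≤ y ∧
      mu ξ y 0 < m) := by
  rcases hm.eq_or_lt with rfl | hm
  · exact ⟨1, le_rfl, by norm_num, by simp [mu], Or.inl ⟨rfl, rfl⟩⟩
  · have hex : ∃ d, 1 ≤ d ∧ (m : ℚ) ≤ mu ξ d 0 := ⟨m, by omega, le_mu_self h1 hm (by omega)⟩
    classical
    refine ⟨Nat.find hex, (Nat.find_spec hex).1,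
      Nat.find_min' hex ⟨by omega, le_mu_self h1 hm (by omega)⟩, (Nat.find_spec hex).2, Or.inr ?_⟩
    have h3 := (Nat.find_spec hex).1
    have h4 := (Nat.find_spec hex).2
    have h5 : Nat.find hex ≠ 1 := fun h => by
      rw [h] at h4
      norm_num [mu] at h4
      omega
    refine ⟨Nat.find hex - 1, by omega, by omega, ?_⟩
    have := Nat.find_min hex (show Nat.find hex - 1 < Nat.find hex by omega)
    push Not at this
    exact this (by omega)

/-- Here `0.35 = 1 - 0.65` and `1.2768 = 1.995 * 0.64`. Raising to the 20th power reduces the claim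
to `2 ^ 7 ≤ 1.2768 ^ 20`. -/
theorem two_rpow_le : (2 : ℝ) ^ (0.35 : ℝ) ≤ 1.2768 := by
  have h : ((2 : ℝ) ^ (0.35 : ℝ)) ^ 20 ≤ 1.2768 ^ 20 := by
    rw [← Real.rpow_natCast, ← Real.rpow_mul (by norm_num)]
    norm_num
  exact (pow_le_pow_iff_left₀ (by positivity) (by norm_num) (by norm_num)).1 h

/-- For `y ≥ 2` the hypothesis yields `m * y ≥ 1.995 * 2 ^ y`. A crude first estimate `log₂ m ≥ 0.64
* y` turns this into `m * log₂ m ≥ 1.2768 * 2 ^ y ≥ 2 ^ (y + 0.35)`. -/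
theorem level_le_logb {m y : ℕ} (hm : 3 ≤ m) (hy : 1 ≤ y)
    (h : 1.995 * ((2 : ℝ) ^ y - 2) ≤ ((m : ℝ) - 2) * y) :
    (y : ℝ) + 1 ≤ Real.logb 2 m + Real.logb 2 (Real.logb 2 m) + 0.65 := by
  have hm' : (3 : ℝ) ≤ m := by exact_mod_cast hm
  rcases hy.eq_or_lt with rfl | hy
  · have e1 : (1.5 : ℝ) ≤ Real.logb 2 m := by
      rw [Real.le_logb_iff_rpow_le (by norm_num) (by linarith)]
      have : ((2 : ℝ) ^ (1.5 : ℝ)) ^ 2 ≤ 3 ^ 2 := by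
        rw [← Real.rpow_natCast, ← Real.rpow_mul (by norm_num)]
        norm_num
      exact ((pow_le_pow_iff_left₀ (by positivity) (by norm_num) (by norm_num)).1 this).trans hm'
    have e2 : (0.5 : ℝ) ≤ Real.logb 2 (Real.logb 2 m) := by
      rw [Real.le_logb_iff_rpow_le (by norm_num) (by linarith)]
      have : ((2 : ℝ) ^ (0.5 : ℝ)) ^ 2 ≤ 1.5 ^ 2 := by
        rw [← Real.rpow_natCast, ← Real.rpow_mul (by norm_num)]
        norm_num
      exact ((pow_le_pow_iff_left₀ (by positivity) (by norm_num) (by norm_num)).1 this).trans e1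
    push_cast
    linarith
  · have hy' : (2 : ℝ) ≤ y := by exact_mod_cast hy
    have hmy : 1.995 * (2 : ℝ) ^ y ≤ m * y := by linarith
    have hL : 0.64 * (y : ℝ) ≤ Real.logb 2 m := by
      rw [Real.le_logb_iff_rpow_le (by norm_num) (by linarith)]
      -- This follows from `exp z ≥ exp 1 * z`, as `1.995 * exp 1 * 0.36 * log 2` exceeds `1`.
      have e1 : (y : ℝ) ≤ 1.995 * 2 ^ (0.36 * (y : ℝ)) := by
        rw [Real.rpow_def_of_pos (by norm_num)]
        set z : ℝ := Real.log 2 * (0.36 * y) with hz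
        have h3 := Real.add_one_le_exp (z - 1)
        have h4 : Real.exp z = Real.exp 1 * Real.exp (z - 1) := by
          rw [← Real.exp_add]; congr 1; ring
        have h5 := Real.exp_one_gt_d9
        have h6 := Real.log_two_gt_d9
        have h7 : 0.2495 * (y : ℝ) ≤ z := by rw [hz]; nlinarith
        rw [h4]
        nlinarith [Real.exp_pos (z - 1)]
      have e2 : (2 : ℝ) ^ (0.64 * (y : ℝ)) * 2 ^ (0.36 * (y : ℝ)) = 2 ^ y := by
        rw [← Real.rpow_add (by norm_num), ← Real.rpow_natCast]
        congr 1; ring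
      have e3 : (0 : ℝ) < 2 ^ (0.64 * (y : ℝ)) := by positivity
      have e4 : (2 : ℝ) ^ (0.64 * (y : ℝ)) * y ≤ m * y := by
        refine le_trans ?_ hmy
        rw [← e2]
        nlinarith
      exact le_of_mul_le_mul_right e4 (by linarith)
    have hL0 : 0 < Real.logb 2 m := by linarith
    rw [← Real.logb_mul (by linarith) hL0.ne']
    suffices hs : (y : ℝ) + 0.35 ≤ Real.logb 2 (m * Real.logb 2 m) by linarith
    rw [Real.le_logb_iff_rpow_le (by norm_num) (by positivity), Real.rpow_add (by norm_num),
      Real.rpow_natCast]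
    have e5 : (m : ℝ) * (0.64 * y) ≤ m * Real.logb 2 m :=
      mul_le_mul_of_nonneg_left hL (by linarith)
    have e6 : (2 : ℝ) ^ y * 2 ^ (0.35 : ℝ) ≤ 2 ^ y * 1.2768 :=
      mul_le_mul_of_nonneg_left two_rpow_le (by positivity)
    linarith

theorem exists_level {ξ : ℚ} (h1 : 1.995 ≤ ξ) {m : ℕ} (hm : 2 ≤ m) :
    ∃ d, 1 ≤ d ∧ d ≤ m ∧ (m : ℚ) ≤ mu ξ d 0 ∧
      (d : ℝ) ≤ Real.logb 2 m + Real.logb 2 (Real.logb 2 m) + 0.65 := by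
  obtain ⟨d, hd, hdm, hmu, hor⟩ := exists_minDepth h1 hm
  refine ⟨d, hd, hdm, hmu, ?_⟩
  rcases hor with ⟨rfl, rfl⟩ | ⟨y, rfl, hy, hlt⟩
  · norm_num
  · rw [mu_lt_iff hy] at hlt
    have hp : (2 : ℚ) ≤ 2 ^ y := by
      have : 2 ^ 1 ≤ 2 ^ y := two_pow_le_iff.2 hy
      exact_mod_cast this
    push_cast at hlt
    have hlt' : 1.995 * ((2 : ℚ) ^ y - 2) ≤ ((m : ℚ) - 2) * y := by nlinarith
    have hm3 : 3 ≤ m := by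
      by_contra hc
      have : m = 2 := by omega
      subst this
      norm_num at hlt
      nlinarith
    push_cast
    refine level_le_logb hm3 hy ?_
    have : ((1.995 * ((2 : ℚ) ^ y - 2) : ℚ) : ℝ) ≤ ((((m : ℚ) - 2) * y : ℚ) : ℝ) := by
      exact_mod_cast hlt'
    push_cast at this
    exact this

theorem grinchukLeftist_zero (ξ : ℚ) (m : ℕ) :
    grinchukLeftist ξ 0 m =
      (⟨m, ((grinchukLeftistRun ξ 0 m).run { next := m, gates := [], time := 0 }).2.gates,
        ((grinchukLeftistRun ξ 0 m).run { next := m, gates := [], time := 0 }).1⟩,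
        ((grinchukLeftistRun ξ 0 m).run { next := m, gates := [], time := 0 }).2.time) := by
  simp only [grinchukLeftist, Nat.zero_add]

theorem inputRange_eq_ofFn {m : ℕ} (t : Fin m → Bool) :
    inputRange (fun i => if h : i < m then t ⟨i, h⟩ else false) 0 m = List.ofFn t := by
  refine List.ext_getElem (by simp [inputRange]) fun i h1 h2 => ?_
  have : i < m := by simpa using h2
  simp [inputRange, this]

end AndOrPath

/-! ### The main theorem -/

theorem mainTheorem1 (ξ : ℚ) (hξ : 1.995 ≤ ξ) (hξ' : ξ < 2) :
    (∀ m : ℕ, 2 ≤ m →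
      (AndOrPath.grinchukLeftist ξ 0 m).1.Computes (m := m) AndOrPath.andOrPath ∧
      ((AndOrPath.grinchukLeftist ξ 0 m).1.depth : ℝ) ≤
        Real.logb 2 m + Real.logb 2 (Real.logb 2 m) + 0.65 ∧
      ((AndOrPath.grinchukLeftist ξ 0 m).1.size : ℝ) ≤ 3.67 * m - 2) ∧
    ∃ c : ℝ, ∀ m : ℕ, 2 ≤ m →
      ((AndOrPath.grinchukLeftist ξ 0 m).2 : ℝ) ≤ c * (m * Real.logb 2 m) := by
  -- The time is at most `5 * m + 100 * d * (2 * g + 1)` with `d ≤ 3 * log₂ m` and `2 * g + 1 ≤ 5.34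
  -- * m`, and `5 + 300 * 5.34 < 2000`.
  refine ⟨fun m hm => ?_, 2000, fun m hm => ?_⟩
  · obtain ⟨d, hd, hdm, hmu, hlog⟩ := AndOrPath.exists_level hξ hm
    have key := AndOrPath.grinchukLeftistRun_spec hξ hξ' hm hd hdm hmu
    rw [AndOrPath.grinchukLeftist_zero]
    -- The run does not depend on the assignment, so any one serves for validity, depth and size.
    obtain ⟨hinv, hgood, g, hg1, hg2, -⟩ := key fun _ => false
    refine ⟨⟨⟨hinv.valid, ?_⟩, rfl, fun t => ?_⟩, ?_, ?_⟩
    · have := hgood.lt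
      rw [hinv.next_eq] at this
      exact this
    · have := (key fun i => if h : i < m then t ⟨i, h⟩ else false).2.1.value_eq
      rw [AndOrPath.inputRange_eq_ofFn] at this
      exact this
    · refine le_trans ?_ hlog
      have hdep := hinv.depth_le
      rw [hinv.next_eq] at hdep
      have hD : (AndOrPath.Circuit.depth ⟨m, ((AndOrPath.grinchukLeftistRun ξ 0 m).run
          { next := m, gates := [], time := 0 }).2.gates,
          ((AndOrPath.grinchukLeftistRun ξ 0 m).run
          { next := m, gates := [], time := 0 }).1⟩) ≤ d :=
        Finset.sup_le fun v hv => hdep v (Finset.mem_range.1 hv)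
      exact_mod_cast hD
    · have e1 : (g : ℝ) + 1 ≤ 267 / 100 * m := by
        have : (((g : ℚ) + 1 : ℚ) : ℝ) ≤ ((267 / 100 * m : ℚ) : ℝ) := by exact_mod_cast hg2
        push_cast at this
        exact this
      have e2 : ((((AndOrPath.grinchukLeftistRun ξ 0 m).run
          { next := m, gates := [], time := 0 }).2.gates.length : ℕ) : ℝ) ≤ ((m - 2 + g : ℕ) : ℝ) :=
        by exact_mod_cast hg1
      push_cast [hm] at e2
      refine e2.trans ?_
      linarith
  · obtain ⟨d, hd, hdm, hmu, hlog⟩ := AndOrPath.exists_level hξ hm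
    obtain ⟨-, -, g, -, hg2, ht⟩ :=
      AndOrPath.grinchukLeftistRun_spec hξ hξ' hm hd hdm hmu fun _ => false
    rw [AndOrPath.grinchukLeftist_zero]
    have e1 : (g : ℝ) + 1 ≤ 267 / 100 * m := by
      have : (((g : ℚ) + 1 : ℚ) : ℝ) ≤ ((267 / 100 * m : ℚ) : ℝ) := by exact_mod_cast hg2
      push_cast at this
      exact this
    have e2 : ((((AndOrPath.grinchukLeftistRun ξ 0 m).run
        { next := m, gates := [], time := 0 }).2.time : ℕ) : ℝ) ≤
        ((5 * m + 100 * d * (2 * g + 1) : ℕ) : ℝ) := by exact_mod_cast ht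
    refine e2.trans ?_
    push_cast
    have hm' : (2 : ℝ) ≤ m := by exact_mod_cast hm
    set L := Real.logb 2 m with hL
    have hL1 : 1 ≤ L := by
      rw [hL, Real.le_logb_iff_rpow_le (by norm_num) (by linarith)]
      simpa using hm'
    have hLL : Real.logb 2 L ≤ 2 * (L - 1) := by
      have h3 := Real.log_le_sub_one_of_pos (show 0 < L by linarith)
      have h4 := Real.log_two_gt_d9
      rw [Real.logb, div_le_iff₀ (by linarith)]
      nlinarith
    have hdL : (d : ℝ) ≤ 3 * L := by linarith
    have e3 : 2 * (g : ℝ) + 1 ≤ 5.34 * m := by linarith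
    have e4 : 100 * (d : ℝ) * (2 * g + 1) ≤ 100 * (3 * L) * (5.34 * m) :=
      mul_le_mul (by linarith) e3 (by positivity) (by linarith)
    nlinarith
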